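/- **Theorem (Γ-limit of the discrete regularized spline energy).** *Setting.* Let $V$ be a separable real Hilbert space, compactly (and injectively) embedded in a real Banach space $Y$; regard $\mathcal M=V$ as a manifold. Let $g_y(v,w)=g^c_y(v,w)+Q(v,w)$ ($y\in Y$, $v,w\in V$) be an admissible metric: $g^c$ maps $Y$ into the bounded bilinear forms on $Y$ (with the operator norm), is twice differentiable with bounded first and second derivatives, each $g^c_y$ is symmetric on $V$ and $g^c_y(v,v)\le C^*\|v\|_Y^2$ for $v\in V$; $Q$ is a bounded symmetric positive semi-definite bilinear form on $V$; and $c^*\|v\|_V^2\le g_y(v,v)$ for all $y\in Y$, $v\in V$ with some $c^*>0$. Let $\operatorname{dist}$ be the Riemannian distance of $g$ on $V$ (infimum of lengths of $C^1$ curves), and let $\Gamma_y(v,w)\in V$ be defined by $2g_y(\Gamma_y(v,w),z)=(D_yg_y)(w)(v,z)-(D_yg_y)(z)(v,w)+(D_yg_y)(v)(w,z)$ for all $z\in V$. Let $W[y,z]=W^c[y,z]+Q(y-z,y-z)$ be admissible: $W^c:V\times V\to[0,\infty)$ is of class $C^4$ with derivatives up to order four bounded on bounded sets, $W^c$ is continuous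 along weakly convergent sequences in $V\times V$, there are $\varepsilon,C>0$ with $|W[y,z]-\operatorname{dist}^2(y,z)|\le C\operatorname{dist}^3(y,z)$ whenever $\operatorname{dist}(y,z)\le\varepsilon$, and $W[y,z]\ge\gamma(\|y-z\|_V)$ for some strictly increasing continuous $\gamma:[0,\infty)\to[0,\infty)$ with $\gamma(0)=0$, $\gamma(d)\to\infty$ as $d\to\infty$. Let $\sigma>0$. *Continuous energy.* For $y\in W^{2,2}((0,1);V)$, $$\mathcal F^\sigma[y]=\int_0^1 g_y\big(\ddot y+\Gamma_y(\dot y,\dot y),\,\ddot y+\Gamma_y(\dot y,\dot y)\big)\,dt+\sigma\int_0^1 g_y(\dot y,\dot y)\,dt .$$ *Constraints.* Let $0\le t_1<\dots<t_I\le1$ and $\bar y_1,\dots,\bar y_I\in V$, and choose one boundary condition: natural; Hermite with $v_0,v_1\in V$ (then $t_1=0$, $t_I=1$); or periodic (then $t_1\ne0$ or $t_I\ne1$). $\mathcal I[y]=0$ if $y(t_i)=\bar y_i$ for all $i$ and $y$ satisfies the boundary condition (natural: no condition; Hermite: $\dot y(0)=v_0$, $\dot y(1)=v_1$; periodic: $y(0)=y(1)$,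 $\dot y(0)=\dot y(1)$), and $\mathcal I[y]=\infty$ otherwise. *Discrete energy.* For a positive integer $K$ with all $Kt_i$ integers and $(y_0,\dots,y_K)\in V^{K+1}$ put $\hat K=K-1$ (in the periodic case $\hat K=K$ and $y_{K+1}:=y_1$) and $$\mathbf F^{\sigma,K}[y_0,\dots,y_K]=4K^3\sum_{k=1}^{\hat K}W[y_k,\tilde y_k]+\sigma K\sum_{k=1}^K W[y_{k-1},y_k],\qquad \tilde y_k\in\operatorname*{arg\,min}_{y\in V}\big(W[y_{k-1},y]+W[y,y_{k+1}]\big).$$ With $\tau=1/K$, $t^s=s\tau$, let $\eta_{(y_0,\dots,y_K)}:[0,1]\to V$ be given by $\frac{y_{k-1}+y_k}2+(y_k-y_{k-1})\frac{t-t^{k-1/2}}\tau+(y_{k+1}-2y_k+y_{k-1})\frac{(t-t^{k-1/2})^2}{2\tau^2}$ on $[t^{k-1/2},t^{k+1/2}]$, $1\le k\le K-1$, by $y_0+(y_1-y_0)\frac t\tau$ on $[0,t^{1/2}]$, and by $y_{K-1}+(y_K-y_{K-1})\frac{t-t^{K-1}}\tau$ on $[t^{K-1/2},1]$; in the periodic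 case the quadratic formula is used for $k=1,\dots,K$, with $[t^{K-1/2},t^{K+1/2}]$ identified with $[t^{K-1/2},1]\cup[0,t^{1/2}]$. For $y\in W^{2,2}((0,1);V)$ set $\mathcal F^{\sigma,K}[y]=\mathbf F^{\sigma,K}[y_0,\dots,y_K]$ if $y=\eta_{(y_0,\dots,y_K)}$ for some (necessarily unique) $(y_0,\dots,y_K)$, and $\mathcal F^{\sigma,K}[y]=\infty$ otherwise. Set $\mathcal I^K[y]=0$ if $y=\eta_{(y_0,\dots,y_K)}$ with $y_{Kt_i}=\bar y_i$ for all $i$ and with the discrete boundary condition (natural: none; Hermite: $K(y_1-y_0)=v_0$, $K(y_K-y_{K-1})=v_1$; periodic: $y_0=y_K$), and $\mathcal I^K[y]=\infty$ otherwise. *Claim.* The minimizers $\tilde y_k$ exist. For every choice of the minimizers $\tilde y_k$, as $K\to\infty$ along any sequence of positive integers for which all $Kt_i$ are integers, $$\Gamma\text{-}\lim_{K\to\infty}\big(\mathcal F^{\sigma,K}+\mathcal I^K\big)=\mathcal F^\sigma+\mathcal I$$ with respect to weak convergence in $W^{2,2}((0,1);V)$. That is, $\liminf_K(\mathcal F^{\sigma,K}+\mathcal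 I^K)[y^K]\ge(\mathcal F^\sigma+\mathcal I)[y]$ whenever $y^K\rightharpoonup y$ weakly in $W^{2,2}((0,1);V)$, and for every $y\in W^{2,2}((0,1);V)$ there are $y^K\rightharpoonup y$ with $\limsup_K(\mathcal F^{\sigma,K}+\mathcal I^K)[y^K]\le(\mathcal F^\sigma+\mathcal I)[y]$. -/

import Mathlib

open Set Filter Topology MeasureTheory
open scoped ENNReal

set_option maxSynthPendingDepth 3

noncomputable section

namespace RiemSpline

/-! ### Weak convergence and sequential Gamma-convergence -/

/-- Weak convergence of a sequence in a real normed space: convergence of every continuous linear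
functional. -/
def WeakTendsto {E : Type*} [NormedAddCommGroup E] [NormedSpace ℝ E] (x : ℕ → E) (a : E) : Prop :=
  ∀ φ : E →L[ℝ] ℝ, Tendsto (fun n => φ (x n)) atTop (𝓝 (φ a))

/-- (Sequential) Gamma-convergence with respect to weak convergence: the liminf inequality along
every weakly convergent sequence, and the existence of a weakly convergent recovery sequence. -/
def GammaTendsto {E : Type*} [NormedAddCommGroup E] [NormedSpace ℝ E]
    (F : ℕ → E → ℝ≥0∞) (Flim : E → ℝ≥0∞) : Prop :=
  (∀ (a : E) (x : ℕ → E), WeakTendsto x a → Flim a ≤ liminf (fun n => F n (x n)) atTop) ∧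
  (∀ a : E, ∃ x : ℕ → E, WeakTendsto x a ∧ limsup (fun n => F n (x n)) atTop ≤ Flim a)

section Sobolev

variable (V : Type*) [NormedAddCommGroup V] [NormedSpace ℝ V]

/-- Lebesgue measure on the open unit interval. -/
abbrev unitMeasure : Measure ℝ := volume.restrict (Ioo (0 : ℝ) 1)

/-- The Lebesgue-Bochner space `L²((0,1);V)`. -/
abbrev L2 : Type _ := Lp V 2 unitMeasure

variable {V}

/-- Smooth real test functions with compact support in `(0,1)`. -/
def IsTest (φ : ℝ → ℝ) : Prop :=
  ContDiff ℝ (⊤ : ℕ∞) φ ∧ HasCompactSupport φ ∧ tsupport φ ⊆ Ioo (0 : ℝ) 1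

/-- `v` is the weak derivative of `u` on `(0,1)`. -/
def IsWeakDeriv (u v : L2 V) : Prop :=
  ∀ φ : ℝ → ℝ, IsTest φ →
    ∫ t, deriv φ t • u t ∂unitMeasure = - ∫ t, φ t • v t ∂unitMeasure

theorem L2.integrable_smul {φ : ℝ → ℝ} (hφ : Continuous φ) (hc : HasCompactSupport φ) (u : L2 V) :
    Integrable (fun t => φ t • u t) unitMeasure := by
  obtain ⟨C, hC⟩ := hc.exists_bound_of_continuous hφ
  have hu : Integrable (fun t => u t) unitMeasure := (Lp.memLp u).integrable (by norm_num)
  exact hu.bdd_smul C hφ.aestronglyMeasurable (Eventually.of_forall hC)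

theorem IsTest.continuous_deriv {φ : ℝ → ℝ} (h : IsTest φ) : Continuous (deriv φ) :=
  h.1.continuous_deriv (by norm_num)

theorem IsWeakDeriv.add {u v u' v' : L2 V} (h : IsWeakDeriv u v) (h' : IsWeakDeriv u' v') :
    IsWeakDeriv (u + u') (v + v') := by
  intro φ hφ
  have e1 : ∫ t, deriv φ t • (u + u') t ∂unitMeasure
      = ∫ t, (deriv φ t • u t + deriv φ t • u' t) ∂unitMeasure := by
    refine integral_congr_ae ?_
    filter_upwards [Lp.coeFn_add u u'] with t ht
    rw [ht, Pi.add_apply, smul_add]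
  have e2 : ∫ t, φ t • (v + v') t ∂unitMeasure
      = ∫ t, (φ t • v t + φ t • v' t) ∂unitMeasure := by
    refine integral_congr_ae ?_
    filter_upwards [Lp.coeFn_add v v'] with t ht
    rw [ht, Pi.add_apply, smul_add]
  rw [e1, e2,
    integral_add (L2.integrable_smul hφ.continuous_deriv hφ.2.1.deriv u)
      (L2.integrable_smul hφ.continuous_deriv hφ.2.1.deriv u'),
    integral_add (L2.integrable_smul hφ.1.continuous hφ.2.1 v)
      (L2.integrable_smul hφ.1.continuous hφ.2.1 v'), h φ hφ, h' φ hφ]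
  abel

theorem IsWeakDeriv.smul (c : ℝ) {u v : L2 V} (h : IsWeakDeriv u v) :
    IsWeakDeriv (c • u) (c • v) := by
  intro φ hφ
  have e1 : ∫ t, deriv φ t • (c • u) t ∂unitMeasure
      = ∫ t, c • (deriv φ t • u t) ∂unitMeasure := by
    refine integral_congr_ae ?_
    filter_upwards [Lp.coeFn_smul c u] with t ht
    rw [ht, Pi.smul_apply, smul_comm]
  have e2 : ∫ t, φ t • (c • v) t ∂unitMeasure = ∫ t, c • (φ t • v t) ∂unitMeasure := by
    refine integral_congr_ae ?_
    filter_upwards [Lp.coeFn_smul c v] with t ht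
    rw [ht, Pi.smul_apply, smul_comm]
  rw [e1, e2, integral_smul, integral_smul, h φ hφ, smul_neg]

theorem IsWeakDeriv.zero : IsWeakDeriv (0 : L2 V) 0 := by
  have h : ∀ φ : ℝ → ℝ, ∫ t, φ t • (0 : L2 V) t ∂unitMeasure = 0 := by
    intro φ
    rw [← integral_zero ℝ V (μ := unitMeasure)]
    refine integral_congr_ae ?_
    filter_upwards [Lp.coeFn_zero V 2 unitMeasure] with t ht
    rw [ht, Pi.zero_apply, smul_zero]
  intro φ _
  rw [h, h, neg_zero]

variable (V)

/-- The Sobolev space `W^{2,2}((0,1);V)`: triples `(y, y', y'')` of `L²` functions in which each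
entry is the weak derivative of the preceding one, with the norm
`(‖y‖² + ‖y'‖² + ‖y''‖²)^(1/2)` inherited from the `ℓ²`-product of three copies of `L²`.
(Weak derivatives are unique, so a triple is the same thing as its first entry.) -/
def W22Submodule : Submodule ℝ (PiLp 2 (fun _ : Fin 3 => L2 V)) where
  carrier := {u | IsWeakDeriv (u 0) (u 1) ∧ IsWeakDeriv (u 1) (u 2)}
  add_mem' h h' := ⟨h.1.add h'.1, h.2.add h'.2⟩
  zero_mem' := ⟨IsWeakDeriv.zero, IsWeakDeriv.zero⟩
  smul_mem' c _ h := ⟨h.1.smul c, h.2.smul c⟩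

/-- The Sobolev space as a normed space. -/
abbrev W22 : Type _ := ↥(W22Submodule V)

variable {V}

/-- The curve underlying an element of `W^{2,2}` (as an element of `L²`). -/
def W22.curve (u : W22 V) : L2 V := u.1 0

/-- The velocity (weak derivative). -/
def W22.vel (u : W22 V) : L2 V := u.1 1

/-- The acceleration (second weak derivative). -/
def W22.acc (u : W22 V) : L2 V := u.1 2

/-- The continuous representative on `[0,1]` of `f` takes the value `a` at `t`. -/
def HasValueAt (f : L2 V) (t : ℝ) (a : V) : Prop :=
  ∃ c : ℝ → V, ContinuousOn c (Icc 0 1) ∧ f =ᵐ[unitMeasure] c ∧ c t = a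

end Sobolev

/-! ### Admissible metrics, Riemannian distance, continuous energies -/

section Metric

variable {V Y : Type*} [NormedAddCommGroup V] [InnerProductSpace ℝ V] [CompleteSpace V]
  [NormedAddCommGroup Y] [NormedSpace ℝ Y]


/-- An admissible metric `g_y(v,w) = g^c_y(v,w) + Q(v,w)` on the Hilbert manifold `V`, where
`ι : V → Y` is the embedding.  The compact part `gc` takes values in the bounded bilinear forms on
`Y`, with the operator norm (which restricts to the injective cross norm on `Y' ⊗ Y'`);
the bound `Q(v,v) ≤ C ‖v‖²` is the continuity of the bilinear form `Q`. -/
structure AdmissibleMetric (ι : V →L[ℝ] Y) where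
  gc : Y → (Y →L[ℝ] Y →L[ℝ] ℝ)
  Q : V →L[ℝ] V →L[ℝ] ℝ
  gc_symm : ∀ (y : Y) (v w : V), gc y (ι v) (ι w) = gc y (ι w) (ι v)
  gc_le : ∃ C : ℝ, ∀ (y : Y) (v : V), gc y (ι v) (ι v) ≤ C * ‖ι v‖ ^ 2
  gc_differentiable : Differentiable ℝ gc
  gc_differentiable_fderiv : Differentiable ℝ (fderiv ℝ gc)
  gc_fderiv_le : ∃ C : ℝ, ∀ y : Y, ‖fderiv ℝ gc y‖ ≤ C
  gc_fderiv_fderiv_le : ∃ C : ℝ, ∀ y : Y, ‖fderiv ℝ (fderiv ℝ gc) y‖ ≤ C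
  Q_symm : ∀ v w : V, Q v w = Q w v
  Q_nonneg : ∀ v : V, 0 ≤ Q v v
  coercive : ∃ c : ℝ, 0 < c ∧ ∀ (y : Y) (v : V), c * ‖v‖ ^ 2 ≤ gc y (ι v) (ι v) + Q v v

variable {ι : V →L[ℝ] Y}

namespace AdmissibleMetric

variable (G : AdmissibleMetric ι)

/-- The metric `g_y(v,w)` at the point `y` of the manifold. -/
def g (y v w : V) : ℝ := G.gc (ι y) (ι v) (ι w) + G.Q v w

/-- The derivative `(D_y g_y)(w)(u,v)` of the metric in direction `w` (`Q` does not contribute). -/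
def Dg (y w u v : V) : ℝ := fderiv ℝ G.gc (ι y) (ι w) (ι u) (ι v)

theorem exists_christoffel (y v w : V) :
    ∃ r : V, ∀ z : V, 2 * G.g y r z = G.Dg y w v z - G.Dg y z v w + G.Dg y v w z := by
  let B : V →L[ℝ] V →L[ℝ] ℝ := (G.gc (ι y)).bilinearComp ι ι + G.Q
  have hB : IsCoercive B := by
    obtain ⟨c, hc, h⟩ := G.coercive
    refine ⟨c, hc, fun u => ?_⟩
    have := h (ι y) u
    simp only [B, add_apply, ContinuousLinearMap.bilinearComp_apply]
    nlinarith [this]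
  let D := fderiv ℝ G.gc (ι y)
  let l : V →L[ℝ] ℝ := (1 / 2 : ℝ) •
    ((D (ι w) (ι v)).comp ι - ((D.flip (ι v)).flip (ι w)).comp ι + (D (ι v) (ι w)).comp ι)
  refine ⟨hB.continuousLinearEquivOfBilin.symm ((InnerProductSpace.toDual ℝ V).symm l), fun z => ?_⟩
  have h1 := hB.continuousLinearEquivOfBilin_apply
    (hB.continuousLinearEquivOfBilin.symm ((InnerProductSpace.toDual ℝ V).symm l)) z
  rw [ContinuousLinearEquiv.apply_symm_apply, InnerProductSpace.toDual_symm_apply] at h1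
  have h2 : G.g y (hB.continuousLinearEquivOfBilin.symm
      ((InnerProductSpace.toDual ℝ V).symm l)) z = l z := by
    rw [h1]; simp [B, g]
  rw [h2]
  simp [l, D, Dg]
  ring

/-- The Christoffel operator `Γ_y(v,w)`, i.e. the vector `r` with
`2 g_y(r,z) = (D_y g_y)(w)(v,z) - (D_y g_y)(z)(v,w) + (D_y g_y)(v)(w,z)` for all `z`
(unique because `g_y` is positive definite). -/
def christoffel (y v w : V) : V := (G.exists_christoffel y v w).choose

theorem christoffel_spec (y v w z : V) :
    2 * G.g y (G.christoffel y v w) z = G.Dg y w v z - G.Dg y z v w + G.Dg y v w z :=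
  (G.exists_christoffel y v w).choose_spec z

/-- The Riemannian distance: infimum of the lengths of the `C¹` curves joining two points. -/
def dist (y z : V) : ℝ :=
  sInf {l : ℝ | ∃ γ : ℝ → V, ContDiff ℝ 1 γ ∧ γ 0 = y ∧ γ 1 = z ∧
    l = ∫ t in (0 : ℝ)..1, √(G.g (γ t) (deriv γ t) (deriv γ t))}

/-- The covariant derivative of the velocity along a curve, `y'' + Γ_y(y',y')`. -/
def covAcc (u : W22 V) (t : ℝ) : V :=
  u.acc t + G.christoffel (u.curve t) (u.vel t) (u.vel t)

/-- The path energy. -/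
def pathEnergy (u : W22 V) : ℝ≥0∞ :=
  ∫⁻ t, ENNReal.ofReal (G.g (u.curve t) (u.vel t) (u.vel t)) ∂unitMeasure

/-- The spline energy. -/
def splineEnergy (u : W22 V) : ℝ≥0∞ :=
  ∫⁻ t, ENNReal.ofReal (G.g (u.curve t) (G.covAcc u t) (G.covAcc u t)) ∂unitMeasure

/-- The regularized spline energy. -/
def regSplineEnergy (σ : ℝ) (u : W22 V) : ℝ≥0∞ :=
  G.splineEnergy u + ENNReal.ofReal σ * G.pathEnergy u

end AdmissibleMetric

/-- An admissible approximation `W[y,z] = W^c[y,z] + Q(y-z,y-z)` of the squared Riemannian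
distance. -/
structure AdmissibleEnergy (G : AdmissibleMetric ι) where
  Wc : V → V → ℝ
  Wc_nonneg : ∀ y z : V, 0 ≤ Wc y z
  approx : ∃ ε C : ℝ, 0 < ε ∧ 0 < C ∧ ∀ y z : V, G.dist y z ≤ ε →
    |(Wc y z + G.Q (y - z) (y - z)) - G.dist y z ^ 2| ≤ C * G.dist y z ^ 3
  contDiff : ContDiff ℝ 4 (fun p : V × V => Wc p.1 p.2)
  /-- The `C⁴` norm of `W^c` is finite on bounded sets. -/
  bounded_derivs : ∀ R : ℝ, ∃ C : ℝ, ∀ j : ℕ, j ≤ 4 → ∀ p : V × V, ‖p‖ ≤ R →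
    ‖iteratedFDeriv ℝ j (fun p : V × V => Wc p.1 p.2) p‖ ≤ C
  weak_continuous : ∀ (y z : ℕ → V) (a b : V), WeakTendsto y a → WeakTendsto z b →
    Tendsto (fun n => Wc (y n) (z n)) atTop (𝓝 (Wc a b))
  coercive : ∃ γ : ℝ → ℝ, StrictMonoOn γ (Ici 0) ∧ ContinuousOn γ (Ici 0) ∧ γ 0 = 0 ∧
    Tendsto γ atTop atTop ∧ ∀ y z : V, γ ‖y - z‖ ≤ Wc y z + G.Q (y - z) (y - z)

/-- The functional `W`. -/
def AdmissibleEnergy.W {G : AdmissibleMetric ι} (A : AdmissibleEnergy G) (y z : V) : ℝ :=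
  A.Wc y z + G.Q (y - z) (y - z)

end Metric

/-! ### Boundary conditions and discrete energies -/

section Discrete

variable {V : Type*} [NormedAddCommGroup V] [NormedSpace ℝ V]

/-- The three types of boundary conditions. -/
inductive BoundaryCondition (V : Type*)
  | natural
  | hermite (v₀ v₁ : V)
  | periodic

/-- Compatibility of the boundary condition with the interpolation times: in the Hermite case both
end points are interpolation times, in the periodic case at most one of them is. -/
def BoundaryCondition.Compatible {I : ℕ} (t : Fin I → ℝ) : BoundaryCondition V → Prop
  | natural => True
  | hermite _ _ => (∃ i, t i = 0) ∧ ∃ i, t i = 1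
  | periodic => ¬ ((∃ i, t i = 0) ∧ ∃ i, t i = 1)

/-- The entry `y_k`, `0 ≤ k ≤ K`, of a discrete path `(y_0,…,y_K)`. -/
def node {K : ℕ} (p : Fin (K + 1) → V) (k : ℕ) : V := p (Fin.ofNat (K + 1) k)

/-- The entry `y_{k+1}`, with the convention `y_{K+1} = y_1` in the periodic case. -/
def nextNode {K : ℕ} (bc : BoundaryCondition V) (p : Fin (K + 1) → V) (k : ℕ) : V :=
  match bc with
  | .periodic => if k = K then node p 1 else node p (k + 1)
  | _ => node p (k + 1)

/-- The number of auxiliary points: `K - 1` in general, `K` in the periodic case. -/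
def numAux (bc : BoundaryCondition V) (K : ℕ) : ℕ :=
  match bc with
  | .periodic => K
  | _ => K - 1

/-- `z` minimizes `y ↦ W[a,y] + W[y,b]`. -/
def IsMidpoint (W : V → V → ℝ) (a b z : V) : Prop :=
  IsMinOn (fun y => W a y + W y b) univ z

/-- The points `m k`, `1 ≤ k ≤ numAux bc K`, are admissible auxiliary points for the discrete
path `p`, i.e. `m k` minimizes `W[y_{k-1},·] + W[·,y_{k+1}]`. -/
def IsAux (W : V → V → ℝ) (bc : BoundaryCondition V) {K : ℕ} (p : Fin (K + 1) → V)
    (m : ℕ → V) : Prop :=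
  ∀ k ∈ Finset.Icc 1 (numAux bc K), IsMidpoint W (node p (k - 1)) (nextNode bc p k) (m k)

/-- The discrete path energy. -/
def discretePathEnergy (W : V → V → ℝ) {K : ℕ} (p : Fin (K + 1) → V) : ℝ :=
  K * ∑ k ∈ Finset.Icc 1 K, W (node p (k - 1)) (node p k)

/-- The discrete spline energy with auxiliary points `m k`. -/
def discreteSplineEnergy (W : V → V → ℝ) (bc : BoundaryCondition V) {K : ℕ}
    (p : Fin (K + 1) → V) (m : ℕ → V) : ℝ :=
  4 * (K : ℝ) ^ 3 * ∑ k ∈ Finset.Icc 1 (numAux bc K), W (node p k) (m k)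

/-- The quadratic `(a+b)/2 + (b-a) s + (c-2b+a) s²/2`, `s ∈ [0,1]`, connecting the midpoints of
`a, b` and of `b, c`. -/
def quadPiece (a b c : V) (s : ℝ) : V :=
  (1 / 2 : ℝ) • (a + b) + s • (b - a) + (s ^ 2 / 2) • (c - (2 : ℝ) • b + a)

/-- The interpolation `η_{(y_0,…,y_K)}`.  With `τ = 1/K`, the interval
`[(k-1/2)τ, (k+1/2)τ]` has index `k = ⌊K t + 1/2⌋` and local coordinate `s = K t - (k - 1/2)`.
In the periodic case the last interval is `[(K-1/2)τ, 1]` joined with `[0, τ/2]`. -/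
def interp (bc : BoundaryCondition V) {K : ℕ} (p : Fin (K + 1) → V) (t : ℝ) : V :=
  let k := ⌊(K : ℝ) * t + 1 / 2⌋₊
  let s := (K : ℝ) * t - ((k : ℝ) - 1 / 2)
  match bc with
  | .periodic =>
      if (K : ℝ) * t < 1 / 2 then
        quadPiece (node p (K - 1)) (node p K) (node p 1) ((K : ℝ) * (t + 1) - ((K : ℝ) - 1 / 2))
      else quadPiece (node p (k - 1)) (node p k) (nextNode .periodic p k) s
  | _ =>
      if (K : ℝ) * t ≤ 1 / 2 then node p 0 + ((K : ℝ) * t) • (node p 1 - node p 0)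
      else if (K : ℝ) * t < (K : ℝ) - 1 / 2 then
        quadPiece (node p (k - 1)) (node p k) (node p (k + 1)) s
      else node p (K - 1) + ((K : ℝ) * t - ((K : ℝ) - 1)) • (node p K - node p (K - 1))

/-- The Sobolev curve `u` is the interpolation of the discrete path `p`. -/
def IsInterp (bc : BoundaryCondition V) {K : ℕ} (p : Fin (K + 1) → V) (u : W22 V) : Prop :=
  u.curve =ᵐ[unitMeasure] interp bc p

/-- A functional on discrete paths viewed as a functional on `W^{2,2}`: its value at the (unique)
discrete path of which `u` is the interpolation, and `∞` if there is none. -/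
def liftDiscrete (bc : BoundaryCondition V) {K : ℕ} (Φ : (Fin (K + 1) → V) → ℝ≥0∞)
    (u : W22 V) : ℝ≥0∞ :=
  ⨅ (p : Fin (K + 1) → V) (_ : IsInterp bc p u), Φ p

/-- The discrete regularized spline energy as a functional on `W^{2,2}`; `m p` are the auxiliary
points chosen for the discrete path `p`. -/
def discreteRegSplineEnergy (W : V → V → ℝ) (σ : ℝ) (bc : BoundaryCondition V) (K : ℕ)
    (m : (Fin (K + 1) → V) → ℕ → V) : W22 V → ℝ≥0∞ :=
  liftDiscrete bc fun p =>
    ENNReal.ofReal (discreteSplineEnergy W bc p (m p) + σ * discretePathEnergy W p)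

/-- The boundary condition for Sobolev curves.  The natural boundary condition is not a constraint
on curves in `W^{2,2}`. -/
def BoundaryCondition.Holds : BoundaryCondition V → W22 V → Prop
  | natural, _ => True
  | hermite v₀ v₁, u => HasValueAt u.vel 0 v₀ ∧ HasValueAt u.vel 1 v₁
  | periodic, u => (∃ a, HasValueAt u.curve 0 a ∧ HasValueAt u.curve 1 a) ∧
      ∃ b, HasValueAt u.vel 0 b ∧ HasValueAt u.vel 1 b

/-- The boundary condition for discrete paths. -/
def BoundaryCondition.DiscreteHolds {K : ℕ} : BoundaryCondition V → (Fin (K + 1) → V) → Prop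
  | natural, _ => True
  | hermite v₀ v₁, p => (K : ℝ) • (node p 1 - node p 0) = v₀ ∧
      (K : ℝ) • (node p K - node p (K - 1)) = v₁
  | periodic, p => node p 0 = node p K

open Classical in
/-- The indicator of the interpolation and boundary constraints for Sobolev curves. -/
def constraint {I : ℕ} (t : Fin I → ℝ) (ybar : Fin I → V) (bc : BoundaryCondition V)
    (u : W22 V) : ℝ≥0∞ :=
  if (∀ i, HasValueAt u.curve (t i) (ybar i)) ∧ bc.Holds u then 0 else ⊤

open Classical in
/-- The indicator of the discrete interpolation constraints `y_{K t_i} = ybar_i` and of the discrete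
boundary condition, as a functional on `W^{2,2}`. -/
def discreteConstraint {I : ℕ} (t : Fin I → ℝ) (ybar : Fin I → V) (bc : BoundaryCondition V)
    (K : ℕ) : W22 V → ℝ≥0∞ :=
  liftDiscrete bc fun p : Fin (K + 1) → V =>
    if (∀ i, ∃ k : Fin (K + 1), (k : ℝ) = K * t i ∧ p k = ybar i) ∧ bc.DiscreteHolds p
      then 0 else ⊤

end Discrete

end RiemSpline

end

/-!
Discrete and continuous energies are compared on one and the same curve.  Let `u = η_{(y_0,…,y_K)}`
be the interpolation of a discrete path, with `‖u‖ ≤ M` in `W^{2,2}`.  The second differences of the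
path are `K⁻²` times the values of the piecewise constant `u''`, so each has size `O(K^{-3/2})`, and
the first differences have size `O(K⁻¹)`.

* *Consistency of `W`.*  Comparing `W` with the squared Riemannian distance at small separation
  identifies its second-order Taylor polynomial on the diagonal with the metric, hence
  `W[y,z] = g_y(z-y,z-y) + O(‖z-y‖³)` locally uniformly, and ties the third derivatives of `W` on
  the diagonal to `D g`.
* *Expansion of the midpoints.*  Minimizers of `W[a,·] + W[·,b]` exist by the direct method: `W^c`
  is weakly continuous, `Q` is weakly lower semicontinuous, and the coercivity bounds minimizing
  sequences.  The Euler-Lagrange equation at the minimizer `z` between the neighbours of a node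
  `y_k`, expanded with the third derivatives just mentioned, gives
  `2 (z - y_k) = (y_{k+1} - 2 y_k + y_{k-1}) + Γ_{y_k}(d,d) + O(K^{-5/2})`, where `d` is a first
  difference.  Thus `2 K² (z - y_k)` is the covariant acceleration of `u` up to `O(K^{-1/2})`.
* *Consistency of the energies.*  Summation over the cells bounds the difference between the discrete
  energy of the path and the continuous energy of `u` by a null sequence depending on `M` and `σ`
  (`AdmissibleEnergy.exists_consistency`).

It remains to show the two inequalities for the fixed functional `F^σ`. *Liminf:* the compact
embedding turns weak convergence in `W^{2,2}` into convergence of positions and velocities in `Y` at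
every time. Hence the metric coefficients converge pointwise and the Christoffel terms strongly in
`L²`, and positivity gives weak lower semicontinuity (`AdmissibleMetric.eventually_energy_le`). At a
node the interpolation misses the path by an eighth of a second difference, which vanishes in the
limit, so that the constraints pass to the weak limit. *Limsup:* take the path of nodal values of
`u`. Its interpolation has an acceleration of no larger `L²` norm than `u''` and converges weakly,
hence strongly (`tendsto_eta_nodal`). Moving the second and the last but one node adjusts Hermite
data, and periodic ghost nodes replace natural ones, at a cost controlled by the `L²` norm of `u''`
near the end points (`tendsto_eta_recovery`). The energy is continuous for strong convergence
(`AdmissibleMetric.tendsto_energy`).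
-/

open Set Filter Topology MeasureTheory
open scoped ENNReal

set_option maxSynthPendingDepth 3
set_option linter.unusedSectionVars false

noncomputable section

namespace RiemSpline

/-! ### Taylor's formula -/

section Taylor

variable {E F : Type*} [NormedAddCommGroup E] [NormedSpace ℝ E]
  [NormedAddCommGroup F] [NormedSpace ℝ F]

theorem norm_fderiv_three {f : E → F} (p : E) :
    ‖fderiv ℝ (fderiv ℝ (fderiv ℝ f)) p‖ = ‖iteratedFDeriv ℝ 3 f p‖ := by
  rw [← norm_iteratedFDeriv_fderiv, ← norm_iteratedFDeriv_fderiv, ← norm_iteratedFDeriv_fderiv,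
    norm_iteratedFDeriv_zero]

/-- Taylor's formula of second order, with a remainder bounded on balls. It is obtained by applying
the mean value inequality to the second derivative, to the first-order remainder, and to the
second-order remainder in turn. -/
theorem norm_taylor_two_le {f : E → F} (hf : ContDiff ℝ 3 f) {R C : ℝ} (hC0 : 0 ≤ C)
    (hC : ∀ p, ‖p‖ ≤ R → ‖iteratedFDeriv ℝ 3 f p‖ ≤ C) {p h : E}
    (hp : ‖p‖ + ‖h‖ ≤ R) :
    ‖f (p + h) - f p - fderiv ℝ f p h - (1 / 2 : ℝ) • fderiv ℝ (fderiv ℝ f) p h h‖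
      ≤ C * ‖h‖ ^ 3 := by
  have hf1 : ContDiff ℝ 2 (fderiv ℝ f) := hf.fderiv_right (by norm_num)
  have hf2 : ContDiff ℝ 1 (fderiv ℝ (fderiv ℝ f)) := hf1.fderiv_right (by norm_num)
  have d0 : Differentiable ℝ f := hf.differentiable (by norm_num)
  have d1 : Differentiable ℝ (fderiv ℝ f) := hf1.differentiable (by norm_num)
  have d2 : Differentiable ℝ (fderiv ℝ (fderiv ℝ f)) := hf2.differentiable (by norm_num)
  set s : Set E := Metric.closedBall 0 ‖h‖ with hs
  have hsc : Convex ℝ s := convex_closedBall _ _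
  have h0 : (0 : E) ∈ s := by simp [hs]
  have hmem : ∀ x ∈ s, ‖p + x‖ ≤ R := fun x hx => by
    have : ‖x‖ ≤ ‖h‖ := by simpa [hs] using hx
    linarith [norm_add_le p x]
  have hle : ∀ x ∈ s, ‖x‖ ≤ ‖h‖ := fun x hx => by simpa [hs] using hx
  have shift : ∀ x : E, HasFDerivAt (fun x : E => p + x) (ContinuousLinearMap.id ℝ E) x :=
    fun x => (hasFDerivAt_id x).const_add p
  have s2 : ∀ x ∈ s, ‖fderiv ℝ (fderiv ℝ f) (p + x) - fderiv ℝ (fderiv ℝ f) p‖ ≤ C * ‖h‖ := by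
    intro x hx
    have key := hsc.norm_image_sub_le_of_norm_hasFDerivWithin_le (C := C)
      (f := fun x => fderiv ℝ (fderiv ℝ f) (p + x))
      (f' := fun x => fderiv ℝ (fderiv ℝ (fderiv ℝ f)) (p + x))
      (fun x _ => by
        have := (d2 (p + x)).hasFDerivAt.comp x (shift x)
        exact (this.congr_fderiv (by simp)).hasFDerivWithinAt)
      (fun x hx => (norm_fderiv_three _).trans_le (hC _ (hmem x hx))) h0 hx
    simp only [add_zero, sub_zero] at key
    exact key.trans (mul_le_mul_of_nonneg_left (hle x hx) hC0)
  have s1 : ∀ x ∈ s, ‖fderiv ℝ f (p + x) - fderiv ℝ f p - fderiv ℝ (fderiv ℝ f) p x‖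
      ≤ C * ‖h‖ * ‖h‖ := by
    intro x hx
    have key := hsc.norm_image_sub_le_of_norm_hasFDerivWithin_le (C := C * ‖h‖)
      (f := fun x => fderiv ℝ f (p + x) - fderiv ℝ (fderiv ℝ f) p x)
      (f' := fun x => fderiv ℝ (fderiv ℝ f) (p + x) - fderiv ℝ (fderiv ℝ f) p)
      (fun x _ => by
        have := ((d1 (p + x)).hasFDerivAt.comp x (shift x)).sub
          (fderiv ℝ (fderiv ℝ f) p).hasFDerivAt
        exact (this.congr_fderiv (by simp)).hasFDerivWithinAt)
      s2 h0 hx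
    simp only [add_zero, sub_zero, map_zero] at key
    rw [sub_right_comm] at key
    exact key.trans (mul_le_mul_of_nonneg_left (hle x hx) (by positivity))
  have sym : ∀ x y : E, fderiv ℝ (fderiv ℝ f) p x y = fderiv ℝ (fderiv ℝ f) p y x := fun x y =>
    (hf.contDiffAt (x := p)).isSymmSndFDerivAt (by simp; norm_num) x y
  have key := hsc.norm_image_sub_le_of_norm_hasFDerivWithin_le (C := C * ‖h‖ * ‖h‖)
      (f := fun x => f (p + x) - fderiv ℝ f p x - (1 / 2 : ℝ) • fderiv ℝ (fderiv ℝ f) p x x)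
      (f' := fun x => fderiv ℝ f (p + x) - fderiv ℝ f p - fderiv ℝ (fderiv ℝ f) p x)
      (fun x _ => by
        have hq : HasFDerivAt (fun x => (1 / 2 : ℝ) • fderiv ℝ (fderiv ℝ f) p x x)
            (fderiv ℝ (fderiv ℝ f) p x) x := by
          have h2 := ((fderiv ℝ (fderiv ℝ f) p).hasFDerivAt (x := x)).clm_apply (hasFDerivAt_id x)
          refine (h2.const_smul (1 / 2 : ℝ)).congr_fderiv ?_
          ext z
          simp [sym z x, ← two_smul ℝ, smul_smul]
        have := (((d0 (p + x)).hasFDerivAt.comp x (shift x)).sub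
          (fderiv ℝ f p).hasFDerivAt).sub hq
        exact (this.congr_fderiv (by simp)).hasFDerivWithinAt)
      s1 h0 (show h ∈ s by simp [hs])
  simp only [add_zero, sub_zero, map_zero, smul_zero] at key
  calc _ = ‖f (p + h) - fderiv ℝ f p h - (1 / 2 : ℝ) • fderiv ℝ (fderiv ℝ f) p h h - f p‖ := by
        congr 1; abel
    _ ≤ _ := key
    _ = _ := by ring

end Taylor

/-! ### Bounds for the metric and its Christoffel operator -/

variable {V Y : Type*} [NormedAddCommGroup V] [InnerProductSpace ℝ V] [CompleteSpace V]
  [NormedAddCommGroup Y] [NormedSpace ℝ Y] {ι : V →L[ℝ] Y}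

namespace AdmissibleMetric

variable (G : AdmissibleMetric ι)

/-- The metric `g_y` as a bounded bilinear form on `V`. -/
def bil (y : V) : V →L[ℝ] V →L[ℝ] ℝ := (G.gc (ι y)).bilinearComp ι ι + G.Q

@[simp] theorem bil_apply (y v w : V) : G.bil y v w = G.g y v w := by
  simp [bil, g]

theorem g_symm (y v w : V) : G.g y v w = G.g y w v := by
  simp only [g, G.gc_symm (ι y) v w, G.Q_symm v w]

/-- The constants in the admissibility of the metric, collected: `c` is the coercivity constant,
`L` bounds everything else. -/
structure Bounds (c L : ℝ) : Prop where
  c_pos : 0 < c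
  one_le : 1 ≤ L
  coercive : ∀ y v : V, c * ‖v‖ ^ 2 ≤ G.g y v v
  norm_emb : ‖ι‖ ≤ L
  norm_Q : ‖G.Q‖ ≤ L
  norm_gc_zero : ‖G.gc 0‖ ≤ L
  gc_lip : ∀ y y' : Y, ‖G.gc y - G.gc y'‖ ≤ L * ‖y - y'‖
  norm_fderiv : ∀ y : Y, ‖fderiv ℝ G.gc y‖ ≤ L
  fderiv_lip : ∀ y y' : Y, ‖fderiv ℝ G.gc y - fderiv ℝ G.gc y'‖ ≤ L * ‖y - y'‖

theorem exists_bounds : ∃ c L : ℝ, G.Bounds c L := by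
  obtain ⟨c, hc, h⟩ := G.coercive
  obtain ⟨C1, h1⟩ := G.gc_fderiv_le
  obtain ⟨C2, h2⟩ := G.gc_fderiv_fderiv_le
  have p1 : 0 ≤ C1 := (norm_nonneg _).trans (h1 0)
  have p2 : 0 ≤ C2 := le_trans (norm_nonneg (fderiv ℝ (fderiv ℝ G.gc) 0)) (h2 0)
  have n1 := norm_nonneg ι
  have n2 := norm_nonneg G.Q
  have n3 := norm_nonneg (G.gc 0)
  refine ⟨c, 1 + ‖ι‖ + ‖G.Q‖ + ‖G.gc 0‖ + C1 + C2, hc, by linarith, fun y v => h _ _, by linarith,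
    by linarith, by linarith, fun y y' => ?_, fun y => (h1 y).trans (by linarith), fun y y' => ?_⟩
  · refine (convex_univ.norm_image_sub_le_of_norm_fderiv_le (fun x _ => G.gc_differentiable x)
      (fun x _ => h1 x) (mem_univ y') (mem_univ y)).trans ?_
    exact mul_le_mul_of_nonneg_right (by linarith) (norm_nonneg _)
  · refine (convex_univ.norm_image_sub_le_of_norm_fderiv_le
      (fun x _ => G.gc_differentiable_fderiv x)
      (fun x _ => h2 x) (mem_univ y') (mem_univ y)).trans ?_
    exact mul_le_mul_of_nonneg_right (by linarith) (norm_nonneg _)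

variable {G} {c L : ℝ}

namespace Bounds

variable (hb : G.Bounds c L)
include hb

theorem L_nonneg : 0 ≤ L := by linarith [hb.one_le]

theorem norm_emb_apply (v : V) : ‖ι v‖ ≤ L * ‖v‖ :=
  (ι.le_opNorm v).trans (mul_le_mul_of_nonneg_right hb.norm_emb (norm_nonneg _))

theorem g_sub_le (y y' v w : V) :
    |G.g y v w - G.g y' v w| ≤ L * ‖ι y - ι y'‖ * ‖ι v‖ * ‖ι w‖ := by
  have h : G.g y v w - G.g y' v w = (G.gc (ι y) - G.gc (ι y')) (ι v) (ι w) := by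
    simp [g]
  rw [h, ← Real.norm_eq_abs]
  refine ((G.gc (ι y) - G.gc (ι y')).le_opNorm₂ _ _).trans ?_
  gcongr
  exact hb.gc_lip _ _

theorem g_sub_le' (y y' v w : V) :
    |G.g y v w - G.g y' v w| ≤ L ^ 4 * ‖y - y'‖ * ‖v‖ * ‖w‖ := by
  refine (hb.g_sub_le y y' v w).trans ?_
  have h := hb.L_nonneg
  rw [← map_sub]
  calc L * ‖ι (y - y')‖ * ‖ι v‖ * ‖ι w‖
      ≤ L * (L * ‖y - y'‖) * (L * ‖v‖) * (L * ‖w‖) := by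
        gcongr <;> exact hb.norm_emb_apply _
    _ = _ := by ring

theorem abs_g_le (y v w : V) :
    |G.g y v w| ≤ L ^ 4 * (2 + ‖y‖) * ‖v‖ * ‖w‖ := by
  have h := hb.L_nonneg
  have h1 := hb.one_le
  have e0 : |G.g 0 v w| ≤ L ^ 3 * ‖v‖ * ‖w‖ + L * ‖v‖ * ‖w‖ := by
    have a1 : |G.gc 0 (ι v) (ι w)| ≤ L ^ 3 * ‖v‖ * ‖w‖ := by
      rw [← Real.norm_eq_abs]
      calc _ ≤ ‖G.gc 0‖ * ‖ι v‖ * ‖ι w‖ := (G.gc 0).le_opNorm₂ _ _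
        _ ≤ L * (L * ‖v‖) * (L * ‖w‖) := by
            gcongr
            · exact hb.norm_gc_zero
            · exact hb.norm_emb_apply _
            · exact hb.norm_emb_apply _
        _ = _ := by ring
    have a2 : |G.Q v w| ≤ L * ‖v‖ * ‖w‖ := by
      rw [← Real.norm_eq_abs]
      refine (G.Q.le_opNorm₂ _ _).trans ?_
      gcongr
      exact hb.norm_Q
    have : G.g 0 v w = G.gc 0 (ι v) (ι w) + G.Q v w := by simp [g]
    rw [this]
    exact (abs_add_le _ _).trans (add_le_add a1 a2)
  have e1 := hb.g_sub_le' y 0 v w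
  rw [sub_zero] at e1
  have e2 : |G.g y v w| ≤ |G.g y v w - G.g 0 v w| + |G.g 0 v w| := by
    simpa using abs_add_le (G.g y v w - G.g 0 v w) (G.g 0 v w)
  have hm : 0 ≤ ‖v‖ * ‖w‖ := by positivity
  have e3 : L ^ 3 * (‖v‖ * ‖w‖) ≤ L ^ 4 * (‖v‖ * ‖w‖) := by gcongr; norm_num
  have e4 : L * (‖v‖ * ‖w‖) ≤ L ^ 4 * (‖v‖ * ‖w‖) := by
    gcongr; exact le_self_pow₀ h1 (by norm_num)
  nlinarith

theorem g_self_nonneg (y v : V) : 0 ≤ G.g y v v :=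
  (mul_nonneg hb.c_pos.le (sq_nonneg _)).trans (hb.coercive y v)

theorem abs_Dg_le (y u v w : V) : |G.Dg y u v w| ≤ L * ‖ι u‖ * ‖ι v‖ * ‖ι w‖ := by
  rw [← Real.norm_eq_abs, Dg]
  refine ((fderiv ℝ G.gc (ι y) (ι u)).le_opNorm₂ _ _).trans ?_
  gcongr
  exact ((fderiv ℝ G.gc (ι y)).le_opNorm _).trans (by gcongr; exact hb.norm_fderiv _)

theorem Dg_sub_le (y y' u v w : V) :
    |G.Dg y u v w - G.Dg y' u v w| ≤ L * ‖ι y - ι y'‖ * ‖ι u‖ * ‖ι v‖ * ‖ι w‖ := by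
  have h : G.Dg y u v w - G.Dg y' u v w
      = (fderiv ℝ G.gc (ι y) - fderiv ℝ G.gc (ι y')) (ι u) (ι v) (ι w) := by simp [Dg]
  rw [h, ← Real.norm_eq_abs]
  refine (((fderiv ℝ G.gc (ι y) - fderiv ℝ G.gc (ι y')) (ι u)).le_opNorm₂ _ _).trans ?_
  gcongr
  exact ((fderiv ℝ G.gc (ι y) - fderiv ℝ G.gc (ι y')).le_opNorm _).trans
    (by gcongr; exact hb.fderiv_lip _ _)

/-- A vector is controlled by the functional it represents with respect to `g_y`. -/
theorem norm_le_of_g_le {y d : V} {C : ℝ} (hC : 0 ≤ C) (h : |G.g y d d| ≤ C * ‖d‖) :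
    c * ‖d‖ ≤ C := by
  rcases eq_or_ne d 0 with rfl | hd
  · simpa using hC
  · have hd' : 0 < ‖d‖ := norm_pos_iff.2 hd
    have := (hb.coercive y d).trans ((le_abs_self _).trans h)
    rw [pow_two, ← mul_assoc] at this
    exact le_of_mul_le_mul_right this hd'

theorem christoffel_unique {y v w r : V}
    (h : ∀ z, 2 * G.g y r z = G.Dg y w v z - G.Dg y z v w + G.Dg y v w z) :
    r = G.christoffel y v w := by
  have h0 : ∀ z, G.g y (r - G.christoffel y v w) z = 0 := fun z => by
    have := (h z).trans (G.christoffel_spec y v w z).symm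
    rw [← bil_apply, map_sub, sub_apply, bil_apply, bil_apply]
    linarith
  have h1 := hb.coercive y (r - G.christoffel y v w)
  rw [h0] at h1
  have h2 : ‖r - G.christoffel y v w‖ ^ 2 = 0 :=
    le_antisymm (nonpos_of_mul_nonpos_right h1 hb.c_pos) (sq_nonneg _)
  exact sub_eq_zero.1 (norm_eq_zero.1 (pow_eq_zero_iff (by norm_num) |>.1 h2))

theorem christoffel_smul (y v : V) (a : ℝ) :
    G.christoffel y (a • v) (a • v) = a ^ 2 • G.christoffel y v v := by
  refine (hb.christoffel_unique fun z => ?_).symm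
  have := G.christoffel_spec y v v z
  rw [← bil_apply, map_smul, smul_apply, bil_apply, smul_eq_mul]
  simp only [Dg, map_smul, smul_apply, smul_eq_mul] at this ⊢
  linear_combination a ^ 2 * this

theorem norm_christoffel_le (y v w : V) :
    c * ‖G.christoffel y v w‖ ≤ 2 * L ^ 4 * ‖v‖ * ‖w‖ := by
  have hL := hb.L_nonneg
  refine hb.norm_le_of_g_le (by positivity) (y := y) ?_
  set r := G.christoffel y v w
  have h := G.christoffel_spec y v w r
  have key : ∀ a b e : V, |G.Dg y a b e| ≤ L ^ 4 * ‖a‖ * ‖b‖ * ‖e‖ := fun a b e =>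
    (hb.abs_Dg_le y a b e).trans <| by
      calc _ ≤ L * (L * ‖a‖) * (L * ‖b‖) * (L * ‖e‖) := by
            gcongr <;> exact hb.norm_emb_apply _
        _ = _ := by ring
  have k1 := abs_le.1 (key w v r)
  have k2 := abs_le.1 (key r v w)
  have k3 := abs_le.1 (key v w r)
  have hp : 0 ≤ L ^ 4 * ‖v‖ * ‖w‖ * ‖r‖ := by positivity
  rw [abs_le]
  constructor <;> nlinarith

/-- The Christoffel operator is Lipschitz on bounded sets with respect to the weak norm of `Y`. -/
theorem exists_christoffel_lip (R : ℝ) : ∃ C : ℝ, 0 ≤ C ∧ ∀ y y' v v' : V, ‖v‖ ≤ R → ‖v'‖ ≤ R →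
    ‖G.christoffel y v v - G.christoffel y' v' v'‖ ≤ C * (‖ι y - ι y'‖ + ‖ι v - ι v'‖) := by
  rcases lt_or_ge R 0 with hR | hR
  · exact ⟨0, le_rfl, fun y y' v v' h => absurd (h.trans_lt hR) (not_lt.2 (norm_nonneg _))⟩
  have hL := hb.L_nonneg
  have hc := hb.c_pos
  set D : ℝ := 3 * L ^ 4 * R ^ 2 + 6 * L ^ 3 * R + 4 * L ^ 7 * R ^ 2 / c with hD
  have hD0 : 0 ≤ D := by positivity
  refine ⟨D / (2 * c), by positivity, fun y y' v v' hv hv' => ?_⟩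
  set e := ‖ι y - ι y'‖
  set f := ‖ι v - ι v'‖
  have he : 0 ≤ e := norm_nonneg _
  have hf : 0 ≤ f := norm_nonneg _
  set r := G.christoffel y v v with hr
  set r' := G.christoffel y' v' v' with hr'
  have iv : ‖ι v‖ ≤ L * R := (hb.norm_emb_apply v).trans (by gcongr)
  have iv' : ‖ι v'‖ ≤ L * R := (hb.norm_emb_apply v').trans (by gcongr)
  have nr' : ‖r'‖ ≤ 2 * L ^ 4 * R ^ 2 / c := by
    rw [le_div_iff₀ hc, mul_comm]
    refine (hb.norm_christoffel_le y' v' v').trans ?_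
    calc 2 * L ^ 4 * ‖v'‖ * ‖v'‖ ≤ 2 * L ^ 4 * R * R := by gcongr
      _ = _ := by ring
  have key : c * ‖r - r'‖ ≤ D / 2 * (e + f) := by
    refine hb.norm_le_of_g_le (by positivity) (y := y) ?_
    generalize hz : r - r' = z
    have iz := hb.norm_emb_apply z
    -- test with the difference of the Christoffel vectors; the right-hand side of the defining
    -- equation of the Christoffel operator only sees the compact part of the metric, which is
    -- Lipschitz with respect to the norm of `Y`
    have h1 : G.g y z z = G.g y r z - G.g y' r' z - (G.g y r' z - G.g y' r' z) := by
      nth_rewrite 1 [← hz]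
      rw [← bil_apply, map_sub, sub_apply, bil_apply, bil_apply]; ring
    have h2 := G.christoffel_spec y v v z
    have h3 := G.christoffel_spec y' v' v' z
    rw [← hr] at h2
    rw [← hr'] at h3
    have a1 : |G.Dg y v v z - G.Dg y' v' v' z| ≤ (L ^ 4 * R ^ 2 * e + 2 * L ^ 3 * R * f) * ‖z‖ := by
      have b1 : |G.Dg y v v z - G.Dg y' v v z| ≤ L * e * (L * R) * (L * R) * (L * ‖z‖) :=
        (hb.Dg_sub_le y y' v v z).trans (by gcongr)
      have b2 : |G.Dg y' (v - v') v z| ≤ L * f * (L * R) * (L * ‖z‖) :=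
        (hb.abs_Dg_le y' (v - v') v z).trans (by rw [map_sub]; gcongr)
      have b3 : |G.Dg y' v' (v - v') z| ≤ L * (L * R) * f * (L * ‖z‖) :=
        (hb.abs_Dg_le y' v' (v - v') z).trans (by rw [map_sub]; gcongr)
      have b4 : G.Dg y v v z - G.Dg y' v' v' z = (G.Dg y v v z - G.Dg y' v v z)
          + G.Dg y' (v - v') v z + G.Dg y' v' (v - v') z := by
        simp only [Dg, map_sub, sub_apply]; ring
      rw [b4]
      refine (abs_add_three _ _ _).trans ((add_le_add_three b1 b2 b3).trans (le_of_eq ?_))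
      ring
    have a2 : |G.Dg y z v v - G.Dg y' z v' v'| ≤ (L ^ 4 * R ^ 2 * e + 2 * L ^ 3 * R * f) * ‖z‖ := by
      have b1 : |G.Dg y z v v - G.Dg y' z v v| ≤ L * e * (L * ‖z‖) * (L * R) * (L * R) :=
        (hb.Dg_sub_le y y' z v v).trans (by gcongr)
      have b2 : |G.Dg y' z (v - v') v| ≤ L * (L * ‖z‖) * f * (L * R) :=
        (hb.abs_Dg_le y' z (v - v') v).trans (by rw [map_sub]; gcongr)
      have b3 : |G.Dg y' z v' (v - v')| ≤ L * (L * ‖z‖) * (L * R) * f :=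
        (hb.abs_Dg_le y' z v' (v - v')).trans (by rw [map_sub]; gcongr)
      have b4 : G.Dg y z v v - G.Dg y' z v' v' = (G.Dg y z v v - G.Dg y' z v v)
          + G.Dg y' z (v - v') v + G.Dg y' z v' (v - v') := by
        simp only [Dg, map_sub, sub_apply]; ring
      rw [b4]
      refine (abs_add_three _ _ _).trans ((add_le_add_three b1 b2 b3).trans (le_of_eq ?_))
      ring
    have a3 : |G.g y r' z - G.g y' r' z| ≤ 2 * L ^ 7 * R ^ 2 / c * e * ‖z‖ := by
      refine (hb.g_sub_le y y' r' z).trans ?_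
      calc L * e * ‖ι r'‖ * ‖ι z‖ ≤ L * e * (L * (2 * L ^ 4 * R ^ 2 / c)) * (L * ‖z‖) := by
            gcongr
            exact (hb.norm_emb_apply r').trans (by gcongr)
        _ = _ := by ring
    have hp : 0 ≤ L ^ 7 * R ^ 2 / c * f * ‖z‖ := by positivity
    have hp2 : 0 ≤ L ^ 4 * R ^ 2 * f * ‖z‖ := by positivity
    have hp3 : 0 ≤ L ^ 3 * R * e * ‖z‖ := by positivity
    have hD2 : D / 2 * (e + f) * ‖z‖ = 3 / 2 * ((L ^ 4 * R ^ 2 * e + 2 * L ^ 3 * R * f) * ‖z‖)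
        + 2 * L ^ 7 * R ^ 2 / c * e * ‖z‖ + (3 / 2 * (L ^ 4 * R ^ 2 * f * ‖z‖)
        + 3 * (L ^ 3 * R * e * ‖z‖) + 2 * (L ^ 7 * R ^ 2 / c * f * ‖z‖)) := by
      rw [hD]; ring
    rw [hD2]
    have a1' := abs_le.1 a1
    have a2' := abs_le.1 a2
    have a3' := abs_le.1 a3
    rw [abs_le]
    constructor <;> linarith [a1'.1, a1'.2, a2'.1, a2'.2, a3'.1, a3'.2]
  have e1 : D / (2 * c) * (e + f) = D / 2 * (e + f) / c := by field_simp
  rw [e1, le_div_iff₀ hc, mul_comm]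
  exact key

end Bounds
end AdmissibleMetric
end RiemSpline
end

noncomputable section

namespace RiemSpline

variable {V Y : Type*} [NormedAddCommGroup V] [InnerProductSpace ℝ V] [CompleteSpace V]
  [NormedAddCommGroup Y] [NormedSpace ℝ Y] {ι : V →L[ℝ] Y}

/-! ### The Riemannian distance near the diagonal -/

namespace AdmissibleMetric

variable (G : AdmissibleMetric ι)

theorem continuous_g {α : Type*} [TopologicalSpace α] {γ η ζ : α → V} (hγ : Continuous γ)
    (hη : Continuous η) (hζ : Continuous ζ) : Continuous fun t => G.g (γ t) (η t) (ζ t) := by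
  have h1 : Continuous fun t => G.gc (ι (γ t)) :=
    G.gc_differentiable.continuous.comp (ι.continuous.comp hγ)
  exact ((h1.clm_apply (ι.continuous.comp hη)).clm_apply (ι.continuous.comp hζ)).add
    ((G.Q.continuous.comp hη).clm_apply hζ)

/-- The length of a curve over the unit interval. -/
def length (γ : ℝ → V) : ℝ := ∫ t in (0 : ℝ)..1, √(G.g (γ t) (deriv γ t) (deriv γ t))

theorem length_nonneg (γ : ℝ → V) : 0 ≤ G.length γ :=
  intervalIntegral.integral_nonneg (by norm_num) fun _ _ => Real.sqrt_nonneg _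

theorem dist_le_length {γ : ℝ → V} (hγ : ContDiff ℝ 1 γ) : G.dist (γ 0) (γ 1) ≤ G.length γ :=
  csInf_le ⟨0, by rintro l ⟨γ, -, -, -, rfl⟩; exact G.length_nonneg γ⟩ ⟨γ, hγ, rfl, rfl, rfl⟩

theorem contDiff_segment (y d : V) : ContDiff ℝ 1 fun t : ℝ => y + t • d :=
  contDiff_const.add (contDiff_id.smul contDiff_const)

theorem exists_length_lt {y z : V} {l : ℝ} (h : G.dist y z < l) :
    ∃ γ : ℝ → V, ContDiff ℝ 1 γ ∧ γ 0 = y ∧ γ 1 = z ∧ G.length γ < l := by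
  have hne : {l : ℝ | ∃ γ : ℝ → V, ContDiff ℝ 1 γ ∧ γ 0 = y ∧ γ 1 = z ∧
      l = ∫ t in (0 : ℝ)..1, √(G.g (γ t) (deriv γ t) (deriv γ t))}.Nonempty :=
    ⟨_, fun t : ℝ => y + t • (z - y), contDiff_segment y (z - y), by simp, by simp, rfl⟩
  obtain ⟨_, ⟨γ, h1, h2, h3, rfl⟩, h5⟩ := exists_lt_of_csInf_lt hne h
  exact ⟨γ, h1, h2, h3, h5⟩

theorem dist_nonneg (y z : V) : 0 ≤ G.dist y z :=
  Real.sInf_nonneg (by rintro l ⟨γ, -, -, -, rfl⟩; exact G.length_nonneg γ)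

theorem dist_self (y : V) : G.dist y y = 0 := by
  refine le_antisymm ?_ (G.dist_nonneg y y)
  have h := G.dist_le_length (contDiff_const (c := y) : ContDiff ℝ 1 fun _ : ℝ => y)
  have h0 : G.length (fun _ => y) = 0 := by simp [length, g]
  rwa [h0] at h

namespace Bounds

variable {G} {c L : ℝ} (hb : G.Bounds c L)
include hb

/-- The straight segment bounds the distance from above. -/
theorem dist_sq_le (y z : V) : G.dist y z ^ 2 ≤ G.g y (z - y) (z - y) + L ^ 4 * ‖z - y‖ ^ 3 := by
  set d := z - y with hd
  have hL := hb.L_nonneg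
  set M := G.g y d d + L ^ 4 * ‖d‖ ^ 3
  have hM : 0 ≤ M := add_nonneg (hb.g_self_nonneg _ _) (by positivity)
  have hder : ∀ t, deriv (fun t : ℝ => y + t • d) t = d := fun t => by
    simpa using (((hasDerivAt_id t).smul_const d).const_add y).deriv
  have h1 := G.dist_le_length (contDiff_segment y d)
  simp only [zero_smul, add_zero, one_smul] at h1
  rw [show y + d = z by simp [hd]] at h1
  have h2 : G.length (fun t : ℝ => y + t • d) ≤ √M := by
    have : ∫ _ in (0 : ℝ)..1, √M = √M := by simp
    rw [length, ← this]
    refine intervalIntegral.integral_mono_on (by norm_num) ?_ (by simp) fun t ht => ?_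
    · simp only [hder]
      exact (G.continuous_g (contDiff_segment y d).continuous continuous_const
        continuous_const).sqrt.intervalIntegrable _ _
    · rw [hder]
      refine Real.sqrt_le_sqrt ?_
      have h3 := (abs_le.1 (hb.g_sub_le' (y + t • d) y d d)).2
      have h4 : ‖y + t • d - y‖ ≤ ‖d‖ := by
        rw [add_sub_cancel_left, norm_smul, Real.norm_eq_abs, abs_of_nonneg ht.1]
        exact mul_le_of_le_one_left (norm_nonneg _) ht.2
      have h5 : L ^ 4 * ‖y + t • d - y‖ * ‖d‖ * ‖d‖ ≤ L ^ 4 * ‖d‖ * ‖d‖ * ‖d‖ := by gcongr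
      have h6 : L ^ 4 * ‖d‖ * ‖d‖ * ‖d‖ = L ^ 4 * ‖d‖ ^ 3 := by ring
      simp only [M]
      linarith
  calc G.dist y z ^ 2 ≤ √M ^ 2 := pow_le_pow_left₀ (G.dist_nonneg _ _) (h1.trans h2) 2
    _ = M := Real.sq_sqrt hM

theorem g_sq_le (y v w : V) : G.g y v w ^ 2 ≤ G.g y v v * G.g y w w := by
  have h : ∀ x : ℝ, 0 ≤ G.g y v v * (x * x) + 2 * G.g y v w * x + G.g y w w := fun x => by
    have h0 := hb.g_self_nonneg y (x • v + w)
    have h1 : G.g y (x • v + w) (x • v + w)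
        = G.g y v v * (x * x) + 2 * G.g y v w * x + G.g y w w := by
      rw [← bil_apply]
      simp only [map_add, map_smul, add_apply, smul_apply, bil_apply, smul_eq_mul,
        G.g_symm y w v]
      ring
    rwa [h1] at h0
  have := discrim_le_zero h
  rw [discrim] at this
  nlinarith

/-- A lower bound for the length of a curve: along a curve of length `ℓ` the metric changes at most
by a factor `1 - κ ℓ`. -/
theorem le_length_sq {γ : ℝ → V} (hγ : ContDiff ℝ 1 γ) :
    G.g (γ 0) (γ 1 - γ 0) (γ 1 - γ 0) * (1 - L ^ 4 / (c * √c) * G.length γ) ≤ G.length γ ^ 2 := by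
  have hL := hb.L_nonneg
  have hc := hb.c_pos
  have hsc : 0 < √c := Real.sqrt_pos.2 hc
  set ℓ := G.length γ with hℓ
  have hℓ0 : 0 ≤ ℓ := G.length_nonneg γ
  set d := γ 1 - γ 0 with hd
  set y := γ 0 with hy
  set κ := L ^ 4 / (c * √c)
  have hdγ : Continuous (deriv γ) := hγ.continuous_deriv le_rfl
  have hg0 := hb.g_self_nonneg y d
  -- for long curves the left-hand side is nonpositive
  rcases le_or_gt (1 - κ * ℓ) 0 with hneg | hpos
  · exact (mul_nonpos_of_nonneg_of_nonpos hg0 hneg).trans (sq_nonneg _)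
  have hcont : Continuous fun t => √(G.g (γ t) (deriv γ t) (deriv γ t)) :=
    (G.continuous_g hγ.continuous hdγ hdγ).sqrt
  have hint : ∀ a b, ∫ t in a..b, deriv γ t = γ b - γ a := fun a b =>
    intervalIntegral.integral_deriv_eq_sub (fun x _ => hγ.differentiable (by norm_num) x)
      (hdγ.intervalIntegrable _ _)
  have hpt : ∀ t ∈ Icc (0 : ℝ) 1, √c * ‖γ t - y‖ ≤ ℓ := fun t ht => by
    rw [hy, ← hint 0 t]
    calc √c * ‖∫ s in (0 : ℝ)..t, deriv γ s‖ ≤ √c * ∫ s in (0 : ℝ)..t, ‖deriv γ s‖ := by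
          gcongr; exact intervalIntegral.norm_integral_le_integral_norm ht.1
      _ = ∫ s in (0 : ℝ)..t, √c * ‖deriv γ s‖ := by rw [intervalIntegral.integral_const_mul]
      _ ≤ ∫ s in (0 : ℝ)..t, √(G.g (γ s) (deriv γ s) (deriv γ s)) := by
          refine intervalIntegral.integral_mono_on ht.1
            ((hdγ.norm.const_mul _).intervalIntegrable _ _) (hcont.intervalIntegrable _ _)
            fun s _ => ?_
          refine Real.le_sqrt_of_sq_le ?_
          rw [mul_pow, Real.sq_sqrt hc.le]
          exact hb.coercive _ _
      _ ≤ ℓ := by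
          rw [hℓ, length]
          exact intervalIntegral.integral_mono_interval le_rfl ht.1 ht.2
            (Eventually.of_forall fun _ => Real.sqrt_nonneg _) (hcont.intervalIntegrable _ _)
  have hmet : ∀ t ∈ Icc (0 : ℝ) 1, ∀ v, (1 - κ * ℓ) * G.g y v v ≤ G.g (γ t) v v := fun t ht v => by
    have h1 := (abs_le.1 (hb.g_sub_le' (γ t) y v v)).1
    have h2 : ‖γ t - y‖ ≤ ℓ / √c := by rw [le_div_iff₀ hsc, mul_comm]; exact hpt t ht
    have h3 : ‖v‖ ^ 2 ≤ G.g y v v / c := by rw [le_div_iff₀ hc, mul_comm]; exact hb.coercive y v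
    have h4 : L ^ 4 * ‖γ t - y‖ * ‖v‖ * ‖v‖ ≤ κ * ℓ * G.g y v v := by
      calc L ^ 4 * ‖γ t - y‖ * ‖v‖ * ‖v‖ = L ^ 4 * ‖γ t - y‖ * ‖v‖ ^ 2 := by ring
        _ ≤ L ^ 4 * (ℓ / √c) * (G.g y v v / c) := by gcongr
        _ = _ := by simp only [κ]; field_simp
    linarith
  -- by Cauchy-Schwarz, `g_y(d,d) = ∫ g_y(d,γ')` is at most `√g_y(d,d)` times the length of `γ` in
  -- the fixed metric `g_y`
  have hcs : √(1 - κ * ℓ) * G.g y d d ≤ √(G.g y d d) * ℓ := by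
    have e1 : G.g y d d = ∫ t in (0 : ℝ)..1, G.bil y d (deriv γ t) := by
      rw [(G.bil y d).intervalIntegral_comp_comm (hdγ.intervalIntegrable _ _), hint, bil_apply]
    have e2 : √(1 - κ * ℓ) * G.g y d d
        = ∫ t in (0 : ℝ)..1, √(1 - κ * ℓ) * G.bil y d (deriv γ t) := by
      rw [intervalIntegral.integral_const_mul, ← e1]
    have e3 : √(G.g y d d) * ℓ
        = ∫ t in (0 : ℝ)..1, √(G.g y d d) * √(G.g (γ t) (deriv γ t) (deriv γ t)) := by
      rw [intervalIntegral.integral_const_mul, hℓ, length]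
    rw [e2, e3]
    refine intervalIntegral.integral_mono_on zero_le_one
      ((((G.bil y d).continuous.comp hdγ).const_mul _).intervalIntegrable _ _)
      ((hcont.const_mul _).intervalIntegrable _ _) fun t ht => ?_
    rw [← Real.sqrt_mul hg0, bil_apply]
    refine Real.le_sqrt_of_sq_le ?_
    rw [mul_pow, Real.sq_sqrt hpos.le]
    calc (1 - κ * ℓ) * G.g y d (deriv γ t) ^ 2
        ≤ (1 - κ * ℓ) * (G.g y d d * G.g y (deriv γ t) (deriv γ t)) := by
          gcongr; exact hb.g_sq_le _ _ _
      _ = G.g y d d * ((1 - κ * ℓ) * G.g y (deriv γ t) (deriv γ t)) := by ring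
      _ ≤ _ := by gcongr; exact hmet t ht _
  have hsq := pow_le_pow_left₀ (mul_nonneg (Real.sqrt_nonneg _) hg0) hcs 2
  rw [mul_pow, mul_pow, Real.sq_sqrt hpos.le, Real.sq_sqrt hg0] at hsq
  rcases hg0.eq_or_lt with h0 | h0
  · rw [← h0, zero_mul]; positivity
  · refine le_of_mul_le_mul_left ?_ h0
    linarith

theorem le_dist_sq (y z : V) :
    G.g y (z - y) (z - y) * (1 - L ^ 4 / (c * √c) * G.dist y z) ≤ G.dist y z ^ 2 := by
  have ht : Tendsto (fun l : ℝ => l ^ 2 - G.g y (z - y) (z - y) * (1 - L ^ 4 / (c * √c) * l))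
      (𝓝[>] (G.dist y z)) (𝓝 (G.dist y z ^ 2 -
        G.g y (z - y) (z - y) * (1 - L ^ 4 / (c * √c) * G.dist y z))) := by
    refine Tendsto.mono_left (Continuous.tendsto ?_ _) nhdsWithin_le_nhds
    fun_prop
  have hk : 0 ≤ L ^ 4 / (c * √c) := by have := hb.c_pos; positivity
  refine sub_nonneg.1 (ge_of_tendsto ht ?_)
  filter_upwards [self_mem_nhdsWithin] with l hl
  obtain ⟨γ, h1, h2, h3, h4⟩ := G.exists_length_lt hl
  have h5 := hb.le_length_sq h1
  rw [h2, h3] at h5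
  have h6 := pow_le_pow_left₀ (G.length_nonneg γ) h4.le 2
  have h7 : G.g y (z - y) (z - y) * (1 - L ^ 4 / (c * √c) * l)
      ≤ G.g y (z - y) (z - y) * (1 - L ^ 4 / (c * √c) * G.length γ) := by
    have := hb.g_self_nonneg y (z - y)
    gcongr
  linarith

end Bounds
end AdmissibleMetric
end RiemSpline
end

noncomputable section

namespace RiemSpline

variable {V Y : Type*} [NormedAddCommGroup V] [InnerProductSpace ℝ V] [CompleteSpace V]
  [NormedAddCommGroup Y] [NormedSpace ℝ Y] {ι : V →L[ℝ] Y}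

/-! ### Second and third derivatives of the energy on the diagonal -/

namespace AdmissibleEnergy

open AdmissibleMetric

variable {G : AdmissibleMetric ι} (A : AdmissibleEnergy G)

/-- The compact part of the energy as a function on the product space. -/
def phi (p : V × V) : ℝ := A.Wc p.1 p.2

theorem contDiff_phi : ContDiff ℝ 4 A.phi := A.contDiff

theorem differentiable_phi : Differentiable ℝ A.phi := A.contDiff_phi.differentiable (by norm_num)

theorem contDiff_fderiv_phi : ContDiff ℝ 3 (fderiv ℝ A.phi) :=
  A.contDiff_phi.fderiv_right (by norm_num)

theorem contDiff_hess_phi : ContDiff ℝ 2 (fderiv ℝ (fderiv ℝ A.phi)) :=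
  A.contDiff_fderiv_phi.fderiv_right (by norm_num)

theorem exists_bound_derivs (R : ℝ) : ∃ C : ℝ, 0 ≤ C ∧ ∀ p : V × V, ‖p‖ ≤ R →
    ‖iteratedFDeriv ℝ 3 A.phi p‖ ≤ C ∧ ‖iteratedFDeriv ℝ 3 (fderiv ℝ A.phi) p‖ ≤ C := by
  obtain ⟨C, hC⟩ := A.bounded_derivs R
  refine ⟨max C 0, le_max_right _ _, fun p hp => ⟨?_, ?_⟩⟩
  · exact (hC 3 (by norm_num) p hp).trans (le_max_left _ _)
  · rw [norm_iteratedFDeriv_fderiv]; exact (hC 4 (by norm_num) p hp).trans (le_max_left _ _)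

theorem phi_diag (y : V) : A.phi (y, y) = 0 := by
  obtain ⟨ε, C, hε, hC, h⟩ := A.approx
  have := h y y (by rw [G.dist_self]; exact hε.le)
  simpa [G.dist_self, phi] using this

theorem fderiv_phi_diag (y : V) : fderiv ℝ A.phi (y, y) = 0 := by
  refine IsLocalMin.fderiv_eq_zero (Eventually.of_forall fun p => ?_)
  rw [A.phi_diag]
  exact A.Wc_nonneg _ _

theorem hess_symm (p h k : V × V) :
    fderiv ℝ (fderiv ℝ A.phi) p h k = fderiv ℝ (fderiv ℝ A.phi) p k h :=
  (A.contDiff_phi.contDiffAt (x := p)).isSymmSndFDerivAt (by simp; norm_num) h k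

theorem third_symm (p a h : V × V) : fderiv ℝ (fderiv ℝ (fderiv ℝ A.phi)) p a h
    = fderiv ℝ (fderiv ℝ (fderiv ℝ A.phi)) p h a :=
  (A.contDiff_fderiv_phi.contDiffAt (x := p)).isSymmSndFDerivAt (by simp; norm_num) a h

/-- The diagonal embedding. -/
def diag : V →L[ℝ] V × V := (ContinuousLinearMap.id ℝ V).prod (ContinuousLinearMap.id ℝ V)

@[simp] theorem diag_apply (y : V) : (diag y : V × V) = (y, y) := rfl

theorem hasFDerivAt_diag (y : V) : HasFDerivAt (fun x : V => (diag x : V × V)) diag y :=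
  (hasFDerivAt_id y).prodMk (hasFDerivAt_id y)

/-- The gradient vanishes along the diagonal, hence so does its derivative in tangential
directions. -/
theorem hess_diag_left (y u : V) : fderiv ℝ (fderiv ℝ A.phi) (y, y) (u, u) = 0 := by
  have h1 : HasFDerivAt (fun x : V => fderiv ℝ A.phi (diag x))
      ((fderiv ℝ (fderiv ℝ A.phi) (diag y)).comp diag) y :=
    (A.contDiff_fderiv_phi.differentiable (by norm_num) _).hasFDerivAt.comp y
      (hasFDerivAt_diag y)
  have h2 : (fun x : V => fderiv ℝ A.phi (diag x)) = fun _ => 0 := by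
    ext1 x; exact A.fderiv_phi_diag x
  rw [h2] at h1
  have h3 := h1.unique (hasFDerivAt_const _ _)
  exact DFunLike.congr_fun h3 u

/-- The Hessian on the diagonal is determined by the metric, because `W` agrees with the squared
distance up to third order. -/
theorem hess_snd_self (y x : V) :
    fderiv ℝ (fderiv ℝ A.phi) (y, y) (0, x) (0, x) = 2 * G.gc (ι y) (ι x) (ι x) := by
  obtain ⟨c, L, hb⟩ := G.exists_bounds
  obtain ⟨ε, C, hε, hC, happ⟩ := A.approx
  obtain ⟨C3, hC3, hT⟩ := A.exists_bound_derivs (‖((y, y) : V × V)‖ + ‖((0, x) : V × V)‖)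
  have hL := hb.L_nonneg
  have hc := hb.c_pos
  set H := fderiv ℝ (fderiv ℝ A.phi) (y, y) (0, x) (0, x)
  set g := G.g y x x
  have hg : 0 ≤ g := hb.g_self_nonneg _ _
  set n := ‖x‖
  have hn : 0 ≤ n := norm_nonneg _
  set κ := L ^ 4 / (c * √c)
  have hκ : 0 ≤ κ := by positivity
  set M := √(g + L ^ 4 * n ^ 3)
  have hM : 0 ≤ M := Real.sqrt_nonneg _
  have hM2 : M ^ 2 = g + L ^ 4 * n ^ 3 := Real.sq_sqrt (by positivity)
  set E : ℝ := C * M ^ 3 + L ^ 4 * n ^ 3 + g * κ * M + C3 * n ^ 3 with hE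
  have hE0 : 0 ≤ E := by positivity
  -- compare `W[y, y + s x]` with the squared distance on the one hand and with its Taylor
  -- expansion on the other hand, divide by `s²` and let `s` tend to `0`
  have main : ∀ s : ℝ, 0 < s → s ≤ 1 → s * M ≤ ε →
      |1 / 2 * H - G.gc (ι y) (ι x) (ι x)| ≤ E * s := by
    intro s hs hs1 hsε
    set D := G.dist y (y + s • x) with hD
    have hD0 : 0 ≤ D := G.dist_nonneg _ _
    have gs : G.g y (s • x) (s • x) = s ^ 2 * g := by
      rw [← bil_apply]; simp only [map_smul, smul_apply, smul_eq_mul, bil_apply, g]; ring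
    have ns : ‖s • x‖ = s * n := by rw [norm_smul, Real.norm_eq_abs, abs_of_pos hs]
    have u1 := hb.dist_sq_le y (y + s • x)
    have l1 := hb.le_dist_sq y (y + s • x)
    rw [add_sub_cancel_left, gs, ← hD] at u1 l1
    rw [ns] at u1
    have hs3 : s ^ 3 ≤ s ^ 2 := pow_le_pow_of_le_one hs.le hs1 (by norm_num)
    have hDM : D ≤ s * M := by
      refine abs_le_of_sq_le_sq' ?_ (mul_nonneg hs.le hM) |>.2
      rw [mul_pow, hM2]
      have : L ^ 4 * (s * n) ^ 3 ≤ s ^ 2 * (L ^ 4 * n ^ 3) := by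
        calc L ^ 4 * (s * n) ^ 3 = s ^ 3 * (L ^ 4 * n ^ 3) := by ring
          _ ≤ _ := by gcongr
      linarith
    have hD3 : D ^ 3 ≤ s ^ 3 * M ^ 3 := by
      rw [← mul_pow]; exact pow_le_pow_left₀ hD0 hDM 3
    have w1 := abs_le.1 (happ y (y + s • x) (hDM.trans hsε))
    have q1 : G.Q (y - (y + s • x)) (y - (y + s • x)) = s ^ 2 * G.Q x x := by
      simp only [sub_add_cancel_left, map_neg, map_smul, neg_apply, smul_apply, smul_eq_mul]; ring
    rw [← hD, q1] at w1
    have gq : g = G.gc (ι y) (ι x) (ι x) + G.Q x x := rfl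
    have tay := norm_taylor_two_le (f := A.phi) (A.contDiff_phi.of_le (by norm_num)) hC3
      (fun p hp => (hT p hp).1) (p := (y, y)) (h := s • (0, x)) (by
        gcongr
        rw [norm_smul, Real.norm_eq_abs, abs_of_pos hs]
        exact mul_le_of_le_one_left (norm_nonneg _) hs1)
    rw [A.phi_diag, A.fderiv_phi_diag] at tay
    simp only [map_smul, smul_apply, smul_eq_mul, zero_apply, sub_zero, mul_zero,
      Real.norm_eq_abs] at tay
    have e1 : A.phi ((y, y) + s • ((0, x) : V × V)) = A.Wc y (y + s • x) := by simp [phi]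
    have e2 : ‖s • ((0, x) : V × V)‖ = s * n := by
      rw [norm_smul, Real.norm_eq_abs, abs_of_pos hs]; simp [n]
    rw [e1, e2] at tay
    have t1 := abs_le.1 tay
    have f1 : C * D ^ 3 ≤ s ^ 3 * (C * M ^ 3) := by
      calc C * D ^ 3 ≤ C * (s ^ 3 * M ^ 3) := by gcongr
        _ = _ := by ring
    have f2 : s ^ 2 * g * (κ * D) ≤ s ^ 3 * (g * κ * M) := by
      calc s ^ 2 * g * (κ * D) ≤ s ^ 2 * g * (κ * (s * M)) := by gcongr
        _ = _ := by ring
    have l2 : -(s ^ 2 * g * (κ * D)) ≤ D ^ 2 - s ^ 2 * g := by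
      have l1' : s ^ 2 * g * (1 - κ * D) ≤ D ^ 2 := l1
      have : s ^ 2 * g * (1 - κ * D) = s ^ 2 * g - s ^ 2 * g * (κ * D) := by ring
      linarith
    have e3 : L ^ 4 * (s * n) ^ 3 = s ^ 3 * (L ^ 4 * n ^ 3) := by ring
    have e4 : C3 * (s * n) ^ 3 = s ^ 3 * (C3 * n ^ 3) := by ring
    rw [e3] at u1
    rw [e4] at t1
    have p1 : 0 ≤ s ^ 3 * (g * κ * M) := by positivity
    have p2 : 0 ≤ s ^ 3 * (L ^ 4 * n ^ 3) := by positivity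
    have e5 : s ^ 3 * E = s ^ 3 * (C * M ^ 3) + s ^ 3 * (L ^ 4 * n ^ 3) + s ^ 3 * (g * κ * M)
        + s ^ 3 * (C3 * n ^ 3) := by rw [hE]; ring
    have e6 : s ^ 2 * (1 / 2 * H - G.gc (ι y) (ι x) (ι x))
        = -(A.Wc y (y + s • x) - 1 / 2 * (s * (s * H)))
          + (A.Wc y (y + s • x) + s ^ 2 * G.Q x x - D ^ 2) + (D ^ 2 - s ^ 2 * g) := by
      rw [gq]; ring
    have fin : |s ^ 2 * (1 / 2 * H - G.gc (ι y) (ι x) (ι x))| ≤ s ^ 3 * E := by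
      rw [abs_le, e5, e6]
      generalize s ^ 3 * (C * M ^ 3) = a1 at *
      generalize s ^ 3 * (L ^ 4 * n ^ 3) = a2 at *
      generalize s ^ 3 * (g * κ * M) = a3 at *
      generalize s ^ 3 * (C3 * n ^ 3) = a4 at *
      obtain ⟨w1a, w1b⟩ := w1
      obtain ⟨t1a, t1b⟩ := t1
      constructor <;> linarith only [w1a, w1b, t1a, t1b, u1, l2, f1, f2, p1, p2]
    rw [abs_mul, abs_of_pos (by positivity : 0 < s ^ 2)] at fin
    refine le_of_mul_le_mul_left (fin.trans (le_of_eq ?_)) (by positivity : 0 < s ^ 2)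
    ring
  have hlim : Tendsto (fun s : ℝ => E * s) (𝓝[>] 0) (𝓝 0) := by
    refine Tendsto.mono_left ?_ nhdsWithin_le_nhds
    have : Continuous fun s : ℝ => E * s := by fun_prop
    simpa using this.tendsto 0
  have hz : |1 / 2 * H - G.gc (ι y) (ι x) (ι x)| ≤ 0 := by
    refine ge_of_tendsto hlim ?_
    have hM' : Tendsto (fun s : ℝ => s * M) (𝓝[>] 0) (𝓝 0) := by
      refine Tendsto.mono_left ?_ nhdsWithin_le_nhds
      have : Continuous fun s : ℝ => s * M := by fun_prop
      simpa using this.tendsto 0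
    filter_upwards [self_mem_nhdsWithin, hM'.eventually_le_const hε,
      Ioc_mem_nhdsGT (zero_lt_one' ℝ)] with s hs h1 h2
    exact main s hs h2.2 h1
  have := abs_nonpos_iff.1 hz
  linarith

theorem hess_diag_apply (y : V) (h k : V × V) :
    fderiv ℝ (fderiv ℝ A.phi) (y, y) h k
      = 2 * G.gc (ι y) (ι (h.2 - h.1)) (ι (k.2 - k.1)) := by
  set H := fderiv ℝ (fderiv ℝ A.phi) (y, y) with hH
  -- the Hessian vanishes in directions tangential to the diagonal; the rest is polarization
  have red : ∀ h k : V × V, H h k = H (0, h.2 - h.1) k := fun h k => by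
    have : h = (h.1, h.1) + (0, h.2 - h.1) := by ext <;> simp
    nth_rewrite 1 [this]
    rw [map_add, hH, A.hess_diag_left, zero_add]
  have e : H h k = H (0, h.2 - h.1) (0, k.2 - k.1) := by
    rw [red, hH, A.hess_symm, ← hH, red, hH, A.hess_symm]
  rw [e]
  generalize h.2 - h.1 = u
  generalize k.2 - k.1 = v
  have h1 := A.hess_snd_self y (u + v)
  have h2 := A.hess_snd_self y u
  have h3 := A.hess_snd_self y v
  have h4 := A.hess_symm (y, y) (0, u) (0, v)
  have h5 : ((0, u + v) : V × V) = (0, u) + (0, v) := by simp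
  have h6 := G.gc_symm (ι y) u v
  rw [h5] at h1
  simp only [map_add, add_apply] at h1
  rw [← hH] at h1 h2 h3 h4
  linarith

/-- Differentiation of the formula for the Hessian along the diagonal. -/
theorem third_diag (y u : V) (h k : V × V) :
    fderiv ℝ (fderiv ℝ (fderiv ℝ A.phi)) (y, y) (u, u) h k
      = 2 * G.Dg y u (h.2 - h.1) (k.2 - k.1) := by
  have h1 : HasFDerivAt (fun x : V => fderiv ℝ (fderiv ℝ A.phi) (diag x))
      ((fderiv ℝ (fderiv ℝ (fderiv ℝ A.phi)) (diag y)).comp diag) y :=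
    (A.contDiff_hess_phi.differentiable (by norm_num) _).hasFDerivAt.comp y
      (hasFDerivAt_diag y)
  have h2 : HasFDerivAt (fun x : V => fderiv ℝ (fderiv ℝ A.phi) (diag x) h k)
      ((((fderiv ℝ (fderiv ℝ (fderiv ℝ A.phi)) (diag y)).comp diag).flip h).flip k) y := by
    refine ((h1.clm_apply (hasFDerivAt_const h y)).clm_apply
      (hasFDerivAt_const k y)).congr_fderiv ?_
    ext z; simp
  have h3 : HasFDerivAt (fun x : V => G.gc (ι x)) ((fderiv ℝ G.gc (ι y)).comp ι) y :=
    (G.gc_differentiable _).hasFDerivAt.comp y ι.hasFDerivAt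
  have h4 : HasFDerivAt (fun x : V => 2 * G.gc (ι x) (ι (h.2 - h.1)) (ι (k.2 - k.1)))
      ((2 : ℝ) • ((((fderiv ℝ G.gc (ι y)).comp ι).flip (ι (h.2 - h.1))).flip
        (ι (k.2 - k.1)))) y := by
    refine (((h3.clm_apply (hasFDerivAt_const (ι (h.2 - h.1)) y)).clm_apply
      (hasFDerivAt_const (ι (k.2 - k.1)) y)).const_mul 2).congr_fderiv ?_
    ext z; simp
  have e : (fun x : V => fderiv ℝ (fderiv ℝ A.phi) (diag x) h k)
      = fun x : V => 2 * G.gc (ι x) (ι (h.2 - h.1)) (ι (k.2 - k.1)) := by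
    ext1 x; exact A.hess_diag_apply x h k
  rw [e] at h2
  have := DFunLike.congr_fun (h2.unique h4) u
  simp [Dg] at this ⊢
  linarith

theorem third_symm_right (p a h k : V × V) : fderiv ℝ (fderiv ℝ (fderiv ℝ A.phi)) p a h k
    = fderiv ℝ (fderiv ℝ (fderiv ℝ A.phi)) p a k h := by
  have h1 := (A.contDiff_hess_phi.differentiable (by norm_num) p).hasFDerivAt
  have h2 : ∀ h k : V × V, HasFDerivAt (fun x => fderiv ℝ (fderiv ℝ A.phi) x h k)
      (((fderiv ℝ (fderiv ℝ (fderiv ℝ A.phi)) p).flip h).flip k) p := fun h k => by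
    refine ((h1.clm_apply (hasFDerivAt_const h p)).clm_apply
      (hasFDerivAt_const k p)).congr_fderiv ?_
    ext z <;> simp
  have e : (fun x => fderiv ℝ (fderiv ℝ A.phi) x h k)
      = fun x => fderiv ℝ (fderiv ℝ A.phi) x k h := by
    ext1 x; exact A.hess_symm x h k
  have h3 := h2 h k
  rw [e] at h3
  simpa using DFunLike.congr_fun (h3.unique (h2 k h)) a

/-- The third order term in the Euler-Lagrange equation of the midpoint is the Christoffel
operator. -/
theorem third_christoffel (y a z : V) :
    fderiv ℝ (fderiv ℝ (fderiv ℝ A.phi)) (y, y) (a, 0) (a, 0) (0, z)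
      + fderiv ℝ (fderiv ℝ (fderiv ℝ A.phi)) (y, y) (0, a) (0, a) (z, 0)
      = -4 * G.g y (G.christoffel y a a) z := by
  set T := fderiv ℝ (fderiv ℝ (fderiv ℝ A.phi)) (y, y) with hT
  have s1 : ∀ u v, T u v = T v u := A.third_symm (y, y)
  have s2 : ∀ u v w, T u v w = T u w v := A.third_symm_right (y, y)
  have d : ∀ u h k, T (u, u) h k = 2 * G.Dg y u (h.2 - h.1) (k.2 - k.1) := A.third_diag y
  -- the third derivative is known only if one argument is tangential to the diagonal; the
  -- remaining terms `T (0, a) (0, a) (0, z)` cancel in the sum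
  have ea : ((a, 0) : V × V) = (a, a) - (0, a) := by simp
  have ez : ((z, 0) : V × V) = (z, z) - (0, z) := by simp
  have t1 : T (0, a) (0, a) (z, 0) = 2 * G.Dg y z a a - T (0, a) (0, a) (0, z) := by
    rw [ez, map_sub, s2 (0, a) (0, a) (z, z), s1 (0, a) (z, z), d]; simp
  have t2 : T (a, 0) (a, 0) (0, z) = -4 * G.Dg y a a z + T (0, a) (0, a) (0, z) := by
    have u1 : T (a, 0) (a, 0) (0, z) = T (a, a) (a, 0) (0, z) - T (0, a) (a, 0) (0, z) := by
      have := congrArg (fun x => T x (a, 0) (0, z)) ea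
      simpa only [map_sub, sub_apply] using this
    have u2 : T (0, a) (a, 0) (0, z) = T (a, a) (0, a) (0, z) - T (0, a) (0, a) (0, z) := by
      rw [ea, map_sub, sub_apply, s1 (0, a) (a, a)]
    rw [u1, u2, d, d]
    have hn : G.Dg y a (-a) z = - G.Dg y a a z := by simp [Dg]
    simp only [zero_sub, sub_zero, hn]
    ring
  have h := G.christoffel_spec y a a z
  rw [t1, t2]
  linarith

end AdmissibleEnergy
end RiemSpline
end

noncomputable section

namespace RiemSpline

variable {V Y : Type*} [NormedAddCommGroup V] [InnerProductSpace ℝ V] [CompleteSpace V]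
  [NormedAddCommGroup Y] [NormedSpace ℝ Y] {ι : V →L[ℝ] Y}

/-! ### Discrete geodesic midpoints -/

namespace AdmissibleEnergy

open AdmissibleMetric

variable {G : AdmissibleMetric ι} (A : AdmissibleEnergy G)

theorem W_nonneg (y z : V) : 0 ≤ A.W y z := add_nonneg (A.Wc_nonneg _ _) (G.Q_nonneg _)

/-- `W` agrees with the metric up to third order. -/
theorem exists_W_sub_g_le (R : ℝ) : ∃ C : ℝ, 0 ≤ C ∧ ∀ y x : V, ‖y‖ + ‖x‖ ≤ R →
    |A.W y (y + x) - G.g y x x| ≤ C * ‖x‖ ^ 3 := by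
  obtain ⟨C, hC0, hC⟩ := A.exists_bound_derivs R
  refine ⟨C, hC0, fun y x h => ?_⟩
  have tay := norm_taylor_two_le (f := A.phi) (A.contDiff_phi.of_le (by norm_num)) hC0
      (fun p hp => (hC p hp).1) (p := (y, y)) (h := (0, x)) (by simpa using h)
  rw [A.phi_diag, A.fderiv_phi_diag, A.hess_diag_apply] at tay
  have e : A.W y (y + x) - G.g y x x = A.phi ((y, y) + (0, x)) - G.gc (ι y) (ι x) (ι x) := by
    simp [W, phi, g]
  rw [e, ← Real.norm_eq_abs]
  simpa using tay

/-- The Euler-Lagrange equation of the midpoint. -/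
theorem midpoint_eq {a b m : V} (hm : IsMidpoint A.W a b m) (z : V) :
    fderiv ℝ A.phi (a, m) (0, z) + fderiv ℝ A.phi (m, b) (z, 0)
      + 2 * G.Q (m - a) z + 2 * G.Q (m - b) z = 0 := by
  have hl : HasDerivAt (fun t : ℝ => m + t • z) z 0 := by
    simpa using ((hasDerivAt_id (0 : ℝ)).smul_const z).const_add m
  have h1 : HasDerivAt (fun t : ℝ => A.phi (a, m + t • z)) (fderiv ℝ A.phi (a, m) (0, z)) 0 := by
    have hg : HasFDerivAt A.phi (fderiv ℝ A.phi (a, m + (0 : ℝ) • z)) (a, m + (0 : ℝ) • z) :=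
      (A.differentiable_phi _).hasFDerivAt
    have := hg.comp_hasDerivAt (0 : ℝ) ((hasDerivAt_const (0 : ℝ) a).prodMk hl)
    exact this.congr_deriv (by simp)
  have h2 : HasDerivAt (fun t : ℝ => A.phi (m + t • z, b)) (fderiv ℝ A.phi (m, b) (z, 0)) 0 := by
    have hg : HasFDerivAt A.phi (fderiv ℝ A.phi (m + (0 : ℝ) • z, b)) (m + (0 : ℝ) • z, b) :=
      (A.differentiable_phi _).hasFDerivAt
    have := hg.comp_hasDerivAt (0 : ℝ) (hl.prodMk (hasDerivAt_const (0 : ℝ) b))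
    exact this.congr_deriv (by simp)
  have h3 : ∀ u : V, HasDerivAt (fun t : ℝ => G.Q (u + t • z) (u + t • z)) (2 * G.Q u z) 0 := by
    intro u
    have e : (fun t : ℝ => G.Q (u + t • z) (u + t • z))
        = fun t : ℝ => G.Q u u + (2 * G.Q u z) * t + G.Q z z * t ^ 2 := by
      ext t
      simp only [map_add, map_smul, add_apply, smul_apply, smul_eq_mul, G.Q_symm z u]
      ring
    rw [e]
    have := (((hasDerivAt_id (0 : ℝ)).const_mul (2 * G.Q u z)).const_add (G.Q u u)).add
      ((hasDerivAt_pow 2 (0 : ℝ)).const_mul (G.Q z z))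
    exact this.congr_deriv (by simp)
  have hF : HasDerivAt (fun t : ℝ => A.phi (a, m + t • z) + A.phi (m + t • z, b)
      + G.Q ((m - a) + t • z) ((m - a) + t • z) + G.Q ((m - b) + t • z) ((m - b) + t • z))
      (fderiv ℝ A.phi (a, m) (0, z) + fderiv ℝ A.phi (m, b) (z, 0)
      + 2 * G.Q (m - a) z + 2 * G.Q (m - b) z) 0 := ((h1.add h2).add (h3 _)).add (h3 _)
  have e : (fun t : ℝ => A.phi (a, m + t • z) + A.phi (m + t • z, b)
      + G.Q ((m - a) + t • z) ((m - a) + t • z) + G.Q ((m - b) + t • z) ((m - b) + t • z))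
      = fun t : ℝ => A.W a (m + t • z) + A.W (m + t • z) b := by
    ext t
    have e1 : a - (m + t • z) = -((m - a) + t • z) := by abel
    have e2 : m + t • z - b = (m - b) + t • z := by abel
    simp only [W, phi, e1, e2, map_neg, neg_apply, neg_neg]
    ring
  rw [e] at hF
  refine IsLocalMin.hasDerivAt_eq_zero (Eventually.of_forall fun t => ?_) hF
  simpa using hm (mem_univ (m + t • z))

/-- Expansion of the Euler-Lagrange equation: the midpoint `y + δ` of `y + a` and `y + b` satisfies
`2 δ = a + b + Γ_y(b,b)` up to higher order. -/
theorem exists_midpoint_expansion (R : ℝ) : ∃ C : ℝ, 0 ≤ C ∧ ∀ (y a b δ : V) (ρ : ℝ), ‖y‖ ≤ R →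
    ρ ≤ R → ‖δ‖ ≤ R → ‖a‖ ≤ ρ → ‖b‖ ≤ ρ → IsMidpoint A.W (y + a) (y + b) (y + δ) →
    ‖(2 : ℝ) • δ - (a + b) - G.christoffel y b b‖
      ≤ C * (ρ * ‖δ‖ + ‖δ‖ ^ 2 + ρ * ‖a + b‖ + ρ ^ 3) := by
  obtain ⟨c, L, hb⟩ := G.exists_bounds
  obtain ⟨C, hC0, hC⟩ := A.exists_bound_derivs (2 * R)
  rcases lt_or_ge R 0 with hR | hR
  · exact ⟨0, le_rfl, fun y _ _ _ _ h => absurd (h.trans_lt hR) (not_lt.2 (norm_nonneg _))⟩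
  have hc := hb.c_pos
  refine ⟨C * (2 + R) / c, by positivity, fun y a b δ ρ hy hρ hδ ha hbρ hm => ?_⟩
  set d := ‖δ‖
  have hd : 0 ≤ d := norm_nonneg _
  have hρ0 : 0 ≤ ρ := (norm_nonneg a).trans ha
  -- the constant comes from bounding `2 g_y(D, z)` for all `z` and dividing by the coercivity
  -- constant
  set D := (2 : ℝ) • δ - (a + b) - G.christoffel y b b with hD
  set E : ℝ := ρ * d + d ^ 2 + ρ * ‖a + b‖ + ρ ^ 3 with hE
  have hE0 : 0 ≤ E := by positivity
  set H := fderiv ℝ (fderiv ℝ A.phi) (y, y) with hH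
  set T := fderiv ℝ (fderiv ℝ (fderiv ℝ A.phi)) (y, y) with hT
  have hTn : ‖T‖ ≤ C := (norm_fderiv_three _).trans_le ((hC _ (by simp; linarith)).1)
  have hT3 : ∀ u v w : V × V, |T u v w| ≤ C * ‖u‖ * ‖v‖ * ‖w‖ := fun u v w => by
    rw [← Real.norm_eq_abs]
    refine ((T u).le_opNorm₂ v w).trans ?_
    gcongr
    exact (T.le_opNorm u).trans (by gcongr)
  have nl : ∀ x : V, ‖((x, 0) : V × V)‖ = ‖x‖ := fun x => by simp
  have nr : ∀ x : V, ‖((0, x) : V × V)‖ = ‖x‖ := fun x => by simp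
  have key : ∀ z : V, |2 * G.g y D z| ≤ 2 * (C * (2 + R) * E) * ‖z‖ := by
    intro z
    have hn1 : ‖((a, δ) : V × V)‖ ≤ R := by
      rw [Prod.norm_mk]; exact max_le (ha.trans hρ) hδ
    have hn2 : ‖((δ, b) : V × V)‖ ≤ R := by
      rw [Prod.norm_mk]; exact max_le hδ (hbρ.trans hρ)
    have cube : ∀ h : V × V, ‖h‖ ≤ max ρ d → ‖h‖ ^ 3 ≤ ρ ^ 3 + R * d ^ 2 := fun h hh => by
      have h1 : ‖h‖ ^ 3 ≤ (max ρ d) ^ 3 := pow_le_pow_left₀ (norm_nonneg _) hh 3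
      have h3 : d ^ 3 ≤ R * d ^ 2 := by
        have : d ^ 3 = d * d ^ 2 := by ring
        rw [this]; gcongr
      rcases max_cases ρ d with ⟨h2, -⟩ | ⟨h2, -⟩ <;> rw [h2] at h1
      · have : 0 ≤ R * d ^ 2 := by positivity
        linarith
      · have : 0 ≤ ρ ^ 3 := by positivity
        linarith
    have c1 := cube (a, δ) (by rw [Prod.norm_mk]; exact max_le_max ha le_rfl)
    have c2 := cube (δ, b) (by rw [Prod.norm_mk, max_comm]; exact max_le_max hbρ le_rfl)
    -- the gradient of `W^c` vanishes on the diagonal, so the expansion starts with the Hessian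
    have tay : ∀ h k : V × V, ‖h‖ ≤ R → ‖h‖ ^ 3 ≤ ρ ^ 3 + R * d ^ 2 →
        |fderiv ℝ A.phi ((y, y) + h) k - H h k - 1 / 2 * T h h k|
          ≤ C * (ρ ^ 3 + R * d ^ 2) * ‖k‖ := by
      intro h k hh hcu
      have t := norm_taylor_two_le (f := fderiv ℝ A.phi) A.contDiff_fderiv_phi hC0
        (fun p hp => (hC p hp).2) (p := (y, y)) (h := h) (by simp; linarith)
      rw [A.fderiv_phi_diag, sub_zero] at t
      have t2 := (ContinuousLinearMap.le_opNorm _ k).trans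
        (mul_le_mul_of_nonneg_right t (norm_nonneg k))
      simp only [sub_apply, smul_apply, smul_eq_mul, Real.norm_eq_abs] at t2
      refine t2.trans ?_
      gcongr
    have t1 := abs_le.1 (tay (a, δ) (0, z) hn1 c1)
    have t2 := abs_le.1 (tay (δ, b) (z, 0) hn2 c2)
    have opt := A.midpoint_eq hm z
    have s1 : (y, y) + ((a, δ) : V × V) = (y + a, y + δ) := rfl
    have s2 : (y, y) + ((δ, b) : V × V) = (y + δ, y + b) := rfl
    have H1 : H (a, δ) (0, z) = 2 * G.gc (ι y) (ι (δ - a)) (ι z) := by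
      rw [hH, A.hess_diag_apply]; simp
    have H2 : H (δ, b) (z, 0) = 2 * G.gc (ι y) (ι (δ - b)) (ι z) := by
      rw [hH, A.hess_diag_apply]; simp; ring
    rw [s1, nr, H1] at t1
    rw [s2, nl, H2] at t2
    have x1 : (y + δ) - (y + a) = δ - a := by abel
    have x2 : (y + δ) - (y + b) = δ - b := by abel
    rw [x1, x2] at opt
    have tc := A.third_christoffel y b z
    rw [← hT] at tc
    have ead : ((a, δ) : V × V) = (a, 0) + (0, δ) := by simp
    -- replace `a` by `-b` in the quadratic term, at the expense of terms containing `a + b`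
    have eab : T (a, 0) (a, 0) (0, z) = T (a, 0) (a + b, 0) (0, z) - T (a + b, 0) (b, 0) (0, z)
        + T (b, 0) (b, 0) (0, z) := by
      have y1 : ((a + b, 0) : V × V) = (a, 0) + (b, 0) := by simp
      rw [y1]; simp only [map_add, add_apply]; ring
    have eT1 : T (a, δ) (a, δ) (0, z) = T (a, 0) (a, 0) (0, z) + (T (a, 0) (0, δ) (0, z)
        + T (0, δ) (a, 0) (0, z) + T (0, δ) (0, δ) (0, z)) := by
      rw [ead]; simp only [map_add, add_apply]; ring
    have eT2 : T (δ, b) (δ, b) (z, 0) = T (0, b) (0, b) (z, 0) + (T (0, b) (δ, 0) (z, 0)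
        + T (δ, 0) (0, b) (z, 0) + T (δ, 0) (δ, 0) (z, 0)) := by
      have y1 : ((δ, b) : V × V) = (δ, 0) + (0, b) := by simp
      rw [y1]; simp only [map_add, add_apply]; ring
    have bd : ∀ (u v w : V × V) (α β : ℝ), ‖u‖ ≤ α → ‖v‖ ≤ β → ‖w‖ = ‖z‖ →
        |T u v w| ≤ C * α * β * ‖z‖ := fun u v w α β h1 h2 h3 => by
      have : 0 ≤ α := (norm_nonneg _).trans h1
      refine (hT3 u v w).trans ?_
      rw [h3]; gcongr
    have b1 := abs_le.1 (bd (a, 0) (0, δ) (0, z) ρ d (by rwa [nl]) (nr _).le (nr _))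
    have b2 := abs_le.1 (bd (0, δ) (a, 0) (0, z) d ρ (nr _).le (by rwa [nl]) (nr _))
    have b3 := abs_le.1 (bd (0, δ) (0, δ) (0, z) d d (nr _).le (nr _).le (nr _))
    have b4 := abs_le.1 (bd (0, b) (δ, 0) (z, 0) ρ d (by rwa [nr]) (nl _).le (nl _))
    have b5 := abs_le.1 (bd (δ, 0) (0, b) (z, 0) d ρ (nl _).le (by rwa [nr]) (nl _))
    have b6 := abs_le.1 (bd (δ, 0) (δ, 0) (z, 0) d d (nl _).le (nl _).le (nl _))
    have b7 := abs_le.1 (bd (a, 0) (a + b, 0) (0, z) ρ ‖a + b‖ (by rwa [nl]) (nl _).le (nr _))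
    have b8 := abs_le.1 (bd (a + b, 0) (b, 0) (0, z) ‖a + b‖ ρ (nl _).le (by rwa [nl]) (nr _))
    have gD : 2 * G.g y D z = 2 * G.gc (ι y) (ι (δ - a)) (ι z) + 2 * G.gc (ι y) (ι (δ - b)) (ι z)
        + 2 * G.Q (δ - a) z + 2 * G.Q (δ - b) z - 2 * G.g y (G.christoffel y b b) z := by
      have y1 : D = (δ - a) + (δ - b) - G.christoffel y b b := by
        rw [hD, two_smul]; abel
      rw [y1, ← bil_apply, map_sub, map_add, sub_apply, add_apply, bil_apply, bil_apply, bil_apply]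
      simp only [g]; ring
    have pz : 0 ≤ ‖z‖ := norm_nonneg z
    have q1 : C * ρ * d * ‖z‖ = C * d * ρ * ‖z‖ := by ring
    have q2 : C * ρ * ‖a + b‖ * ‖z‖ = C * ‖a + b‖ * ρ * ‖z‖ := by ring
    have q3 : 2 * (C * (2 + R) * E) * ‖z‖ = 2 * (C * (ρ ^ 3 + R * d ^ 2) * ‖z‖)
        + 2 * (C * d * ρ * ‖z‖) + C * d * d * ‖z‖ + C * ‖a + b‖ * ρ * ‖z‖
        + ((2 * C + 2 * R * C) * d * ρ + 3 * C * d * d + (3 + 2 * R) * C * ‖a + b‖ * ρ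
          + (2 + 2 * R) * C * ρ ^ 3) * ‖z‖ := by
      rw [hE]; ring
    have q4 : 0 ≤ ((2 * C + 2 * R * C) * d * ρ + 3 * C * d * d + (3 + 2 * R) * C * ‖a + b‖ * ρ
          + (2 + 2 * R) * C * ρ ^ 3) * ‖z‖ := by positivity
    rw [eT1, eab] at t1
    rw [eT2] at t2
    rw [q1] at b1 b4
    rw [q2] at b7
    rw [abs_le, gD, q3]
    obtain ⟨t1a, t1b⟩ := t1
    obtain ⟨t2a, t2b⟩ := t2
    obtain ⟨b1a, b1b⟩ := b1
    obtain ⟨b2a, b2b⟩ := b2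
    obtain ⟨b3a, b3b⟩ := b3
    obtain ⟨b4a, b4b⟩ := b4
    obtain ⟨b5a, b5b⟩ := b5
    obtain ⟨b6a, b6b⟩ := b6
    obtain ⟨b7a, b7b⟩ := b7
    obtain ⟨b8a, b8b⟩ := b8
    constructor <;> linarith only [t1a, t1b, t2a, t2b, b1a, b1b, b2a, b2b, b3a, b3b, b4a, b4b, b5a,
      b5b, b6a, b6b, b7a, b7b, b8a, b8b, q4, opt, tc]
  have fin := hb.norm_le_of_g_le (y := y) (d := D) (C := C * (2 + R) * E) (by positivity) (by
    have := key D
    rw [abs_mul, abs_two] at this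
    linarith)
  rw [div_mul_eq_mul_div, le_div_iff₀ hc, mul_comm]
  exact fin

/-- Midpoints of two points close to `y` are close to `y`. -/
theorem exists_midpoint_close (R : ℝ) {ε : ℝ} (hε : 0 < ε) : ∃ ρ : ℝ, 0 < ρ ∧
    ∀ y a b m : V, ‖y‖ ≤ R → ‖a‖ ≤ ρ → ‖b‖ ≤ ρ → IsMidpoint A.W (y + a) (y + b) m →
      ‖m - y‖ ≤ ε := by
  rcases lt_or_ge R 0 with hR | hR
  · exact ⟨1, one_pos, fun y _ _ _ h => absurd (h.trans_lt hR) (not_lt.2 (norm_nonneg _))⟩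
  obtain ⟨c, L, hb⟩ := G.exists_bounds
  obtain ⟨C, hC0, hC⟩ := A.exists_W_sub_g_le (R + 2)
  obtain ⟨γ, hmono, -, hγ0, -, hγ⟩ := A.coercive
  have hL := hb.L_nonneg
  have hγε : 0 < γ (ε / 2) := by
    rw [← hγ0]; exact hmono (mem_Ici.2 le_rfl) (mem_Ici.2 (by positivity)) (by positivity)
  set N : ℝ := L ^ 4 * (3 + R) + C with hN
  have hN0 : 0 ≤ N := by positivity
  have hW : ∀ y x : V, ‖y‖ ≤ R + 1 → ‖x‖ ≤ 1 → A.W y (y + x) ≤ N * ‖x‖ ^ 2 := by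
    intro y x hy hx
    have h1 := (abs_le.1 (hC y x (by linarith))).2
    have h2 := (abs_le.1 (hb.abs_g_le y x x)).2
    have h3 : L ^ 4 * (2 + ‖y‖) * ‖x‖ * ‖x‖ ≤ L ^ 4 * (3 + R) * ‖x‖ ^ 2 := by
      rw [mul_assoc _ ‖x‖, ← pow_two]
      have : 2 + ‖y‖ ≤ 3 + R := by linarith
      gcongr
    have h4 : C * ‖x‖ ^ 3 ≤ C * ‖x‖ ^ 2 :=
      mul_le_mul_of_nonneg_left (pow_le_pow_of_le_one (norm_nonneg _) hx (by norm_num)) hC0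
    rw [hN, add_mul]
    linarith
  obtain ⟨r, hr0, hr⟩ : ∃ r : ℝ, 0 < r ∧ 2 * N * r < γ (ε / 2) := by
    refine ⟨γ (ε / 2) / (2 * (2 * N + 1)), by positivity, ?_⟩
    rw [mul_div_assoc', div_lt_iff₀ (by positivity)]
    nlinarith
  refine ⟨min (min 1 r) (ε / 2), by positivity, fun y a b m hy ha hbb hm => ?_⟩
  set ρ := min (min 1 r) (ε / 2)
  have hρ1 : ρ ≤ 1 := (min_le_left _ _).trans (min_le_left _ _)
  have hρr : ρ ≤ r := (min_le_left _ _).trans (min_le_right _ _)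
  have hρε : ρ ≤ ε / 2 := min_le_right _ _
  have sq : ∀ x : V, ‖x‖ ≤ ρ → N * ‖x‖ ^ 2 ≤ N * r := fun x hx => by
    have : ‖x‖ ^ 2 ≤ r := by nlinarith [norm_nonneg x]
    gcongr
  have w1 : A.W (y + a) y ≤ N * r := by
    have := hW (y + a) (-a) ((norm_add_le _ _).trans (by linarith)) (by rw [norm_neg]; linarith)
    rw [norm_neg, add_neg_cancel_right] at this
    exact this.trans (sq a ha)
  have w2 : A.W y (y + b) ≤ N * r := (hW y b (by linarith) (by linarith)).trans (sq b hbb)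
  -- compare the minimizer with `y`, which has small energy, and use the coercivity of `W`
  have w3 : A.W (y + a) m + A.W m (y + b) ≤ A.W (y + a) y + A.W y (y + b) := hm (mem_univ y)
  have w4 := A.W_nonneg m (y + b)
  have w5 : γ ‖y + a - m‖ ≤ A.W (y + a) m := hγ _ _
  have w6 : ‖y + a - m‖ < ε / 2 := by
    refine (hmono.lt_iff_lt (mem_Ici.2 (norm_nonneg _)) (mem_Ici.2 (by positivity))).1 ?_
    linarith
  calc ‖m - y‖ = ‖a - (y + a - m)‖ := by congr 1; abel
    _ ≤ ‖a‖ + ‖y + a - m‖ := norm_sub_le _ _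
    _ ≤ ε := by linarith

/-- The position of the midpoint under parabolic scaling: if the neighbours of `y` have distance
`O(s²)` and second difference `O(s³)`, the midpoint is determined up to `O(s⁵)`. -/
theorem exists_midpoint_estimate (R : ℝ) : ∃ C s₀ : ℝ, 0 ≤ C ∧ 0 < s₀ ∧
    ∀ (s : ℝ) (y a b m : V), 0 < s → s ≤ s₀ → ‖y‖ ≤ R → ‖a‖ ≤ R * s ^ 2 → ‖b‖ ≤ R * s ^ 2 →
      ‖a + b‖ ≤ R * s ^ 3 → IsMidpoint A.W (y + a) (y + b) m →
      ‖m - y‖ ≤ C * s ^ 3 ∧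
      ‖(2 : ℝ) • (m - y) - (a + b) - G.christoffel y b b‖ ≤ C * s ^ 5 := by
  rcases lt_or_ge R 0 with hR | hR
  · exact ⟨0, 1, le_rfl, one_pos, fun s y _ _ _ _ _ h =>
      absurd (h.trans_lt hR) (not_lt.2 (norm_nonneg _))⟩
  obtain ⟨c, L, hb⟩ := G.exists_bounds
  have hc := hb.c_pos
  have hL := hb.L_nonneg
  obtain ⟨C, hC0, hC⟩ := A.exists_midpoint_expansion (R + 1)
  -- qualitative closeness makes the quadratic term `C ‖δ‖²` of the expansion at most `‖δ‖ / 2`, so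
  -- that it can be absorbed
  obtain ⟨ρ, hρ0, hρ⟩ := A.exists_midpoint_close R (ε := min 1 (1 / (2 * (C + 1)))) (by positivity)
  set N : ℝ := 2 * (R + 2 * L ^ 4 * R ^ 2 / c + C * (R ^ 2 + R ^ 3)) with hN
  have hN0 : 0 ≤ N := by positivity
  set N' : ℝ := C * (R * N + N ^ 2 + R ^ 2 + R ^ 3) with hN'
  have hN'0 : 0 ≤ N' := by positivity
  set s₀ : ℝ := min 1 (min (ρ / (R + 1)) (1 / (2 * (C + 1) * (R + 1)))) with hs₀
  refine ⟨max N N', s₀, hN0.trans (le_max_left _ _), by positivity,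
    fun s y a b m hs hss hy ha hbn hab hm => ?_⟩
  have hs1 : s ≤ 1 := hss.trans (min_le_left _ _)
  have hs2 : s ^ 2 ≤ s := by nlinarith
  have hsρ : R * s ^ 2 ≤ ρ := by
    have h1 : s ≤ ρ / (R + 1) := hss.trans ((min_le_right _ _).trans (min_le_left _ _))
    rw [le_div_iff₀ (by positivity)] at h1
    nlinarith
  have hsC : C * (R * s ^ 2) ≤ 1 / 2 := by
    have h1 : s ≤ 1 / (2 * (C + 1) * (R + 1)) :=
      hss.trans ((min_le_right _ _).trans (min_le_right _ _))
    rw [le_div_iff₀ (by positivity)] at h1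
    have h2 : C * (R * s ^ 2) ≤ (C + 1) * ((R + 1) * s) := by gcongr <;> linarith
    linarith
  have hm' := hρ y a b m hy (ha.trans hsρ) (hbn.trans hsρ) hm
  set δ := m - y with hδ
  have hmδ : m = y + δ := by simp [hδ]
  have hsR : R * s ^ 2 ≤ R + 1 := by nlinarith
  have ex := hC y a b δ (R * s ^ 2) (by linarith) hsR
    ((hm'.trans (min_le_left _ _)).trans (by linarith)) ha hbn (hmδ ▸ hm)
  set d := ‖δ‖
  have hd : 0 ≤ d := norm_nonneg _
  have hdC : C * d ≤ 1 / 2 := by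
    have h1 : d ≤ 1 / (2 * (C + 1)) := hm'.trans (min_le_right _ _)
    rw [le_div_iff₀ (by positivity)] at h1
    nlinarith
  have hΓ : ‖G.christoffel y b b‖ ≤ 2 * L ^ 4 * R ^ 2 / c * s ^ 4 := by
    have h1 := hb.norm_christoffel_le y b b
    have h2 : 2 * L ^ 4 * ‖b‖ * ‖b‖ ≤ 2 * L ^ 4 * (R * s ^ 2) * (R * s ^ 2) := by gcongr
    rw [div_mul_eq_mul_div, le_div_iff₀ hc]
    linarith
  have s4 : s ^ 4 ≤ s ^ 3 := pow_le_pow_of_le_one hs.le hs1 (by norm_num)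
  have s5 : s ^ 5 ≤ s ^ 3 := pow_le_pow_of_le_one hs.le hs1 (by norm_num)
  have s6 : s ^ 6 ≤ s ^ 3 := pow_le_pow_of_le_one hs.le hs1 (by norm_num)
  have s65 : s ^ 6 ≤ s ^ 5 := pow_le_pow_of_le_one hs.le hs1 (by norm_num)
  have ex2 : C * (R * s ^ 2 * d + d ^ 2 + R * s ^ 2 * ‖a + b‖ + (R * s ^ 2) ^ 3)
      ≤ C * (R * s ^ 2) * d + (C * d) * d + C * (R ^ 2 * s ^ 5 + R ^ 3 * s ^ 6) := by
    have : C * (R * s ^ 2 * ‖a + b‖) ≤ C * (R * s ^ 2 * (R * s ^ 3)) := by gcongr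
    calc _ = C * (R * s ^ 2) * d + (C * d) * d + C * (R * s ^ 2 * ‖a + b‖)
          + C * (R * s ^ 2) ^ 3 := by ring
      _ ≤ C * (R * s ^ 2) * d + (C * d) * d + C * (R * s ^ 2 * (R * s ^ 3))
          + C * (R * s ^ 2) ^ 3 := by gcongr
      _ = _ := by ring
  have hdN : d ≤ N * s ^ 3 := by
    have t1 : 2 * d ≤ ‖(2 : ℝ) • δ - (a + b) - G.christoffel y b b‖ + ‖a + b‖
        + ‖G.christoffel y b b‖ := by
      have : (2 : ℝ) • δ = ((2 : ℝ) • δ - (a + b) - G.christoffel y b b) + (a + b)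
          + G.christoffel y b b := by abel
      have h2 : ‖(2 : ℝ) • δ‖ = 2 * d := by rw [norm_smul]; simp [d]
      rw [← h2]
      nth_rewrite 1 [this]
      exact norm_add₃_le
    have t2 : C * (R * s ^ 2) * d ≤ 1 / 2 * d := by gcongr
    have t3 : (C * d) * d ≤ 1 / 2 * d := by gcongr
    have t4 : C * (R ^ 2 * s ^ 5 + R ^ 3 * s ^ 6) ≤ C * (R ^ 2 + R ^ 3) * s ^ 3 := by
      calc C * (R ^ 2 * s ^ 5 + R ^ 3 * s ^ 6) ≤ C * (R ^ 2 * s ^ 3 + R ^ 3 * s ^ 3) := by gcongr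
        _ = _ := by ring
    have t5 : 2 * L ^ 4 * R ^ 2 / c * s ^ 4 ≤ 2 * L ^ 4 * R ^ 2 / c * s ^ 3 := by gcongr
    have t6 : N * s ^ 3 = 2 * (R * s ^ 3 + 2 * L ^ 4 * R ^ 2 / c * s ^ 3
        + C * (R ^ 2 + R ^ 3) * s ^ 3) := by rw [hN]; ring
    have t7 : 0 ≤ R * s ^ 3 := by positivity
    have t8 : 0 ≤ C * (R ^ 2 + R ^ 3) * s ^ 3 := by positivity
    have t9 : 0 ≤ 2 * L ^ 4 * R ^ 2 / c * s ^ 3 := by positivity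
    rw [t6]
    linarith
  constructor
  · exact hdN.trans (by gcongr; exact le_max_left _ _)
  · refine ex.trans (ex2.trans ?_)
    have t1 : C * (R * s ^ 2) * d ≤ C * (R * s ^ 2) * (N * s ^ 3) := by gcongr
    have t2 : (C * d) * d ≤ (C * (N * s ^ 3)) * (N * s ^ 3) := by gcongr
    calc _ ≤ C * (R * s ^ 2) * (N * s ^ 3) + (C * (N * s ^ 3)) * (N * s ^ 3)
          + C * (R ^ 2 * s ^ 5 + R ^ 3 * s ^ 6) := by gcongr
      _ = C * (R * N * s ^ 5 + N ^ 2 * s ^ 6 + R ^ 2 * s ^ 5 + R ^ 3 * s ^ 6) := by ring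
      _ ≤ C * (R * N * s ^ 5 + N ^ 2 * s ^ 5 + R ^ 2 * s ^ 5 + R ^ 3 * s ^ 5) := by gcongr
      _ = N' * s ^ 5 := by rw [hN']; ring
      _ ≤ _ := by gcongr; exact le_max_right _ _

end AdmissibleEnergy

/-! ### Weak compactness and existence of midpoints -/

theorem exists_weakTendsto_subseq [TopologicalSpace.SeparableSpace V] {x : ℕ → V} {R : ℝ}
    (hx : ∀ n, ‖x n‖ ≤ R) : ∃ (a : V) (φ : ℕ → ℕ), StrictMono φ ∧ WeakTendsto (x ∘ φ) a := by
  have hs := WeakDual.isSeqCompact_closedBall ℝ V (0 : StrongDual ℝ V) R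
  obtain ⟨f, -, φ, hφ, hf⟩ := hs (x := fun n => StrongDual.toWeakDual
      (InnerProductSpace.toDual ℝ V (x n))) (fun n => by simpa using hx n)
  refine ⟨(InnerProductSpace.toDual ℝ V).symm (WeakDual.toStrongDual f), φ, hφ, fun ψ => ?_⟩
  have h1 := (WeakDual.eval_continuous ((InnerProductSpace.toDual ℝ V).symm ψ)).tendsto f |>.comp hf
  have e : ∀ z : V, ψ z = inner ℝ z ((InnerProductSpace.toDual ℝ V).symm ψ) := fun z => by
    rw [real_inner_comm, InnerProductSpace.toDual_symm_apply]
  simp only [e, InnerProductSpace.toDual_symm_apply]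
  exact h1

theorem weakTendsto_const {E : Type*} [NormedAddCommGroup E] [NormedSpace ℝ E] (a : E) :
    WeakTendsto (fun _ => a) a := fun _ => tendsto_const_nhds

theorem WeakTendsto.subseq {E : Type*} [NormedAddCommGroup E] [NormedSpace ℝ E] {x : ℕ → E} {a : E}
    (h : WeakTendsto x a) {φ : ℕ → ℕ} (hφ : Tendsto φ atTop atTop) : WeakTendsto (x ∘ φ) a :=
  fun ψ => (h ψ).comp hφ

theorem WeakTendsto.map {E F : Type*} [NormedAddCommGroup E] [NormedSpace ℝ E]
    [NormedAddCommGroup F] [NormedSpace ℝ F] {x : ℕ → E} {a : E}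
    (h : WeakTendsto x a) (T : E →L[ℝ] F) : WeakTendsto (fun n => T (x n)) (T a) :=
  fun ψ => h (ψ.comp T)

/-- Midpoints exist by the direct method. -/
theorem AdmissibleEnergy.exists_midpoint [TopologicalSpace.SeparableSpace V]
    {G : AdmissibleMetric ι} (A : AdmissibleEnergy G) (a b : V) :
    ∃ z : V, IsMidpoint A.W a b z := by
  set F : V → ℝ := fun y => A.W a y + A.W y b with hF
  have hF0 : ∀ y, 0 ≤ F y := fun y => add_nonneg (A.W_nonneg _ _) (A.W_nonneg _ _)
  have hbdd : BddBelow (range F) := ⟨0, by rintro _ ⟨y, rfl⟩; exact hF0 y⟩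
  set I := ⨅ y, F y with hI
  have hmin : ∀ n : ℕ, ∃ y, F y < I + 1 / ((n : ℝ) + 1) := fun n =>
    exists_lt_of_ciInf_lt (lt_add_of_pos_right _ (by positivity))
  choose x hx using hmin
  obtain ⟨γ, hmono, -, hγ0, htop, hγ⟩ := A.coercive
  obtain ⟨M, hM⟩ := (htop.eventually_gt_atTop (I + 1)).exists_forall_of_atTop
  have hbd : ∀ n, ‖x n‖ ≤ ‖a‖ + M := fun n => by
    by_contra! hcon
    have h1 : M ≤ ‖a - x n‖ := by
      have := norm_sub_norm_le (x n) a
      rw [norm_sub_rev]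
      linarith
    have h2 : γ ‖a - x n‖ ≤ A.W a (x n) := hγ _ _
    have h3 := A.W_nonneg (x n) b
    have h4 := hx n
    have h5 : 1 / ((n : ℝ) + 1) ≤ 1 := by
      rw [div_le_one (by positivity)]; linarith [n.cast_nonneg (α := ℝ)]
    have h6 := hM _ h1
    simp only [hF] at h4
    linarith
  obtain ⟨y, φ, hφ, hw⟩ := exists_weakTendsto_subseq hbd
  refine ⟨y, fun z _ => ?_⟩
  have hz : I ≤ F z := ciInf_le hbdd z
  refine le_trans ?_ hz
  have l1 : Tendsto (fun n => A.Wc a (x (φ n))) atTop (𝓝 (A.Wc a y)) :=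
    A.weak_continuous _ _ _ _ (weakTendsto_const a) hw
  have l2 : Tendsto (fun n => A.Wc (x (φ n)) b) atTop (𝓝 (A.Wc y b)) :=
    A.weak_continuous _ _ _ _ hw (weakTendsto_const b)
  have l3 : Tendsto (fun n => G.Q (a - y) (x (φ n))) atTop (𝓝 (G.Q (a - y) y)) := hw _
  have l4 : Tendsto (fun n => G.Q (y - b) (x (φ n))) atTop (𝓝 (G.Q (y - b) y)) := hw _
  -- `Q` is convex, so `W` lies above a function that is weakly continuous and touches it at the
  -- limit
  have l5 : Tendsto (fun n => A.Wc a (x (φ n)) + A.Wc (x (φ n)) b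
      + (2 * (G.Q (a - y) a - G.Q (a - y) (x (φ n))) - G.Q (a - y) (a - y))
      + (2 * (G.Q (y - b) (x (φ n)) - G.Q (y - b) b) - G.Q (y - b) (y - b))) atTop (𝓝 (F y)) := by
    have := ((l1.add l2).add (((l3.const_sub (G.Q (a - y) a)).const_mul 2).sub_const
      (G.Q (a - y) (a - y)))).add
      (((l4.sub_const (G.Q (y - b) b)).const_mul 2).sub_const (G.Q (y - b) (y - b)))
    convert this using 2
    simp only [hF, AdmissibleEnergy.W, map_sub, sub_apply]
    ring
  have l6 : Tendsto (fun n => I + 1 / ((φ n : ℝ) + 1)) atTop (𝓝 (I + 0)) :=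
    (tendsto_one_div_add_atTop_nhds_zero_nat.comp hφ.tendsto_atTop).const_add I
  rw [add_zero] at l6
  refine le_of_tendsto_of_tendsto' l5 l6 fun n => le_trans ?_ (hx (φ n)).le
  have q1 := G.Q_nonneg ((a - x (φ n)) - (a - y))
  have q2 := G.Q_nonneg ((x (φ n) - b) - (y - b))
  have s1 := G.Q_symm (a - x (φ n)) (a - y)
  have s2 := G.Q_symm (x (φ n) - b) (y - b)
  generalize hu : a - x (φ n) = u at *
  generalize hv : x (φ n) - b = v at *
  have e1 : G.Q (a - y) a - G.Q (a - y) (x (φ n)) = G.Q (a - y) u :=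
    (map_sub (G.Q (a - y)) a (x (φ n))).symm.trans (by rw [hu])
  have e2 : G.Q (y - b) (x (φ n)) - G.Q (y - b) b = G.Q (y - b) v :=
    (map_sub (G.Q (y - b)) (x (φ n)) b).symm.trans (by rw [hv])
  rw [e1, e2]
  simp only [hF, AdmissibleEnergy.W, hu, hv]
  generalize a - y = p at *
  generalize y - b = q at *
  simp only [map_sub, sub_apply] at q1 q2
  linarith

end RiemSpline
end

noncomputable section

namespace RiemSpline

variable {V : Type*} [NormedAddCommGroup V] [InnerProductSpace ℝ V] [CompleteSpace V]

/-! ### Primitives of square integrable functions -/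

theorem sq_integral_le {α : Type*} [MeasurableSpace α] {ν : Measure α} [IsFiniteMeasure ν]
    {h : α → ℝ} (hh : MemLp h 2 ν) : (∫ x, h x ∂ν) ^ 2 ≤ ν.real univ * ∫ x, h x ^ 2 ∂ν := by
  have h1 : Integrable h ν := hh.integrable (by norm_num)
  have h2 : Integrable (fun x => h x ^ 2) ν := hh.integrable_sq
  set I := ∫ x, h x ∂ν with hI
  set M := ν.real univ with hM
  have h0 : 0 ≤ ∫ x, (M * h x - I) ^ 2 ∂ν := integral_nonneg fun _ => sq_nonneg _
  have e : ∫ x, (M * h x - I) ^ 2 ∂ν = M ^ 2 * (∫ x, h x ^ 2 ∂ν) - 2 * M * I * I + M * I ^ 2 := by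
    have : (fun x => (M * h x - I) ^ 2)
        = fun x => M ^ 2 * h x ^ 2 - 2 * M * I * h x + I ^ 2 := by ext x; ring
    rw [this, integral_add (by fun_prop) (by fun_prop), integral_sub (by fun_prop) (by fun_prop),
      integral_const_mul, integral_const_mul, integral_const]
    simp [hM, hI]
  rcases (measureReal_nonneg (μ := ν) (s := univ)).eq_or_lt with hz | hz
  · have hν : ν = 0 := by
      rw [← Measure.measure_univ_eq_zero]
      exact (measureReal_eq_zero_iff).1 hz.symm
    simp [hI, hν]
  · rw [e] at h0
    have : 0 ≤ M * (M * (∫ x, h x ^ 2 ∂ν) - I ^ 2) := by linarith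
    have := nonneg_of_mul_nonneg_right this hz
    linarith

instance : IsProbabilityMeasure unitMeasure := ⟨by simp [unitMeasure]⟩

namespace L2

theorem integrable (f : L2 V) : Integrable f unitMeasure :=
  (Lp.memLp f).integrable (by norm_num)

theorem integrable_norm_sq (f : L2 V) : Integrable (fun t => ‖f t‖ ^ 2) unitMeasure :=
  (Lp.memLp f).norm.integrable_sq

theorem norm_sq_eq (f : L2 V) : ‖f‖ ^ 2 = ∫ t, ‖f t‖ ^ 2 ∂unitMeasure := by
  rw [← real_inner_self_eq_norm_sq, L2.inner_def]
  simp

theorem integral_norm_le (f : L2 V) : ∫ t, ‖f t‖ ∂unitMeasure ≤ ‖f‖ := by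
  have h := sq_integral_le (Lp.memLp f).norm
  rw [← norm_sq_eq] at h
  simp only [probReal_univ, one_mul] at h
  exact abs_le_of_sq_le_sq' h (norm_nonneg _) |>.2

/-- Extension by zero of (a representative of) an `L²` function on the unit interval. -/
def ext0 (f : L2 V) : ℝ → V := (Ioo (0 : ℝ) 1).indicator f

theorem integrable_ext0 (f : L2 V) : Integrable f.ext0 :=
  (integrable_indicator_iff measurableSet_Ioo).2 f.integrable

theorem intervalIntegrable_ext0 (f : L2 V) (a b : ℝ) : IntervalIntegrable f.ext0 volume a b :=
  f.integrable_ext0.intervalIntegrable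

theorem ext0_congr {f : L2 V} {h : ℝ → V} (hf : f =ᵐ[unitMeasure] h) :
    f.ext0 =ᵐ[volume] (Ioo (0 : ℝ) 1).indicator h := by
  have := (ae_restrict_iff' measurableSet_Ioo).1 hf
  filter_upwards [this] with t ht
  by_cases h1 : t ∈ Ioo (0 : ℝ) 1
  · simp [ext0, h1, ht h1]
  · simp [ext0, h1]

theorem ext0_add (f g : L2 V) : (f + g).ext0 =ᵐ[volume] f.ext0 + g.ext0 := by
  refine (ext0_congr (Lp.coeFn_add f g)).trans (Eventually.of_forall fun t => ?_)
  exact congrFun (indicator_add (Ioo (0 : ℝ) 1) (f : ℝ → V) g) t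

theorem ext0_smul (c : ℝ) (f : L2 V) : (c • f).ext0 =ᵐ[volume] c • f.ext0 := by
  refine (ext0_congr (Lp.coeFn_smul c f)).trans (Eventually.of_forall fun t => ?_)
  by_cases h : t ∈ Ioo (0 : ℝ) 1 <;> simp [ext0, h]

/-- The primitive, vanishing at `0`, of an `L²` function. -/
def prim (f : L2 V) (t : ℝ) : V := ∫ s in (0 : ℝ)..t, f.ext0 s

@[simp] theorem prim_zero (f : L2 V) : f.prim 0 = 0 := by simp [prim]

theorem continuous_prim (f : L2 V) : Continuous f.prim :=
  intervalIntegral.continuous_primitive f.intervalIntegrable_ext0 0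

theorem prim_sub_prim (f : L2 V) (s t : ℝ) : f.prim t - f.prim s = ∫ r in s..t, f.ext0 r :=
  intervalIntegral.integral_interval_sub_left (f.intervalIntegrable_ext0 _ _)
    (f.intervalIntegrable_ext0 _ _)

theorem norm_prim_le (f : L2 V) (t : ℝ) : ‖f.prim t‖ ≤ ‖f‖ := by
  refine (intervalIntegral.norm_integral_le_integral_norm_uIoc).trans ?_
  refine (setIntegral_le_integral f.integrable_ext0.norm
    (Eventually.of_forall fun _ => norm_nonneg _)).trans ?_
  refine le_trans (le_of_eq ?_) f.integral_norm_le
  rw [← integral_indicator measurableSet_Ioo]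
  congr 1
  ext t
  simp [ext0, norm_indicator_eq_indicator_norm]

theorem prim_add (f g : L2 V) (t : ℝ) : (f + g).prim t = f.prim t + g.prim t := by
  rw [prim, prim, prim, ← intervalIntegral.integral_add (f.intervalIntegrable_ext0 _ _)
    (g.intervalIntegrable_ext0 _ _)]
  refine intervalIntegral.integral_congr_ae ?_
  filter_upwards [ext0_add f g] with s hs _ using hs

theorem prim_smul (c : ℝ) (f : L2 V) (t : ℝ) : (c • f).prim t = c • f.prim t := by
  rw [prim, prim, ← intervalIntegral.integral_smul]
  refine intervalIntegral.integral_congr_ae ?_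
  filter_upwards [ext0_smul c f] with s hs _ using hs

/-- Evaluation of the primitive as a continuous linear map. -/
def primL (t : ℝ) : L2 V →L[ℝ] V :=
  LinearMap.mkContinuous
    { toFun := fun f => f.prim t
      map_add' := fun f g => prim_add f g t
      map_smul' := fun c f => prim_smul c f t } 1 (fun f => by simpa using f.norm_prim_le t)

theorem prim_congr {f : L2 V} {h : ℝ → V} (hf : f =ᵐ[unitMeasure] h) {t : ℝ}
    (ht : t ∈ Icc (0 : ℝ) 1) : f.prim t = ∫ s in (0 : ℝ)..t, h s := by
  refine intervalIntegral.integral_congr_ae ?_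
  have h1 : ∀ᵐ s : ℝ, s ≠ 1 := by simp [ae_iff]
  filter_upwards [ext0_congr hf, h1] with s hs hs1 hs2
  rw [uIoc_of_le ht.1] at hs2
  rw [hs, indicator_of_mem]
  exact ⟨hs2.1, lt_of_le_of_ne (hs2.2.trans ht.2) hs1⟩

theorem prim_memLp (f : L2 V) : MemLp f.prim 2 unitMeasure :=
  MemLp.of_bound f.continuous_prim.aestronglyMeasurable ‖f‖ (Eventually.of_forall f.norm_prim_le)

theorem integrable_prim (f : L2 V) : Integrable f.prim unitMeasure :=
  f.prim_memLp.integrable (by norm_num)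

end L2

theorem IsTest.apply_one {φ : ℝ → ℝ} (h : IsTest φ) : φ 1 = 0 := by
  by_contra hne
  have := h.2.2 (subset_tsupport φ hne)
  exact lt_irrefl _ this.2

theorem IsTest.differentiable {φ : ℝ → ℝ} (h : IsTest φ) : Differentiable ℝ φ :=
  h.1.differentiable (by simp)

/-- Integration by parts for the primitive of an integrable function. -/
theorem L2.isWeakDeriv_prim (f : L2 V) {φ : ℝ → ℝ} (hφ : IsTest φ) :
    ∫ t, deriv φ t • f.prim t ∂unitMeasure = - ∫ t, φ t • f t ∂unitMeasure := by
  have hint : Integrable (Function.uncurry fun t s : ℝ =>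
      (Iic t).indicator (fun s => deriv φ t • f s) s)
      (unitMeasure.prod unitMeasure) := by
    have h1 : Integrable (deriv φ) unitMeasure :=
      (hφ.continuous_deriv.integrable_of_hasCompactSupport hφ.2.1.deriv).restrict
    have h2 := h1.smul_prod f.integrable
    have h3 : MeasurableSet {p : ℝ × ℝ | p.2 ≤ p.1} :=
      measurableSet_le measurable_snd measurable_fst
    refine (h2.indicator h3).congr (Eventually.of_forall fun p => ?_)
    simp only [Function.uncurry, indicator, mem_ofPred_eq, mem_Iic]
  -- write the primitive as an integral over the triangle `s ≤ t` and exchange the integrals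
  have e1 : ∀ t ∈ Ioo (0 : ℝ) 1, deriv φ t • f.prim t
      = ∫ s, (Iic t).indicator (fun s => deriv φ t • f s) s ∂unitMeasure := by
    intro t ht
    rw [integral_indicator measurableSet_Iic, integral_smul, L2.prim,
      intervalIntegral.integral_of_le ht.1.le, Measure.restrict_restrict measurableSet_Iic]
    congr 1
    have : Iic t ∩ Ioo (0 : ℝ) 1 = Ioc 0 t := by
      ext s; simp only [mem_inter_iff, mem_Iic, mem_Ioo, mem_Ioc]
      exact ⟨fun h => ⟨h.2.1, h.1⟩, fun h => ⟨h.2, h.1, h.2.trans_lt ht.2⟩⟩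
    rw [this]
    refine setIntegral_congr_fun measurableSet_Ioc fun s hs => ?_
    exact indicator_of_mem (show s ∈ Ioo (0 : ℝ) 1 from ⟨hs.1, hs.2.trans_lt ht.2⟩) _
  have e2 : ∀ s ∈ Ioo (0 : ℝ) 1,
      ∫ t, (Iic t).indicator (fun s => deriv φ t • f s) s ∂unitMeasure = -(φ s • f s) := by
    intro s hs
    have h1 : (fun t => (Iic t).indicator (fun s => deriv φ t • f s) s)
        = (Ici s).indicator (fun t => deriv φ t • f s) := by
      ext t; simp [indicator]
    rw [h1, integral_indicator measurableSet_Ici, integral_smul_const,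
      Measure.restrict_restrict measurableSet_Ici]
    have h2 : Ici s ∩ Ioo (0 : ℝ) 1 = Ico s 1 := by
      ext t; simp only [mem_inter_iff, mem_Ici, mem_Ioo, mem_Ico]
      exact ⟨fun h => ⟨h.1, h.2.2⟩, fun h => ⟨h.1, hs.1.trans_le h.1, h.2⟩⟩
    rw [h2, integral_Ico_eq_integral_Ioc, ← intervalIntegral.integral_of_le hs.2.le,
      intervalIntegral.integral_deriv_eq_sub (fun x _ => hφ.differentiable x)
        (hφ.continuous_deriv.intervalIntegrable _ _), hφ.apply_one]
    simp
  rw [setIntegral_congr_fun measurableSet_Ioo e1, integral_integral_swap hint,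
    setIntegral_congr_fun measurableSet_Ioo e2, integral_neg]

/-- The lemma of du Bois-Reymond: a function with vanishing weak derivative is constant. -/
theorem ae_eq_const_of_weakDeriv_zero {h : ℝ → V} (hh : Integrable h unitMeasure)
    (h0 : ∀ φ : ℝ → ℝ, IsTest φ → ∫ t, deriv φ t • h t ∂unitMeasure = 0) :
    ∃ c : V, h =ᵐ[unitMeasure] fun _ => c := by
  -- subtracting a multiple of a fixed bump of integral one, every test function becomes the
  -- derivative of a test function
  let B : ContDiffBump (1 / 2 : ℝ) := ⟨1 / 8, 1 / 4, by norm_num, by norm_num⟩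
  set ρ : ℝ → ℝ := B.normed volume with hρ
  have hρd : ContDiff ℝ (⊤ : ℕ∞) ρ := B.contDiff_normed
  have hρc : HasCompactSupport ρ := B.hasCompactSupport_normed
  have hρs : tsupport ρ ⊆ Ioo (0 : ℝ) 1 := by
    rw [hρ, B.tsupport_normed_eq, Real.closedBall_eq_Icc]
    exact Icc_subset_Ioo (by norm_num [B]) (by norm_num [B])
  have hρi : ∫ t, ρ t = 1 := B.integral_normed
  have hint : ∀ g : ℝ → ℝ, Continuous g → HasCompactSupport g →
      Integrable (fun t => g t • h t) unitMeasure := fun g hg hgc => by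
    obtain ⟨C, hC⟩ := hgc.exists_bound_of_continuous hg
    exact hh.bdd_smul C hg.aestronglyMeasurable (Eventually.of_forall hC)
  set c := ∫ t, ρ t • h t ∂unitMeasure with hc
  refine ⟨c, ?_⟩
  have key : ∀ g : ℝ → ℝ, ContDiff ℝ (⊤ : ℕ∞) g → HasCompactSupport g → tsupport g ⊆ Ioo 0 1 →
      ∫ t, g t • (h t - c) ∂unitMeasure = 0 := by
    intro g hg hgc hgs
    have iu : ∀ g : ℝ → ℝ, tsupport g ⊆ Ioo 0 1 → ∫ t, g t ∂unitMeasure = ∫ t, g t := fun g hs =>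
      setIntegral_eq_integral_of_forall_compl_eq_zero fun t ht =>
        image_eq_zero_of_notMem_tsupport fun h => ht (hs h)
    set m := ∫ t, g t with hm
    set ψ : ℝ → ℝ := fun t => g t - m * ρ t with hψ
    have hψd : ContDiff ℝ (⊤ : ℕ∞) ψ := hg.sub (contDiff_const.mul hρd)
    have gi : Integrable g := hg.continuous.integrable_of_hasCompactSupport hgc
    have ri : Integrable ρ := hρd.continuous.integrable_of_hasCompactSupport hρc
    have ψi : Integrable ψ := gi.sub (ri.const_mul m)
    have ψ0 : ∫ t, ψ t = 0 := by
      rw [hψ, integral_sub gi (ri.const_mul m), integral_const_mul, hρi]; simp [hm]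
    have Kc : IsCompact (tsupport g ∪ tsupport ρ) := hgc.isCompact.union hρc.isCompact
    have Kn : (tsupport g ∪ tsupport ρ).Nonempty := by
      by_contra hne
      rw [not_nonempty_iff_eq_empty, union_empty_iff, tsupport_eq_empty_iff] at hne
      rw [tsupport_eq_empty_iff.1 hne.2] at hρi
      simp at hρi
    obtain ⟨a, ha, hal⟩ := Kc.exists_isLeast Kn
    obtain ⟨b, hb, hbl⟩ := Kc.exists_isGreatest Kn
    have Ks : tsupport g ∪ tsupport ρ ⊆ Ioo 0 1 := union_subset hgs hρs
    have ψz : ∀ t, t ∉ tsupport g ∪ tsupport ρ → ψ t = 0 := fun t ht => by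
      rw [mem_union, not_or] at ht
      simp [hψ, image_eq_zero_of_notMem_tsupport ht.1, image_eq_zero_of_notMem_tsupport ht.2]
    have ψa : ∀ t < a, ψ t = 0 := fun t ht => ψz t fun h => absurd (hal h) (not_le.2 ht)
    have ψb : ∀ t > b, ψ t = 0 := fun t ht => ψz t fun h => absurd (hbl h) (not_le.2 ht)
    set Ψ : ℝ → ℝ := fun t => ∫ s in Iic t, ψ s with hΨ
    have Ψd : ∀ t, HasDerivAt Ψ (ψ t) t := fun t => by
      have e : Ψ = fun t => (∫ s in Iic 0, ψ s) + ∫ s in (0 : ℝ)..t, ψ s := by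
        ext t
        rw [hΨ, ← intervalIntegral.integral_Iic_sub_Iic ψi.integrableOn ψi.integrableOn]
        ring
      rw [e]
      exact (intervalIntegral.integral_hasDerivAt_right ψi.intervalIntegrable
        (hψd.continuous.stronglyMeasurableAtFilter _ _) hψd.continuous.continuousAt).const_add _
    have Ψderiv : deriv Ψ = ψ := funext fun t => (Ψd t).deriv
    have Ψz : ∀ t, t ∉ Icc a b → Ψ t = 0 := by
      intro t ht
      rw [mem_Icc, not_and_or, not_le, not_le] at ht
      rcases ht with ht | ht
      · exact setIntegral_eq_zero_of_forall_eq_zero fun s hs => ψa s (lt_of_le_of_lt hs ht)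
      · rw [← ψ0]
        refine setIntegral_eq_integral_of_forall_compl_eq_zero fun s hs => ψb s ?_
        simp only [mem_Iic, not_le] at hs
        exact ht.trans hs
    have Ψt : IsTest Ψ := by
      refine ⟨contDiff_infty_iff_deriv.2 ⟨fun t => (Ψd t).differentiableAt, by rwa [Ψderiv]⟩,
        HasCompactSupport.intro isCompact_Icc Ψz, ?_⟩
      refine (closure_minimal (fun t ht => ?_) isClosed_Icc).trans
        (Icc_subset_Ioo (Ks ha).1 (Ks hb).2)
      by_contra hcon
      exact ht (Ψz t hcon)
    have h1 := h0 Ψ Ψt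
    rw [Ψderiv] at h1
    have h2 : ∫ t, ψ t • h t ∂unitMeasure = (∫ t, g t • h t ∂unitMeasure) - m • c := by
      have h3 : Integrable (fun t => m • ρ t • h t) unitMeasure :=
        (hint ρ hρd.continuous hρc).smul m
      rw [hc, ← integral_smul, ← integral_sub (hint g hg.continuous hgc) h3]
      refine integral_congr_ae (Eventually.of_forall fun t => ?_)
      simp [hψ, sub_smul, mul_smul]
    have h3 : ∫ t, g t • (h t - c) ∂unitMeasure = (∫ t, g t • h t ∂unitMeasure) - m • c := by
      rw [hm, ← iu g hgs, ← integral_smul_const, ← integral_sub (hint g hg.continuous hgc)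
        (gi.restrict.smul_const c)]
      simp [smul_sub]
    rw [h3, ← h2, h1]
  have hloc : LocallyIntegrableOn (fun t => h t - c) (Ioo (0 : ℝ) 1) := by
    have : IntegrableOn (fun t => h t - c) (Ioo (0 : ℝ) 1) := hh.sub (integrable_const c)
    exact this.locallyIntegrableOn
  have fin := isOpen_Ioo.ae_eq_zero_of_integral_contDiff_smul_eq_zero hloc fun g hg hgc hgs => by
    rw [← key g hg hgc hgs]
    refine (setIntegral_eq_integral_of_forall_compl_eq_zero fun t ht => ?_).symm
    rw [image_eq_zero_of_notMem_tsupport fun h => ht (hgs h), zero_smul]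
  rw [EventuallyEq, ae_restrict_iff' measurableSet_Ioo]
  filter_upwards [fin] with t ht hmem
  exact sub_eq_zero.1 (ht hmem)

end RiemSpline
end

noncomputable section

namespace RiemSpline

variable {V : Type*} [NormedAddCommGroup V] [InnerProductSpace ℝ V] [CompleteSpace V]

/-! ### The continuous representatives of Sobolev curves -/

/-- The constant `c` in `u = c + ∫ v`, where `v` is the weak derivative of `u`, as a continuous
linear function of `u` and `v`. -/
def meanDiff (u v : L2 V) : V := ∫ t, (u t - v.prim t) ∂unitMeasure

theorem meanDiff_eq (u v : L2 V) :
    meanDiff u v = (∫ t, u t ∂unitMeasure) - ∫ t, v.prim t ∂unitMeasure :=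
  integral_sub u.integrable v.integrable_prim

theorem meanDiff_add (u v u' v' : L2 V) :
    meanDiff (u + u') (v + v') = meanDiff u v + meanDiff u' v' := by
  simp only [meanDiff_eq, L2.prim_add]
  rw [integral_congr_ae (Lp.coeFn_add u u')]
  simp only [Pi.add_apply]
  rw [integral_add u.integrable u'.integrable, integral_add v.integrable_prim v'.integrable_prim]
  abel

theorem meanDiff_smul (c : ℝ) (u v : L2 V) : meanDiff (c • u) (c • v) = c • meanDiff u v := by
  simp only [meanDiff_eq, L2.prim_smul]
  rw [integral_congr_ae (Lp.coeFn_smul c u)]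
  simp only [Pi.smul_apply]
  rw [integral_smul, integral_smul, smul_sub]

theorem norm_meanDiff_le (u v : L2 V) : ‖meanDiff u v‖ ≤ ‖u‖ + ‖v‖ := by
  rw [meanDiff_eq]
  refine (norm_sub_le _ _).trans (add_le_add ?_ ?_)
  · exact (norm_integral_le_integral_norm _).trans u.integral_norm_le
  · refine (norm_integral_le_of_norm_le_const (Eventually.of_forall v.norm_prim_le)).trans ?_
    simp

theorem IsWeakDeriv.ae_eq {u v : L2 V} (h : IsWeakDeriv u v) :
    u =ᵐ[unitMeasure] fun t => meanDiff u v + v.prim t := by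
  obtain ⟨c, hc⟩ := ae_eq_const_of_weakDeriv_zero (u.integrable.sub v.integrable_prim)
    (fun φ hφ => by
      have h2 := v.isWeakDeriv_prim hφ
      have i2 : Integrable (fun t => deriv φ t • v.prim t) unitMeasure := by
        obtain ⟨C, hC⟩ := hφ.2.1.deriv.exists_bound_of_continuous hφ.continuous_deriv
        exact v.integrable_prim.bdd_smul C hφ.continuous_deriv.aestronglyMeasurable
          (Eventually.of_forall hC)
      simp only [Pi.sub_apply, smul_sub]
      rw [integral_sub (L2.integrable_smul hφ.continuous_deriv hφ.2.1.deriv u) i2, h φ hφ, h2]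
      simp)
  have hm : meanDiff u v = c := by
    rw [meanDiff, ← Pi.sub_def, integral_congr_ae hc]; simp
  filter_upwards [hc] with t ht
  rw [hm, ← ht]
  simp

namespace W22

theorem norm_sq_eq (u : W22 V) : ‖u‖ ^ 2 = ‖u.curve‖ ^ 2 + ‖u.vel‖ ^ 2 + ‖u.acc‖ ^ 2 := by
  have : ‖u‖ = ‖u.1‖ := rfl
  rw [this, PiLp.norm_sq_eq_of_L2, Fin.sum_univ_three]
  rfl

theorem norm_curve_le (u : W22 V) : ‖u.curve‖ ≤ ‖u‖ :=
  abs_le_of_sq_le_sq' (by rw [norm_sq_eq u]; nlinarith [sq_nonneg ‖u.vel‖, sq_nonneg ‖u.acc‖])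
    (norm_nonneg _) |>.2

theorem norm_vel_le (u : W22 V) : ‖u.vel‖ ≤ ‖u‖ :=
  abs_le_of_sq_le_sq' (by rw [norm_sq_eq u]; nlinarith [sq_nonneg ‖u.curve‖, sq_nonneg ‖u.acc‖])
    (norm_nonneg _) |>.2

theorem norm_acc_le (u : W22 V) : ‖u.acc‖ ≤ ‖u‖ :=
  abs_le_of_sq_le_sq' (by rw [norm_sq_eq u]; nlinarith [sq_nonneg ‖u.vel‖, sq_nonneg ‖u.curve‖])
    (norm_nonneg _) |>.2

theorem norm_le_add (u : W22 V) : ‖u‖ ≤ ‖u.curve‖ + ‖u.vel‖ + ‖u.acc‖ := by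
  refine abs_le_of_sq_le_sq' ?_ (by positivity) |>.2
  rw [norm_sq_eq u]
  nlinarith [norm_nonneg u.curve, norm_nonneg u.vel, norm_nonneg u.acc,
    mul_nonneg (norm_nonneg u.curve) (norm_nonneg u.vel),
    mul_nonneg (norm_nonneg u.curve) (norm_nonneg u.acc),
    mul_nonneg (norm_nonneg u.vel) (norm_nonneg u.acc)]

/-- The velocity as a continuous linear map. -/
def velL : W22 V →L[ℝ] L2 V :=
  LinearMap.mkContinuous
    { toFun := fun u => u.vel, map_add' := fun _ _ => rfl, map_smul' := fun _ _ => rfl } 1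
    (fun u => by rw [one_mul]; exact u.norm_vel_le)

/-- The acceleration as a continuous linear map. -/
def accL : W22 V →L[ℝ] L2 V :=
  LinearMap.mkContinuous
    { toFun := fun u => u.acc, map_add' := fun _ _ => rfl, map_smul' := fun _ _ => rfl } 1
    (fun u => by rw [one_mul]; exact u.norm_acc_le)

@[simp] theorem velL_apply (u : W22 V) : velL u = u.vel := rfl

/-- The initial position of a Sobolev curve. -/
def pos0 (u : W22 V) : V := meanDiff u.curve u.vel

/-- The initial velocity of a Sobolev curve. -/
def vel0 (u : W22 V) : V := meanDiff u.vel u.acc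

theorem norm_pos0_le (u : W22 V) : ‖u.pos0‖ ≤ 2 * ‖u‖ :=
  (norm_meanDiff_le _ _).trans (by linarith [u.norm_curve_le, u.norm_vel_le])

theorem norm_vel0_le (u : W22 V) : ‖u.vel0‖ ≤ 2 * ‖u‖ :=
  (norm_meanDiff_le _ _).trans (by linarith [u.norm_acc_le, u.norm_vel_le])

/-- The continuous representative of a Sobolev curve. -/
def c (u : W22 V) (t : ℝ) : V := u.pos0 + u.vel.prim t

/-- The continuous representative of the velocity of a Sobolev curve. -/
def v (u : W22 V) (t : ℝ) : V := u.vel0 + u.acc.prim t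

theorem continuous_c (u : W22 V) : Continuous u.c := continuous_const.add u.vel.continuous_prim

theorem continuous_v (u : W22 V) : Continuous u.v := continuous_const.add u.acc.continuous_prim

theorem curve_ae (u : W22 V) : u.curve =ᵐ[unitMeasure] u.c := u.2.1.ae_eq

theorem vel_ae (u : W22 V) : u.vel =ᵐ[unitMeasure] u.v := u.2.2.ae_eq

@[simp] theorem c_zero (u : W22 V) : u.c 0 = u.pos0 := by simp [c]

@[simp] theorem v_zero (u : W22 V) : u.v 0 = u.vel0 := by simp [v]

theorem norm_c_le (u : W22 V) (t : ℝ) : ‖u.c t‖ ≤ 3 * ‖u‖ :=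
  (norm_add_le _ _).trans (by linarith [u.norm_pos0_le, u.vel.norm_prim_le t, u.norm_vel_le])

theorem norm_v_le (u : W22 V) (t : ℝ) : ‖u.v t‖ ≤ 3 * ‖u‖ :=
  (norm_add_le _ _).trans (by linarith [u.norm_vel0_le, u.acc.norm_prim_le t, u.norm_acc_le])

/-- Evaluation of the curve at a time as a continuous linear map. -/
def evalC (t : ℝ) : W22 V →L[ℝ] V :=
  LinearMap.mkContinuous
    { toFun := fun u => u.c t
      map_add' := fun u w => by
        have h1 : meanDiff (u + w).curve (u + w).vel = _ := meanDiff_add u.curve u.vel w.curve w.vel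
        have h2 : L2.prim (u + w).vel t = _ := L2.prim_add u.vel w.vel t
        simp only [c, pos0, h1, h2]; abel
      map_smul' := fun a u => by
        have h1 : meanDiff (a • u).curve (a • u).vel = _ := meanDiff_smul a u.curve u.vel
        have h2 : L2.prim (a • u).vel t = _ := L2.prim_smul a u.vel t
        simp only [c, pos0, h1, h2, smul_add, RingHom.id_apply] } 3
    (fun u => u.norm_c_le t)

/-- Evaluation of the velocity at a time as a continuous linear map. -/
def evalV (t : ℝ) : W22 V →L[ℝ] V :=
  LinearMap.mkContinuous
    { toFun := fun u => u.v t
      map_add' := fun u w => by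
        have h1 : meanDiff (u + w).vel (u + w).acc = _ := meanDiff_add u.vel u.acc w.vel w.acc
        have h2 : L2.prim (u + w).acc t = _ := L2.prim_add u.acc w.acc t
        simp only [v, vel0, h1, h2]; abel
      map_smul' := fun a u => by
        have h1 : meanDiff (a • u).vel (a • u).acc = _ := meanDiff_smul a u.vel u.acc
        have h2 : L2.prim (a • u).acc t = _ := L2.prim_smul a u.acc t
        simp only [v, vel0, h1, h2, smul_add, RingHom.id_apply] } 3
    (fun u => u.norm_v_le t)

@[simp] theorem evalC_apply (t : ℝ) (u : W22 V) : evalC t u = u.c t := rfl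
@[simp] theorem evalV_apply (t : ℝ) (u : W22 V) : evalV t u = u.v t := rfl

theorem v_sub (u : W22 V) (s t : ℝ) : u.v t - u.v s = ∫ r in s..t, u.acc.ext0 r := by
  rw [← L2.prim_sub_prim]; simp [v]

theorem c_eq_integral (u : W22 V) {t : ℝ} (ht : t ∈ Icc (0 : ℝ) 1) :
    u.c t = u.pos0 + ∫ r in (0 : ℝ)..t, u.v r := by
  rw [c, L2.prim_congr u.vel_ae ht]

theorem c_sub (u : W22 V) {s t : ℝ} (hs : s ∈ Icc (0 : ℝ) 1) (ht : t ∈ Icc (0 : ℝ) 1) :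
    u.c t - u.c s = ∫ r in s..t, u.v r := by
  rw [u.c_eq_integral hs, u.c_eq_integral ht, add_sub_add_left_eq_sub]
  exact intervalIntegral.integral_interval_sub_left (u.continuous_v.intervalIntegrable _ _)
    (u.continuous_v.intervalIntegrable _ _)

/-- The velocity is Hölder continuous with exponent `1/2`. -/
theorem norm_v_sub_sq_le (u : W22 V) {s t : ℝ} (hst : s ≤ t) :
    ‖u.v t - u.v s‖ ^ 2 ≤ (t - s) * ∫ r in s..t, ‖u.acc.ext0 r‖ ^ 2 := by
  rw [v_sub, intervalIntegral.integral_of_le hst, intervalIntegral.integral_of_le hst]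
  have hm : MemLp (fun r => ‖u.acc.ext0 r‖) 2 (volume.restrict (Ioc s t)) := by
    have : MemLp u.acc.ext0 2 volume := (memLp_indicator_iff_restrict measurableSet_Ioo).2
      (Lp.memLp u.acc)
    exact this.norm.restrict _
  have h1 := sq_integral_le hm
  have h2 : (volume.restrict (Ioc s t)).real univ = t - s := by
    simp [measureReal_def, ENNReal.toReal_ofReal (sub_nonneg.2 hst)]
  rw [h2] at h1
  exact (pow_le_pow_left₀ (norm_nonneg _) (norm_integral_le_integral_norm _) 2).trans h1

theorem integrable_ext0_sq (f : L2 V) : Integrable fun r => ‖f.ext0 r‖ ^ 2 := by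
  have : MemLp f.ext0 2 volume := (memLp_indicator_iff_restrict measurableSet_Ioo).2 (Lp.memLp f)
  exact this.norm.integrable_sq

theorem integral_ext0_sq (f : L2 V) : ∫ r, ‖f.ext0 r‖ ^ 2 = ‖f‖ ^ 2 := by
  rw [L2.norm_sq_eq, ← integral_indicator measurableSet_Ioo]
  congr 1; ext r
  by_cases h : r ∈ Ioo (0 : ℝ) 1 <;> simp [L2.ext0, h]

theorem integral_ext0_sq_le (f : L2 V) {s t : ℝ} (hst : s ≤ t) :
    ∫ r in s..t, ‖f.ext0 r‖ ^ 2 ≤ ‖f‖ ^ 2 := by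
  rw [← integral_ext0_sq, intervalIntegral.integral_of_le hst]
  exact setIntegral_le_integral (integrable_ext0_sq f) (Eventually.of_forall fun _ => sq_nonneg _)

theorem norm_v_sub_sq_le' (u : W22 V) (s t : ℝ) : ‖u.v t - u.v s‖ ^ 2 ≤ |t - s| * ‖u‖ ^ 2 := by
  wlog hst : s ≤ t generalizing s t
  · rw [norm_sub_rev, abs_sub_comm]; exact this t s (le_of_not_ge hst)
  rw [abs_of_nonneg (sub_nonneg.2 hst)]
  refine (u.norm_v_sub_sq_le hst).trans ?_
  have := sub_nonneg.2 hst
  gcongr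
  exact (integral_ext0_sq_le _ hst).trans (pow_le_pow_left₀ (norm_nonneg _) u.norm_acc_le 2)

theorem norm_c_sub_le (u : W22 V) {s t : ℝ} (hs : s ∈ Icc (0 : ℝ) 1) (ht : t ∈ Icc (0 : ℝ) 1) :
    ‖u.c t - u.c s‖ ≤ 3 * ‖u‖ * |t - s| := by
  rw [u.c_sub hs ht]
  exact intervalIntegral.norm_integral_le_of_norm_le_const fun r _ => u.norm_v_le r

theorem hasValueAt_iff {f : L2 V} {r : ℝ → V} (hr : Continuous r) (hf : f =ᵐ[unitMeasure] r) {t : ℝ}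
    (ht : t ∈ Icc (0 : ℝ) 1) {a : V} : HasValueAt f t a ↔ r t = a := by
  constructor
  · rintro ⟨w, hw, hfw, rfl⟩
    refine Measure.eqOn_Icc_of_ae_eq volume (zero_ne_one' ℝ) ?_ hr.continuousOn hw ht
    rw [← restrict_Ioo_eq_restrict_Icc]
    exact hf.symm.trans hfw
  · rintro rfl
    exact ⟨r, hr.continuousOn, hf, rfl⟩

theorem hasValueAt_curve (u : W22 V) {t : ℝ} (ht : t ∈ Icc (0 : ℝ) 1) {a : V} :
    HasValueAt u.curve t a ↔ u.c t = a := hasValueAt_iff u.continuous_c u.curve_ae ht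

theorem hasValueAt_vel (u : W22 V) {t : ℝ} (ht : t ∈ Icc (0 : ℝ) 1) {a : V} :
    HasValueAt u.vel t a ↔ u.v t = a := hasValueAt_iff u.continuous_v u.vel_ae ht

/-- The Sobolev curve with given initial position, initial velocity, and acceleration. -/
def ofAcc (x y : V) (f : L2 V) : W22 V :=
  let hv : MemLp (fun t => y + f.prim t) 2 unitMeasure := (memLp_const y).add f.prim_memLp
  let w : L2 V := hv.toLp _
  let hu : MemLp (fun t => x + w.prim t) 2 unitMeasure := (memLp_const x).add w.prim_memLp
  ⟨WithLp.toLp 2 ![hu.toLp _, w, f], by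
    have hP : ∀ (z : V) (g : L2 V) (h : MemLp (fun t => z + g.prim t) 2 unitMeasure),
        IsWeakDeriv (h.toLp _) g := by
      intro z g h φ hφ
      have e1 : ∫ t, deriv φ t • (h.toLp _ : L2 V) t ∂unitMeasure
          = ∫ t, (deriv φ t • z + deriv φ t • g.prim t) ∂unitMeasure := by
        refine integral_congr_ae ?_
        filter_upwards [h.coeFn_toLp] with t ht
        rw [ht, smul_add]
      have i1 : Integrable (deriv φ) unitMeasure :=
        (hφ.continuous_deriv.integrable_of_hasCompactSupport hφ.2.1.deriv).restrict
      have i2 : Integrable (fun t => deriv φ t • g.prim t) unitMeasure := by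
        obtain ⟨C, hC⟩ := hφ.2.1.deriv.exists_bound_of_continuous hφ.continuous_deriv
        exact g.integrable_prim.bdd_smul C hφ.continuous_deriv.aestronglyMeasurable
          (Eventually.of_forall hC)
      have z1 : ∫ t, deriv φ t ∂unitMeasure = 0 := by
        rw [unitMeasure, ← integral_Ioc_eq_integral_Ioo,
          ← intervalIntegral.integral_of_le zero_le_one,
          intervalIntegral.integral_deriv_eq_sub (fun x _ => hφ.differentiable x)
            (hφ.continuous_deriv.intervalIntegrable _ _), hφ.apply_one]
        have : φ 0 = 0 := by
          by_contra hne
          exact lt_irrefl _ (hφ.2.2 (subset_tsupport φ hne)).1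
        rw [this, sub_zero]
      rw [e1, integral_add (i1.smul_const z) i2, integral_smul_const, z1, zero_smul, zero_add,
        g.isWeakDeriv_prim hφ]
    exact ⟨hP x w hu, hP y f hv⟩⟩

@[simp] theorem acc_ofAcc (x y : V) (f : L2 V) : (ofAcc x y f).acc = f := rfl

@[simp] theorem vel0_ofAcc (x y : V) (f : L2 V) : (ofAcc x y f).vel0 = y := by
  have hv : MemLp (fun t => y + f.prim t) 2 unitMeasure := (memLp_const y).add f.prim_memLp
  have h : (ofAcc x y f).vel =ᵐ[unitMeasure] fun t => y + f.prim t := hv.coeFn_toLp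
  rw [vel0, meanDiff, acc_ofAcc]
  have : ∫ t, ((ofAcc x y f).vel t - f.prim t) ∂unitMeasure = ∫ _, y ∂unitMeasure := by
    refine integral_congr_ae ?_
    filter_upwards [h] with t ht
    rw [ht]; simp
  rw [this]; simp

@[simp] theorem pos0_ofAcc (x y : V) (f : L2 V) : (ofAcc x y f).pos0 = x := by
  set w := (ofAcc x y f).vel with hw
  have hu : MemLp (fun t => x + w.prim t) 2 unitMeasure := (memLp_const x).add w.prim_memLp
  have h : (ofAcc x y f).curve =ᵐ[unitMeasure] fun t => x + w.prim t := hu.coeFn_toLp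
  rw [pos0, meanDiff]
  have : ∫ t, ((ofAcc x y f).curve t - w.prim t) ∂unitMeasure = ∫ _, x ∂unitMeasure := by
    refine integral_congr_ae ?_
    filter_upwards [h] with t ht
    rw [ht]; simp
  rw [this]; simp

theorem norm_toLp_le {r : ℝ → V} {f : L2 V} {C : ℝ} (hf : f =ᵐ[unitMeasure] r)
    (hr : ∀ t, ‖r t‖ ≤ C) : ‖f‖ ≤ C := by
  have hC : 0 ≤ C := (norm_nonneg _).trans (hr 0)
  refine (Lp.norm_le_of_ae_bound hC (C := C) (hf.mono fun t ht => ht ▸ hr t)).trans ?_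
  simp [measureUnivNNReal]

/-- A Sobolev curve is controlled by its initial data and its acceleration. -/
theorem norm_le_data (u : W22 V) : ‖u‖ ≤ ‖u.pos0‖ + 2 * ‖u.vel0‖ + 3 * ‖u.acc‖ := by
  have h1 : ‖u.vel‖ ≤ ‖u.vel0‖ + ‖u.acc‖ := norm_toLp_le u.vel_ae fun t =>
    (norm_add_le _ _).trans (by gcongr; exact u.acc.norm_prim_le t)
  have h2 : ‖u.curve‖ ≤ ‖u.pos0‖ + ‖u.vel‖ := norm_toLp_le u.curve_ae fun t =>
    (norm_add_le _ _).trans (by gcongr; exact u.vel.norm_prim_le t)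
  linarith [u.norm_le_add]

/-- A Sobolev curve is determined by its continuous representative. -/
theorem ext_of_curve {u w : W22 V} (h : u.curve =ᵐ[unitMeasure] w.curve) : u = w := by
  -- weak derivatives are unique
  have key : ∀ {f f' g g' : L2 V}, IsWeakDeriv f g → IsWeakDeriv f' g' → f = f' → g = g' := by
    intro f f' g g' hf hf' e
    subst e
    have hd : IsWeakDeriv (0 : L2 V) (g - g') := by
      have := hf.add (hf'.smul (-1))
      simpa [sub_eq_add_neg] using this
    have hloc : LocallyIntegrableOn (g - g' : L2 V) (Ioo (0 : ℝ) 1) := by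
      have : IntegrableOn (g - g' : L2 V) (Ioo (0 : ℝ) 1) := (g - g').integrable
      exact this.locallyIntegrableOn
    have fin := isOpen_Ioo.ae_eq_zero_of_integral_contDiff_smul_eq_zero hloc fun φ h1 h2 h3 => by
      have h4 := hd φ ⟨h1, h2, h3⟩
      have h5 : ∫ t, deriv φ t • (0 : L2 V) t ∂unitMeasure = 0 := by
        rw [← integral_zero ℝ V (μ := unitMeasure)]
        refine integral_congr_ae ?_
        filter_upwards [Lp.coeFn_zero V 2 unitMeasure] with t ht
        rw [ht, Pi.zero_apply, smul_zero]
      rw [h5, zero_eq_neg] at h4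
      rw [← h4]
      refine (setIntegral_eq_integral_of_forall_compl_eq_zero fun t ht => ?_).symm
      rw [image_eq_zero_of_notMem_tsupport fun h => ht (h3 h), zero_smul]
    have h6 : g - g' = 0 := by
      refine Lp.ext ?_
      refine EventuallyEq.trans ?_ (Lp.coeFn_zero V 2 unitMeasure).symm
      rw [EventuallyEq, ae_restrict_iff' measurableSet_Ioo]
      filter_upwards [fin] with t ht hmem
      exact ht hmem
    exact sub_eq_zero.1 h6
  have h0 : u.curve = w.curve := Lp.ext h
  have h1 : u.vel = w.vel := key u.2.1 w.2.1 h0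
  have h2 : u.acc = w.acc := key u.2.2 w.2.2 h1
  refine Subtype.ext (PiLp.ext fun i => ?_)
  fin_cases i
  · exact h0
  · exact h1
  · exact h2

end W22

end RiemSpline
end

noncomputable section

namespace RiemSpline

variable {V : Type*} [NormedAddCommGroup V] [InnerProductSpace ℝ V] [CompleteSpace V]

/-! ### The interpolation of a discrete path -/

/-- The second difference of a sequence of nodes. -/
def secDiff (Y : ℤ → V) (k : ℤ) : V := Y (k + 1) - (2 : ℝ) • Y k + Y (k - 1)

/-- The index of the cell `[(k-1/2)/K, (k+1/2)/K]` that contains `t`. -/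
def cell (K : ℕ) (t : ℝ) : ℤ := ⌊(K : ℝ) * t + 1 / 2⌋

theorem cell_eq {K : ℕ} {t : ℝ} {k : ℤ} (h1 : (k : ℝ) - 1 / 2 ≤ K * t) (h2 : K * t < k + 1 / 2) :
    cell K t = k := by
  rw [cell, Int.floor_eq_iff]; constructor <;> linarith

theorem sub_half_le_of_cell (K : ℕ) (t : ℝ) : (cell K t : ℝ) - 1 / 2 ≤ K * t := by
  have := Int.floor_le ((K : ℝ) * t + 1 / 2)
  rw [cell]; linarith

theorem lt_add_half_of_cell (K : ℕ) (t : ℝ) : K * t < (cell K t : ℝ) + 1 / 2 := by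
  have := Int.lt_floor_add_one ((K : ℝ) * t + 1 / 2)
  rw [cell]; linarith

theorem cell_mem (K : ℕ) {t : ℝ} (ht : t ∈ Icc (0 : ℝ) 1) : cell K t ∈ Icc (0 : ℤ) K := by
  have hK : (0 : ℝ) ≤ K := K.cast_nonneg
  constructor
  · rw [cell, Int.floor_nonneg]; have := mul_nonneg hK ht.1; linarith
  · have h1 : (K : ℝ) * t ≤ K := mul_le_of_le_one_right hK ht.2
    have h2 := sub_half_le_of_cell K t
    have h3 : (cell K t : ℝ) < (K : ℤ) + 1 := by push_cast; linarith
    exact Int.lt_add_one_iff.1 (by exact_mod_cast h3)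

theorem measurable_cell (K : ℕ) : Measurable (cell K) :=
  Int.measurable_floor.comp ((measurable_id.const_mul _).add_const _)

theorem memLp_cell {E : Type*} [NormedAddCommGroup E] (F : ℤ → E) (K : ℕ) :
    MemLp (fun t => F (cell K t)) 2 unitMeasure := by
  have hb : ∀ᵐ t ∂unitMeasure, ‖F (cell K t)‖ ≤ ∑ k ∈ Finset.Icc (0 : ℤ) K, ‖F k‖ := by
    filter_upwards [ae_restrict_mem measurableSet_Ioo] with t ht
    exact Finset.single_le_sum (f := fun k => ‖F k‖) (fun _ _ => norm_nonneg _)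
      (Finset.mem_Icc.2 (cell_mem K (Ioo_subset_Icc_self ht)))
  refine MemLp.of_bound (StronglyMeasurable.aestronglyMeasurable ?_) _ hb
  exact (StronglyMeasurable.of_discrete (f := F)).comp_measurable (measurable_cell K)

/-- The step function taking the value `F k` on the `k`-th cell. -/
def cellStep (F : ℤ → V) (K : ℕ) : L2 V := (memLp_cell F K).toLp _

theorem cellStep_ae (F : ℤ → V) (K : ℕ) :
    cellStep F K =ᵐ[unitMeasure] fun t => F (cell K t) := (memLp_cell F K).coeFn_toLp

/-- The piecewise quadratic interpolation of the nodes `Y_{-1}, …, Y_{K+1}` as a Sobolev curve. -/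
def eta (Y : ℤ → V) (K : ℕ) : W22 V :=
  W22.ofAcc (Y 0 + (1 / 8 : ℝ) • secDiff Y 0)
    ((K : ℝ) • ((Y 0 - Y (-1)) + (1 / 2 : ℝ) • secDiff Y 0))
    (cellStep (fun k => (K : ℝ) ^ 2 • secDiff Y k) K)

section eta

variable (Y : ℤ → V) {K : ℕ}

theorem eta_acc : (eta Y K).acc = cellStep (fun k => (K : ℝ) ^ 2 • secDiff Y k) K := by
  rw [eta, W22.acc_ofAcc]

theorem eta_acc_ae : (eta Y K).acc =ᵐ[unitMeasure] fun t => (K : ℝ) ^ 2 • secDiff Y (cell K t) := by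
  rw [eta_acc]
  exact cellStep_ae (fun k => (K : ℝ) ^ 2 • secDiff Y k) K

theorem eta_v_step {s t : ℝ} {k : ℤ} (hs : s ∈ Icc (0 : ℝ) 1) (ht : t ∈ Icc (0 : ℝ) 1)
    (hst : s ≤ t) (hsk : (k : ℝ) - 1 / 2 ≤ K * s) (htk : K * t ≤ k + 1 / 2) :
    (eta Y K).v t = (eta Y K).v s + (K * (K * t - K * s)) • secDiff Y k := by
  have hK : (0 : ℝ) ≤ K := K.cast_nonneg
  have h1 : (eta Y K).v t - (eta Y K).v s = ∫ _ in s..t, (K : ℝ) ^ 2 • secDiff Y k := by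
    rw [W22.v_sub]
    refine intervalIntegral.integral_congr_ae ?_
    have hne : ∀ᵐ r : ℝ, r ≠ t := by simp [ae_iff]
    filter_upwards [L2.ext0_congr (eta_acc_ae Y (K := K)), hne] with r hr hrt hmem
    rw [uIoc_of_le hst] at hmem
    have hrt' : r < t := lt_of_le_of_ne hmem.2 hrt
    rcases hK.eq_or_lt with h0 | h0
    · rw [hr]; simp [← h0, indicator]
    rw [hr, indicator_of_mem (show r ∈ Ioo (0 : ℝ) 1 from
      ⟨hs.1.trans_lt hmem.1, hrt'.trans_le ht.2⟩), cell_eq (k := k)]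
    · have := mul_lt_mul_of_pos_left hmem.1 h0; linarith
    · have := mul_lt_mul_of_pos_left hrt' h0; linarith
  rw [intervalIntegral.integral_const, smul_smul] at h1
  rw [← sub_eq_iff_eq_add', h1]
  congr 1; ring

theorem eta_c_step {s t : ℝ} {k : ℤ} (hs : s ∈ Icc (0 : ℝ) 1) (ht : t ∈ Icc (0 : ℝ) 1)
    (hst : s ≤ t) (hsk : (k : ℝ) - 1 / 2 ≤ K * s) (htk : K * t ≤ k + 1 / 2) :
    (eta Y K).c t = (eta Y K).c s + (t - s) • (eta Y K).v s
      + ((K * t - K * s) ^ 2 / 2) • secDiff Y k := by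
  have hK : (0 : ℝ) ≤ K := K.cast_nonneg
  have h1 : (eta Y K).c t - (eta Y K).c s
      = ∫ r in s..t, ((eta Y K).v s + (K ^ 2 * (r - s)) • secDiff Y k) := by
    rw [W22.c_sub _ hs ht]
    refine intervalIntegral.integral_congr fun r hr => ?_
    rw [uIcc_of_le hst] at hr
    have := mul_le_mul_of_nonneg_left hr.2 hK
    rw [eta_v_step Y hs ⟨hs.1.trans hr.1, hr.2.trans ht.2⟩ hr.1 hsk (by linarith)]
    congr 2; ring
  have h2 : ∫ r in s..t, ((K : ℝ) ^ 2 * (r - s)) = (K * t - K * s) ^ 2 / 2 := by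
    rw [intervalIntegral.integral_const_mul, intervalIntegral.integral_sub (by simp) (by simp)]
    simp
    ring
  rw [intervalIntegral.integral_add (by simp) (Continuous.intervalIntegrable (by fun_prop) _ _),
    intervalIntegral.integral_const, intervalIntegral.integral_smul_const, h2] at h1
  rw [add_assoc, ← h1]; abel

theorem div_mem_Icc {K : ℕ} (hK : 0 < K) {a : ℝ} (h0 : 0 ≤ a) (h1 : a ≤ K) :
    a / K ∈ Icc (0 : ℝ) 1 := by
  have : (0 : ℝ) < K := by exact_mod_cast hK
  exact ⟨by positivity, (div_le_one this).2 h1⟩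

theorem eta_zero : (eta Y K).c 0 = Y 0 + (1 / 8 : ℝ) • secDiff Y 0 ∧
    (eta Y K).v 0 = (K : ℝ) • ((Y 0 - Y (-1)) + (1 / 2 : ℝ) • secDiff Y 0) := by
  rw [W22.c_zero, W22.v_zero, eta, W22.pos0_ofAcc, W22.vel0_ofAcc]
  exact ⟨rfl, rfl⟩

/-- At the interfaces of the cells the interpolation passes through the midpoints of adjacent
nodes, with the difference quotient as velocity. -/
theorem eta_half (hK : 0 < K) (k : ℕ) (hk : k + 1 ≤ K) :
    (eta Y K).c (((k : ℝ) + 1 / 2) / K) = (1 / 2 : ℝ) • (Y k + Y (k + 1)) ∧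
    (eta Y K).v (((k : ℝ) + 1 / 2) / K) = (K : ℝ) • (Y (k + 1) - Y k) := by
  have hK' : (0 : ℝ) < K := by exact_mod_cast hK
  have hmem : ∀ j : ℕ, j + 1 ≤ K → ((j : ℝ) + 1 / 2) / K ∈ Icc (0 : ℝ) 1 := fun j hj => by
    have : (j : ℝ) + 1 ≤ K := by exact_mod_cast hj
    exact div_mem_Icc hK (by positivity) (by linarith)
  have hm : ∀ a : ℝ, (K : ℝ) * (a / K) = a := fun a => by field_simp
  induction k with
  | zero =>
    obtain ⟨c0, v0⟩ := eta_zero Y (K := K)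
    have h1 := hmem 0 hk
    have hle : (0 : ℝ) ≤ (((0 : ℕ) : ℝ) + 1 / 2) / K := h1.1
    have a1 : (((0 : ℤ)) : ℝ) - 1 / 2 ≤ K * (0 : ℝ) := by norm_num
    have a2 : (K : ℝ) * ((((0 : ℕ) : ℝ) + 1 / 2) / K) ≤ ((0 : ℤ) : ℝ) + 1 / 2 := by
      rw [hm]; norm_num
    have hc := eta_c_step Y (K := K) (s := 0) (left_mem_Icc.2 zero_le_one) h1 hle a1 a2
    have hv := eta_v_step Y (K := K) (s := 0) (left_mem_Icc.2 zero_le_one) h1 hle a1 a2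
    rw [hm, c0, v0, smul_smul] at hc
    rw [hm, v0] at hv
    have e : ((((0 : ℕ) : ℝ) + 1 / 2) / K - 0) * K = 1 / 2 := by field_simp; simp
    rw [e] at hc
    rw [hc, hv]
    simp only [secDiff, Nat.cast_zero, zero_add, mul_zero, sub_zero, zero_sub]
    constructor
    · module
    · module
  | succ k ih =>
    obtain ⟨c0, v0⟩ := ih (by omega)
    have h0 := hmem k (by omega)
    have h1 := hmem (k + 1) hk
    have hle : ((k : ℝ) + 1 / 2) / K ≤ (((k + 1 : ℕ) : ℝ) + 1 / 2) / K := by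
      gcongr; linarith
    have a1 : (((k + 1 : ℕ) : ℤ) : ℝ) - 1 / 2 ≤ K * (((k : ℝ) + 1 / 2) / K) := by
      rw [hm]; push_cast; linarith
    have a2 : (K : ℝ) * ((((k + 1 : ℕ) : ℝ) + 1 / 2) / K) ≤ (((k + 1 : ℕ) : ℤ) : ℝ) + 1 / 2 := by
      rw [hm]; push_cast; linarith
    have hc := eta_c_step Y h0 h1 hle a1 a2
    have hv := eta_v_step Y h0 h1 hle a1 a2
    rw [hm, hm, c0, v0, smul_smul] at hc
    rw [hm, hm, v0] at hv
    have e : ((((k + 1 : ℕ) : ℝ) + 1 / 2) / K - ((k : ℝ) + 1 / 2) / K) * K = 1 := by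
      field_simp; push_cast; ring
    have e2 : ((((k + 1 : ℕ) : ℝ) + 1 / 2) - ((k : ℝ) + 1 / 2)) = 1 := by push_cast; ring
    rw [e, e2] at hc
    rw [e2] at hv
    rw [hc, hv]
    have i1 : (((k + 1 : ℕ) : ℤ)) - 1 = (k : ℤ) := by push_cast; ring
    simp only [secDiff, i1]
    push_cast
    constructor
    · module
    · module

/-- The interpolation on a (closed) cell. -/
theorem eta_cell (hK : 0 < K) {k : ℤ} (hk : k ∈ Icc (0 : ℤ) K) {t : ℝ} (ht : t ∈ Icc (0 : ℝ) 1)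
    (h1 : (k : ℝ) - 1 / 2 ≤ K * t) (h2 : K * t ≤ k + 1 / 2) :
    (eta Y K).c t = quadPiece (Y (k - 1)) (Y k) (Y (k + 1)) (K * t - (k - 1 / 2)) ∧
    (eta Y K).v t = (K : ℝ) • ((Y k - Y (k - 1)) + (K * t - (k - 1 / 2)) • secDiff Y k) := by
  have hK' : (0 : ℝ) < K := by exact_mod_cast hK
  have hm : ∀ a : ℝ, (K : ℝ) * (a / K) = a := fun a => by field_simp
  obtain ⟨n, rfl⟩ := Int.eq_ofNat_of_zero_le hk.1
  have hnK : n ≤ K := by exact_mod_cast hk.2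
  rcases Nat.eq_zero_or_pos n with rfl | hn
  · obtain ⟨c0, v0⟩ := eta_zero Y (K := K)
    have a1 : (((0 : ℕ) : ℤ) : ℝ) - 1 / 2 ≤ K * (0 : ℝ) := by norm_num
    have hc := eta_c_step Y (K := K) (s := 0) (left_mem_Icc.2 zero_le_one) ht ht.1 a1 h2
    have hv := eta_v_step Y (K := K) (s := 0) (left_mem_Icc.2 zero_le_one) ht ht.1 a1 h2
    rw [c0, v0, smul_smul] at hc
    rw [v0] at hv
    rw [hc, hv]
    simp only [secDiff, quadPiece, Nat.cast_zero, zero_add, mul_zero, sub_zero, zero_sub]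
    constructor
    · module
    · module
  · obtain ⟨j, rfl⟩ : ∃ j, n = j + 1 := ⟨n - 1, by omega⟩
    obtain ⟨c0, v0⟩ := eta_half Y hK j hnK
    have hj1 : (j : ℝ) + 1 ≤ K := by exact_mod_cast hnK
    have h0 : ((j : ℝ) + 1 / 2) / K ∈ Icc (0 : ℝ) 1 :=
      div_mem_Icc hK (by positivity) (by linarith)
    push_cast at h1 h2
    have hle : ((j : ℝ) + 1 / 2) / K ≤ t := by rw [div_le_iff₀ hK']; linarith
    have a1 : (((j + 1 : ℕ) : ℤ) : ℝ) - 1 / 2 ≤ K * (((j : ℝ) + 1 / 2) / K) := by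
      rw [hm]; push_cast; linarith
    have a2 : (K : ℝ) * t ≤ (((j + 1 : ℕ) : ℤ) : ℝ) + 1 / 2 := by push_cast; linarith
    have hc := eta_c_step Y h0 ht hle a1 a2
    have hv := eta_v_step Y h0 ht hle a1 a2
    rw [hm, c0, v0, smul_smul] at hc
    rw [hm, v0] at hv
    have e : (t - ((j : ℝ) + 1 / 2) / K) * K = K * t - (j + 1 / 2) := by field_simp
    rw [e] at hc
    rw [hc, hv]
    have i1 : (((j + 1 : ℕ) : ℤ)) - 1 = (j : ℤ) := by push_cast; ring
    simp only [secDiff, quadPiece, i1]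
    push_cast
    constructor
    · module
    · module

theorem eta_node (hK : 0 < K) {k : ℕ} (hk : k ≤ K) :
    (eta Y K).c ((k : ℝ) / K) = Y k + (1 / 8 : ℝ) • secDiff Y k ∧
    (eta Y K).v ((k : ℝ) / K) = (K : ℝ) • ((Y k - Y (k - 1)) + (1 / 2 : ℝ) • secDiff Y k) := by
  have hK' : (0 : ℝ) < K := by exact_mod_cast hK
  have hm : (K : ℝ) * ((k : ℝ) / K) = k := by field_simp
  have hkK : (k : ℝ) ≤ K := by exact_mod_cast hk
  have h := eta_cell Y hK (k := (k : ℤ)) ⟨by positivity, by exact_mod_cast hk⟩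
    (div_mem_Icc hK (by positivity) hkK) (by rw [hm]; push_cast; linarith)
    (by rw [hm]; push_cast; linarith)
  rw [hm, Int.cast_natCast, sub_sub_cancel] at h
  refine ⟨h.1.trans ?_, h.2⟩
  simp only [quadPiece, secDiff]
  module

end eta

/-! ### Discrete paths and their ghost nodes -/

/-- The ghost node on the left: the periodic one, or the reflection that makes the interpolation
affine on the first boundary cell. -/
def leftGhost (bc : BoundaryCondition V) {K : ℕ} (p : Fin (K + 1) → V) : V :=
  match bc with
  | .periodic => node p (K - 1)
  | _ => (2 : ℝ) • node p 0 - node p 1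

/-- The ghost node on the right. -/
def rightGhost (bc : BoundaryCondition V) {K : ℕ} (p : Fin (K + 1) → V) : V :=
  match bc with
  | .periodic => node p 1
  | _ => (2 : ℝ) • node p K - node p (K - 1)

/-- The nodes of a discrete path, extended by ghost nodes on both sides. -/
def extNode (bc : BoundaryCondition V) {K : ℕ} (p : Fin (K + 1) → V) (k : ℤ) : V :=
  if k < 0 then leftGhost bc p else if (K : ℤ) < k then rightGhost bc p else node p k.toNat

section extNode

variable {K : ℕ} (bc : BoundaryCondition V) (p : Fin (K + 1) → V)

theorem extNode_natCast {k : ℕ} (hk : k ≤ K) : extNode bc p k = node p k := by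
  have h1 : ¬ ((k : ℤ) < 0) := by omega
  have h2 : ¬ ((K : ℤ) < k) := by omega
  rw [extNode, if_neg h1, if_neg h2, Int.toNat_natCast]

theorem node_val (k : Fin (K + 1)) : node p k = p k := by
  simp [node]

/-- Whether the boundary condition is the periodic one. -/
def IsPeriodic : BoundaryCondition V → Prop
  | .periodic => True
  | _ => False

theorem numAux_of_not_periodic {bc : BoundaryCondition V} (h : ¬ IsPeriodic bc) (K : ℕ) :
    numAux bc K = K - 1 := by
  cases bc <;> simp_all [IsPeriodic, numAux]

theorem numAux_of_periodic {bc : BoundaryCondition V} (h : IsPeriodic bc) (K : ℕ) :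
    numAux bc K = K := by
  cases bc <;> simp_all [IsPeriodic, numAux]

theorem nextNode_eq {k : ℕ} (hk : k ∈ Finset.Icc 1 (numAux bc K)) :
    nextNode bc p k = extNode bc p (k + 1) := by
  rw [Finset.mem_Icc] at hk
  have e : ((k : ℤ) + 1) = ((k + 1 : ℕ) : ℤ) := by push_cast; ring
  by_cases h : IsPeriodic bc
  · rw [numAux_of_periodic h] at hk
    rcases hk.2.eq_or_lt with rfl | hlt
    · rw [extNode, if_neg (by omega), if_pos (by omega)]
      cases bc <;> simp_all [IsPeriodic, nextNode, rightGhost]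
    · rw [e, extNode_natCast bc p (by omega)]
      cases bc <;> simp_all [IsPeriodic, nextNode]
      omega
  · rw [numAux_of_not_periodic h] at hk
    rw [e, extNode_natCast bc p (by omega)]
    cases bc <;> simp_all [IsPeriodic, nextNode]

theorem extNode_neg_one : extNode bc p (-1) = leftGhost bc p := by
  rw [extNode, if_pos (by norm_num)]

theorem extNode_succ : extNode bc p (K + 1) = rightGhost bc p := by
  rw [extNode, if_neg (by omega), if_pos (by omega)]

theorem secDiff_extNode_zero (hK : 0 < K) {bc : BoundaryCondition V} (h : ¬ IsPeriodic bc) :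
    secDiff (extNode bc p) 0 = 0 := by
  have h0 : extNode bc p 0 = node p 0 := extNode_natCast bc p (k := 0) (by omega)
  have h1 : extNode bc p 1 = node p 1 := extNode_natCast bc p (k := 1) hK
  rw [secDiff, zero_add, zero_sub, extNode_neg_one, h0, h1]
  cases bc <;> simp_all [IsPeriodic, leftGhost]

theorem secDiff_extNode_last (hK : 0 < K) {bc : BoundaryCondition V} (h : ¬ IsPeriodic bc) :
    secDiff (extNode bc p) K = 0 := by
  have e : ((K : ℤ) - 1) = ((K - 1 : ℕ) : ℤ) := by omega
  have h0 : extNode bc p ((K : ℤ) - 1) = node p (K - 1) := by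
    rw [e, extNode_natCast bc p (by omega)]
  rw [secDiff, h0, extNode_succ, extNode_natCast bc p le_rfl]
  cases bc <;> simp_all [IsPeriodic, rightGhost]

theorem secDiff_extNode_periodic (hK : 0 < K) {bc : BoundaryCondition V} (h : IsPeriodic bc)
    (hp : node p 0 = node p K) :
    secDiff (extNode bc p) 0 = secDiff (extNode bc p) K := by
  have e : ((K : ℤ) - 1) = ((K - 1 : ℕ) : ℤ) := by omega
  have h0 : extNode bc p ((K : ℤ) - 1) = node p (K - 1) := by
    rw [e, extNode_natCast bc p (by omega)]
  have h00 : extNode bc p 0 = node p 0 := extNode_natCast bc p (k := 0) (by omega)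
  have h1 : extNode bc p 1 = node p 1 := extNode_natCast bc p (k := 1) hK
  rw [secDiff, secDiff, h0, extNode_succ, zero_add, zero_sub, extNode_neg_one,
    extNode_natCast bc p le_rfl, h00, h1, hp]
  cases bc <;> simp_all [IsPeriodic, leftGhost, rightGhost]

variable {bc p}

theorem leftGhost_of_not_periodic (h : ¬ IsPeriodic bc) :
    leftGhost bc p = (2 : ℝ) • node p 0 - node p 1 := by
  cases bc <;> simp_all [IsPeriodic, leftGhost]

theorem rightGhost_of_not_periodic (h : ¬ IsPeriodic bc) :
    rightGhost bc p = (2 : ℝ) • node p K - node p (K - 1) := by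
  cases bc <;> simp_all [IsPeriodic, rightGhost]

theorem interp_of_not_periodic (h : ¬ IsPeriodic bc) (t : ℝ) : interp bc p t =
    if (K : ℝ) * t ≤ 1 / 2 then node p 0 + ((K : ℝ) * t) • (node p 1 - node p 0)
      else if (K : ℝ) * t < (K : ℝ) - 1 / 2 then
        quadPiece (node p (⌊(K : ℝ) * t + 1 / 2⌋₊ - 1)) (node p ⌊(K : ℝ) * t + 1 / 2⌋₊)
          (node p (⌊(K : ℝ) * t + 1 / 2⌋₊ + 1))
          ((K : ℝ) * t - ((⌊(K : ℝ) * t + 1 / 2⌋₊ : ℝ) - 1 / 2))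
      else node p (K - 1) + ((K : ℝ) * t - ((K : ℝ) - 1)) • (node p K - node p (K - 1)) := by
  cases bc
  · rfl
  · rfl
  · exact absurd trivial h

/-- The interpolation of a discrete path is the piecewise quadratic curve through its extended
nodes. -/
theorem eta_c_eq_interp (hK : 0 < K) (hp : IsPeriodic bc → node p 0 = node p K) {t : ℝ}
    (ht : t ∈ Ioo (0 : ℝ) 1) : (eta (extNode bc p) K).c t = interp bc p t := by
  have hK' : (0 : ℝ) < K := by exact_mod_cast hK
  have htK : (0 : ℝ) < K * t := mul_pos hK' ht.1
  have htK2 : (K : ℝ) * t < K := mul_lt_of_lt_one_right hK' ht.2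
  have hti := Ioo_subset_Icc_self ht
  set k := ⌊(K : ℝ) * t + 1 / 2⌋₊ with hk
  have k1 : (k : ℝ) ≤ K * t + 1 / 2 := Nat.floor_le (by positivity)
  have k2 : K * t + 1 / 2 < (k : ℝ) + 1 := Nat.lt_floor_add_one _
  have kK : k ≤ K := by
    have : (k : ℝ) < (K : ℝ) + 1 := by linarith
    exact Nat.lt_succ_iff.1 (by exact_mod_cast this)
  have hc := (eta_cell (extNode bc p) hK (k := (k : ℤ)) ⟨by positivity, by exact_mod_cast kK⟩ hti
    (by push_cast; linarith) (by push_cast; linarith)).1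
  rw [Int.cast_natCast] at hc
  have h00 : extNode bc p 0 = node p 0 := extNode_natCast bc p (k := 0) (by omega)
  have h01 : extNode bc p 1 = node p 1 := extNode_natCast bc p (k := 1) hK
  have hcell0 : (K : ℝ) * t ≤ 1 / 2 → (eta (extNode bc p) K).c t
      = quadPiece (leftGhost bc p) (node p 0) (node p 1) (K * t + 1 / 2) := fun h => by
    have := (eta_cell (extNode bc p) hK (k := 0) ⟨le_rfl, by positivity⟩ hti
      (by push_cast; linarith) (by push_cast; linarith)).1
    rw [this, zero_sub, extNode_neg_one, zero_add, h00, h01]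
    congr 1; push_cast; ring
  have hinner : ∀ {j : ℕ}, k = j + 1 → k + 1 ≤ K → (eta (extNode bc p) K).c t
      = quadPiece (node p (k - 1)) (node p k) (node p (k + 1)) (K * t - (k - 1 / 2)) := by
    intro j hj hkK
    have e1 : ((k : ℤ) - 1) = ((k - 1 : ℕ) : ℤ) := by omega
    have e2 : ((k : ℤ) + 1) = ((k + 1 : ℕ) : ℤ) := by omega
    rw [hc, e1, e2, extNode_natCast bc p (by omega), extNode_natCast bc p (by omega),
      extNode_natCast bc p (by omega)]
  have eK : ((K : ℤ) - 1) = ((K - 1 : ℕ) : ℤ) := by omega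
  have kpos : ¬ ((K : ℝ) * t < 1 / 2) → 1 ≤ k := fun h => by
    by_contra! hcon
    have : k = 0 := by omega
    rw [this] at k2
    push_cast at k2
    linarith
  by_cases hper : IsPeriodic bc
  · have hpp := hp hper
    cases bc with
    | natural => exact absurd hper id
    | hermite _ _ => exact absurd hper id
    | periodic =>
      simp only [interp]
      split_ifs with h1
      · rw [hcell0 h1.le, hpp]
        simp only [leftGhost]
        congr 1; ring
      · have hk1 := kpos h1
        have e1 : ((k : ℤ) - 1) = ((k - 1 : ℕ) : ℤ) := by omega
        rw [← hk, hc, e1, extNode_natCast _ p (by omega), extNode_natCast _ p kK,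
          nextNode_eq .periodic p (Finset.mem_Icc.2 ⟨hk1, kK⟩)]
  · rw [interp_of_not_periodic hper, ← hk]
    split_ifs with h1 h2
    · rw [hcell0 h1, leftGhost_of_not_periodic hper]
      simp only [quadPiece]
      module
    · have hk1 := kpos (by linarith)
      refine hinner (j := k - 1) (by omega) ?_
      have : (k : ℝ) < K := by linarith
      exact_mod_cast this
    · have := (eta_cell (extNode bc p) hK (k := (K : ℤ)) ⟨by positivity, le_rfl⟩ hti
        (by push_cast; linarith) (by push_cast; linarith)).1
      rw [this, eK, extNode_succ, rightGhost_of_not_periodic hper, extNode_natCast bc p (by omega),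
        extNode_natCast bc p le_rfl]
      simp only [quadPiece, Int.cast_natCast]
      module

/-- In the periodic case, a discrete path with a Sobolev interpolation is closed, because the
interpolation is continuous at the first interface. -/
theorem IsInterp.closed (hK : 0 < K) {u : W22 V} (hu : IsInterp .periodic p u) :
    node p 0 = node p K := by
  have hK' : (0 : ℝ) < K := by exact_mod_cast hK
  have hK1 : (1 : ℝ) ≤ K := by exact_mod_cast hK
  have hae : u.c =ᵐ[unitMeasure] interp .periodic p := u.curve_ae.symm.trans hu
  rw [EventuallyEq, ae_restrict_iff' measurableSet_Ioo] at hae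
  set τ : ℝ := 1 / (2 * K) with hτ
  have hτ0 : 0 < τ := by positivity
  have hKτ : K * τ = 1 / 2 := by rw [hτ]; field_simp
  have hτ1 : τ < 1 := by rw [hτ, div_lt_one (by positivity)]; linarith
  set β : ℝ := min 1 (3 * τ) with hβ
  have hτβ : τ < β := lt_min hτ1 (by linarith)
  have qc : ∀ (a b c : V) (α γ : ℝ), Continuous fun t : ℝ => quadPiece a b c (α * t + γ) := by
    intro a b c α γ; unfold quadPiece; fun_prop
  have ne1 : ∀ x : ℝ, ∀ᵐ r : ℝ, r ≠ x := fun x => by simp [ae_iff]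
  -- `τ` is the first interface; the two sides of it give the midpoints of `y_K, y_1` and of `y_0,
  -- y_1`
  have e1 : u.c τ = quadPiece (node p (K - 1)) (node p K) (node p 1) (K * τ + 1 / 2) := by
    refine Measure.eqOn_Icc_of_ae_eq volume hτ0.ne (f := u.c)
      (g := fun t => quadPiece (node p (K - 1)) (node p K) (node p 1) (K * t + 1 / 2)) ?_
      u.continuous_c.continuousOn (qc _ _ _ _ _).continuousOn (right_mem_Icc.2 hτ0.le)
    rw [EventuallyEq, ae_restrict_iff' measurableSet_Icc]
    filter_upwards [hae, ne1 0, ne1 τ] with t h1 h2 h3 h4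
    have h5 : t < τ := lt_of_le_of_ne h4.2 h3
    rw [h1 ⟨lt_of_le_of_ne h4.1 h2.symm, h5.trans hτ1⟩]
    have h6 : (K : ℝ) * t < 1 / 2 := by rw [← hKτ]; gcongr
    simp only [interp]
    rw [if_pos h6]
    congr 1; ring
  have e2 : u.c τ = quadPiece (node p 0) (node p 1) (nextNode .periodic p 1)
      (K * τ + -(1 / 2)) := by
    refine Measure.eqOn_Icc_of_ae_eq volume hτβ.ne (f := u.c)
      (g := fun t => quadPiece (node p 0) (node p 1) (nextNode .periodic p 1) (K * t + -(1 / 2))) ?_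
      u.continuous_c.continuousOn (qc _ _ _ _ _).continuousOn (left_mem_Icc.2 hτβ.le)
    rw [EventuallyEq, ae_restrict_iff' measurableSet_Icc]
    filter_upwards [hae, ne1 β] with t h1 h3 h4
    have h5 : t < β := lt_of_le_of_ne h4.2 h3
    rw [h1 ⟨hτ0.trans_le h4.1, h5.trans_le (min_le_left _ _)⟩]
    have h6 : 1 / 2 ≤ (K : ℝ) * t := by rw [← hKτ]; gcongr; exact h4.1
    have h7 : (K : ℝ) * t < 3 / 2 := by
      have : t < 3 * τ := h5.trans_le (min_le_right _ _)
      nlinarith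
    have h8 : ⌊(K : ℝ) * t + 1 / 2⌋₊ = 1 := by
      rw [Nat.floor_eq_iff (by positivity)]; constructor <;> push_cast <;> linarith
    simp only [interp]
    rw [if_neg (not_lt.2 h6), h8]
    congr 1; push_cast; ring
  rw [e1, hKτ] at e2
  simp only [quadPiece] at e2
  have e3 : node p 0 - node p K = (2 : ℝ) • ((((1 / 2 : ℝ) • (node p 0 + node p 1)
      + (1 / 2 + -(1 / 2) : ℝ) • (node p 1 - node p 0)
      + ((1 / 2 + -(1 / 2) : ℝ) ^ 2 / 2) • 
        (nextNode .periodic p 1 - (2 : ℝ) • node p 1 + node p 0)))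
      - ((1 / 2 : ℝ) • (node p (K - 1) + node p K)
      + (1 / 2 + 1 / 2 : ℝ) • (node p K - node p (K - 1))
      + ((1 / 2 + 1 / 2 : ℝ) ^ 2 / 2) • (node p 1 - (2 : ℝ) • node p K + node p (K - 1)))) := by
    module
  rw [← e2, sub_self, smul_zero] at e3
  exact sub_eq_zero.1 e3

theorem IsInterp.closed' (hK : 0 < K) {u : W22 V} (hu : IsInterp bc p u) (h : IsPeriodic bc) :
    node p 0 = node p K := by
  cases bc with
  | natural => exact absurd h id
  | hermite _ _ => exact absurd h id
  | periodic => exact hu.closed hK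

theorem IsInterp.eq_eta (hK : 0 < K) {u : W22 V} (hu : IsInterp bc p u) :
    u = eta (extNode bc p) K := by
  refine W22.ext_of_curve (hu.trans ?_)
  refine EventuallyEq.trans ?_ (W22.curve_ae _).symm
  filter_upwards [ae_restrict_mem measurableSet_Ioo] with t ht
  exact (eta_c_eq_interp hK (hu.closed' hK) ht).symm

theorem isInterp_eta (hK : 0 < K) (hp : IsPeriodic bc → node p 0 = node p K) :
    IsInterp bc p (eta (extNode bc p) K) := by
  refine (W22.curve_ae _).trans ?_
  filter_upwards [ae_restrict_mem measurableSet_Ioo] with t ht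
  exact eta_c_eq_interp hK hp ht

/-- A discrete path is determined by its interpolation. -/
theorem IsInterp.unique (hK : 0 < K) {u : W22 V} {q : Fin (K + 1) → V} (hu : IsInterp bc p u)
    (hq : IsInterp bc q u) : p = q := by
  have he : eta (extNode bc p) K = eta (extNode bc q) K :=
    (hu.eq_eta hK).symm.trans (hq.eq_eta hK)
  have hK' : (0 : ℝ) < K := by exact_mod_cast hK
  -- value and velocity at an interface give the sum and the difference of the adjacent nodes
  have key : ∀ j : ℕ, j + 1 ≤ K → node p j = node q j ∧ node p (j + 1) = node q (j + 1) := by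
    intro j hj
    obtain ⟨c1, v1⟩ := eta_half (extNode bc p) hK j hj
    obtain ⟨c2, v2⟩ := eta_half (extNode bc q) hK j hj
    rw [he, c2] at c1
    rw [he, v2] at v1
    have v3 := smul_right_injective V hK'.ne' v1
    have c3 := smul_right_injective V (by norm_num : (1 / 2 : ℝ) ≠ 0) c1
    have e2 : ((j : ℤ) + 1) = ((j + 1 : ℕ) : ℤ) := by omega
    rw [e2, extNode_natCast _ _ hj, extNode_natCast _ _ hj, extNode_natCast _ _ (by omega),
      extNode_natCast _ _ (by omega)] at v3 c3
    have a1 : (2 : ℝ) • node q (j + 1) = (2 : ℝ) • node p (j + 1) := by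
      have := congrArg₂ (· + ·) c3 v3
      rw [two_smul, two_smul]
      convert this using 1 <;> abel
    have a2 := smul_right_injective V (by norm_num : (2 : ℝ) ≠ 0) a1
    rw [a2] at c3
    exact ⟨(add_right_cancel c3).symm, a2.symm⟩
  ext1 k
  rw [← node_val p, ← node_val q]
  have hk := k.2
  rcases Nat.lt_or_ge (k : ℕ) K with h | h
  · exact (key k h).1
  · obtain ⟨j, rfl⟩ : ∃ j, K = j + 1 := ⟨K - 1, by omega⟩
    have : (k : ℕ) = j + 1 := by omega
    rw [this]; exact (key j le_rfl).2

end extNode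

end RiemSpline
end

noncomputable section

namespace RiemSpline

variable {V Y : Type*} [NormedAddCommGroup V] [InnerProductSpace ℝ V] [CompleteSpace V]
  [NormedAddCommGroup Y] [NormedSpace ℝ Y] {ι : V →L[ℝ] Y}

/-! ### Quadratic functionals on `L²` given by the metric -/

theorem integral_norm_mul_norm_le {α E F : Type*} [MeasurableSpace α] {ν : Measure α}
    [NormedAddCommGroup E] [NormedAddCommGroup F] {f : α → E} {h : α → F}
    (hf : MemLp f 2 ν) (hh : MemLp h 2 ν) :
    ∫ x, ‖f x‖ * ‖h x‖ ∂ν ≤ √(∫ x, ‖f x‖ ^ 2 ∂ν) * √(∫ x, ‖h x‖ ^ 2 ∂ν) := by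
  have e : ENNReal.ofReal 2 = 2 := by simp
  have := integral_mul_norm_le_Lp_mul_Lq (f := fun x => ‖f x‖) (g := fun x => ‖h x‖)
    Real.HolderConjugate.two_two (e.symm ▸ hf.norm) (e.symm ▸ hh.norm)
  simpa [Real.sqrt_eq_rpow] using this

theorem L2.norm_eq_sqrt (f : L2 V) : ‖f‖ = √(∫ t, ‖f t‖ ^ 2 ∂unitMeasure) := by
  rw [← L2.norm_sq_eq, Real.sqrt_sq (norm_nonneg _)]

theorem L2.integral_norm_mul_norm_le (f h : L2 V) :
    ∫ t, ‖f t‖ * ‖h t‖ ∂unitMeasure ≤ ‖f‖ * ‖h‖ := by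
  rw [f.norm_eq_sqrt, h.norm_eq_sqrt]
  exact RiemSpline.integral_norm_mul_norm_le (Lp.memLp f) (Lp.memLp h)

theorem L2.integrable_norm_mul_norm (f h : L2 V) :
    Integrable (fun t => ‖f t‖ * ‖h t‖) unitMeasure :=
  (Lp.memLp f).norm.integrable_mul (Lp.memLp h).norm

namespace AdmissibleMetric

variable (G : AdmissibleMetric ι)

/-- The bilinear form `∫ g_{c(t)}(f(t), h(t)) dt` on `L²` along a curve `c`. -/
def form (c : ℝ → V) (f h : L2 V) : ℝ := ∫ t, G.g (c t) (f t) (h t) ∂unitMeasure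

variable {G} {b L : ℝ} (hb : G.Bounds b L) {c : ℝ → V} (hc : Continuous c) {M : ℝ}
  (hM : ∀ t, ‖c t‖ ≤ M)

include hc in
theorem aestronglyMeasurable_form (f h : L2 V) :
    AEStronglyMeasurable (fun t => G.g (c t) (f t) (h t)) unitMeasure := by
  have h1 : Continuous fun p : V × V × V => G.g p.1 p.2.1 p.2.2 :=
    G.continuous_g continuous_fst (continuous_fst.comp continuous_snd)
      (continuous_snd.comp continuous_snd)
  have h2 : AEStronglyMeasurable (fun t => (c t, f t, h t)) unitMeasure :=
    hc.aestronglyMeasurable.prodMk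
      ((Lp.aestronglyMeasurable f).prodMk (Lp.aestronglyMeasurable h))
  have h3 := h1.comp_aestronglyMeasurable h2
  exact h3

include hb hM in
theorem abs_g_le_of_bound (v w : V) (t : ℝ) :
    |G.g (c t) v w| ≤ L ^ 4 * (2 + M) * (‖v‖ * ‖w‖) := by
  have := hb.L_nonneg
  refine (hb.abs_g_le (c t) v w).trans ?_
  rw [mul_assoc]
  gcongr
  exact hM t

include hb hc hM

theorem integrable_form (f h : L2 V) :
    Integrable (fun t => G.g (c t) (f t) (h t)) unitMeasure := by
  refine ((f.integrable_norm_mul_norm h).const_mul (L ^ 4 * (2 + M))).mono'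
    (aestronglyMeasurable_form hc f h) (Eventually.of_forall fun t => ?_)
  exact abs_g_le_of_bound hb hM _ _ t

theorem abs_form_le (f h : L2 V) : |G.form c f h| ≤ L ^ 4 * (2 + M) * (‖f‖ * ‖h‖) := by
  have hM0 : 0 ≤ M := (norm_nonneg _).trans (hM 0)
  have := hb.L_nonneg
  rw [form, ← Real.norm_eq_abs]
  refine (norm_integral_le_of_norm_le ((f.integrable_norm_mul_norm h).const_mul _)
    (Eventually.of_forall fun t => abs_g_le_of_bound hb hM _ _ t)).trans ?_
  rw [integral_const_mul]
  gcongr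
  exact f.integral_norm_mul_norm_le h

theorem form_add_right (f h h' : L2 V) : G.form c f (h + h') = G.form c f h + G.form c f h' := by
  rw [form, form, form,
    ← integral_add (integrable_form hb hc hM f h) (integrable_form hb hc hM f h')]
  refine integral_congr_ae ?_
  filter_upwards [Lp.coeFn_add h h'] with t ht
  simp only [ht, ← bil_apply, Pi.add_apply, map_add]

omit hb hc hM in
theorem form_smul_right (a : ℝ) (f h : L2 V) : G.form c f (a • h) = a * G.form c f h := by
  rw [form, form, ← integral_const_mul]
  refine integral_congr_ae ?_
  filter_upwards [Lp.coeFn_smul a h] with t ht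
  simp only [ht, ← bil_apply, Pi.smul_apply, map_smul, smul_eq_mul]

omit hb hc hM in
theorem form_symm (f h : L2 V) : G.form c f h = G.form c h f := by
  simp only [form, G.g_symm]

theorem form_sub_right (f h h' : L2 V) : G.form c f (h - h') = G.form c f h - G.form c f h' := by
  rw [sub_eq_add_neg, form_add_right hb hc hM, ← neg_one_smul ℝ h', form_smul_right]
  ring

theorem form_sub_left (f f' h : L2 V) : G.form c (f - f') h = G.form c f h - G.form c f' h := by
  rw [form_symm, form_sub_right hb hc hM, form_symm h, form_symm h]

omit hc hM in
theorem form_self_nonneg (f : L2 V) : 0 ≤ G.form c f f :=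
  integral_nonneg fun _ => hb.g_self_nonneg _ _

/-- A positive semidefinite form lies above its tangents. -/
theorem tangent_le_form (f h : L2 V) : 2 * G.form c f h - G.form c f f ≤ G.form c h h := by
  have h1 := form_self_nonneg (c := c) hb (h - f)
  rw [form_sub_right hb hc hM, form_sub_left hb hc hM, form_sub_left hb hc hM, form_symm h f] at h1
  linarith

/-- The form with one argument fixed, as a continuous linear functional. -/
def formL (f : L2 V) : L2 V →L[ℝ] ℝ :=
  LinearMap.mkContinuous
    { toFun := fun h => G.form c f h
      map_add' := form_add_right hb hc hM f
      map_smul' := fun a h => form_smul_right a f h } (L ^ 4 * (2 + M) * ‖f‖)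
    (fun h => by
      rw [mul_assoc]; exact abs_form_le hb hc hM f h)

variable {cn : ℕ → ℝ → V} (hcn : ∀ n, Continuous (cn n)) (hMn : ∀ n t, ‖cn n t‖ ≤ M)
  (hlim : ∀ t ∈ Ioo (0 : ℝ) 1, Tendsto (fun n => ι (cn n t)) atTop (𝓝 (ι (c t))))

include hcn hMn hlim

/-- If the curves converge pointwise in `Y`, then the forms converge, uniformly with respect to one
of the arguments. -/
theorem exists_abs_form_sub_le (f : L2 V) : ∃ e : ℕ → ℝ, Tendsto e atTop (𝓝 0) ∧
    ∀ n (h : L2 V), |G.form (cn n) f h - G.form c f h| ≤ e n * ‖h‖ := by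
  have hL := hb.L_nonneg
  obtain ⟨r, hr⟩ : ∃ r : ℕ → ℝ → ℝ, ∀ n t, r n t = ‖ι (cn n t) - ι (c t)‖ :=
    ⟨_, fun _ _ => rfl⟩
  have hrc : ∀ n, Continuous (r n) := fun n => by
    rw [funext (hr n)]
    exact ((ι.continuous.comp (hcn n)).sub (ι.continuous.comp hc)).norm
  have hr0 : ∀ n t, 0 ≤ r n t := fun n t => hr n t ▸ norm_nonneg _
  have hrb : ∀ n t, r n t ≤ L * (2 * M) := fun n t => by
    rw [hr, ← map_sub]
    refine (hb.norm_emb_apply _).trans ?_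
    have := norm_sub_le (cn n t) (c t)
    gcongr; linarith [hMn n t, hM t]
  have hm : ∀ n, MemLp (fun t => r n t * ‖f t‖) 2 unitMeasure := fun n => by
    refine ((Lp.memLp f).norm.const_mul (L * (2 * M))).mono
      ((hrc n).aestronglyMeasurable.mul (Lp.aestronglyMeasurable f).norm)
      (Eventually.of_forall fun t => ?_)
    rw [norm_mul, norm_mul]
    gcongr
    rw [Real.norm_of_nonneg (hr0 n t)]
    exact (hrb n t).trans (le_abs_self _)
  refine ⟨fun n => L ^ 3 * √(∫ t, ‖r n t * ‖f t‖‖ ^ 2 ∂unitMeasure), ?_, fun n h => ?_⟩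
  · have h1 : Tendsto (fun n => ∫ t, ‖r n t * ‖f t‖‖ ^ 2 ∂unitMeasure) atTop
        (𝓝 (∫ _, (0 : ℝ) ∂unitMeasure)) := by
      refine tendsto_integral_of_dominated_convergence (fun t => (L * (2 * M)) ^ 2 * ‖f t‖ ^ 2)
        (fun n => (hm n).1.norm.pow 2) (f.integrable_norm_sq.const_mul _)
        (fun n => Eventually.of_forall fun t => ?_) ?_
      · rw [norm_pow, norm_norm, ← mul_pow, norm_mul, norm_norm, Real.norm_of_nonneg (hr0 n t)]
        have := hr0 n t
        gcongr
        exact hrb n t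
      · filter_upwards [ae_restrict_mem measurableSet_Ioo] with t ht
        have h2 := ((hlim t ht).sub_const (ι (c t))).norm
        have h3 := ((h2.mul_const ‖f t‖).norm).pow 2
        simpa [← hr] using h3
    simp only [integral_zero] at h1
    simpa using (h1.sqrt).const_mul (L ^ 3)
  · rw [form, form, ← integral_sub (integrable_form hb (hcn n) (hMn n) f h)
      (integrable_form hb hc hM f h), ← Real.norm_eq_abs]
    have hi : Integrable (fun t => ‖r n t * ‖f t‖‖ * ‖h t‖) unitMeasure :=
      (hm n).norm.integrable_mul (Lp.memLp h).norm
    refine (norm_integral_le_of_norm_le (hi.const_mul (L ^ 3))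
      (Eventually.of_forall fun t => ?_)).trans ?_
    · rw [Real.norm_eq_abs, norm_mul, norm_norm, Real.norm_of_nonneg (hr0 n t)]
      refine (hb.g_sub_le _ _ _ _).trans ?_
      calc L * ‖ι (cn n t) - ι (c t)‖ * ‖ι (f t)‖ * ‖ι (h t)‖
          ≤ L * r n t * (L * ‖f t‖) * (L * ‖h t‖) := by
            have := hr0 n t
            rw [← hr]
            gcongr
            · exact hb.norm_emb_apply _
            · exact hb.norm_emb_apply _
        _ = _ := by ring
    · rw [integral_const_mul, mul_assoc]
      gcongr
      rw [h.norm_eq_sqrt]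
      exact integral_norm_mul_norm_le (hm n) (Lp.memLp h)

theorem tendsto_form_const (f : L2 V) :
    Tendsto (fun n => G.form (cn n) f f) atTop (𝓝 (G.form c f f)) := by
  obtain ⟨e, he, h⟩ := exists_abs_form_sub_le hb hc hM hcn hMn hlim f
  rw [tendsto_iff_norm_sub_tendsto_zero]
  exact squeeze_zero (fun _ => norm_nonneg _) (fun n => h n f) (by simpa using he.mul_const ‖f‖)

/-- Lower semicontinuity of the quadratic functionals under weak convergence of the arguments and
pointwise convergence in `Y` of the curves. -/
theorem eventually_form_le {f : L2 V} {fn : ℕ → L2 V} (hf : WeakTendsto fn f) {D : ℝ}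
    (hD : ∀ n, ‖fn n‖ ≤ D) {ε : ℝ} (hε : 0 < ε) :
    ∀ᶠ n in atTop, G.form c f f ≤ G.form (cn n) (fn n) (fn n) + ε := by
  obtain ⟨e, he, h⟩ := exists_abs_form_sub_le hb hc hM hcn hMn hlim f
  have h1 := tendsto_form_const hb hc hM hcn hMn hlim f
  have h2 : Tendsto (fun n => G.form c f (fn n)) atTop (𝓝 (G.form c f f)) :=
    hf (formL hb hc hM f)
  have h3 : Tendsto (fun n => |e n| * D) atTop (𝓝 0) := by simpa using he.abs.mul_const D
  have h4 : Tendsto (fun n => 2 * (G.form c f (fn n) - |e n| * D) - G.form (cn n) f f) atTop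
      (𝓝 (2 * (G.form c f f - 0) - G.form c f f)) := ((h2.sub h3).const_mul 2).sub h1
  have h5 : 2 * (G.form c f f - 0) - G.form c f f > G.form c f f - ε := by linarith
  filter_upwards [h4.eventually (lt_mem_nhds h5)] with n hn
  have h6 := tangent_le_form hb (hcn n) (hMn n) f (fn n)
  have h7 := (abs_le.1 ((h n (fn n)).trans
    (mul_le_mul (le_abs_self _) (hD n) (norm_nonneg _) (abs_nonneg _)))).1
  linarith

theorem tendsto_form {f : L2 V} {fn : ℕ → L2 V} (hf : Tendsto fn atTop (𝓝 f)) :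
    Tendsto (fun n => G.form (cn n) (fn n) (fn n)) atTop (𝓝 (G.form c f f)) := by
  have h1 := tendsto_form_const hb hc hM hcn hMn hlim f
  have h2 : Tendsto (fun n => L ^ 4 * (2 + M) * (‖fn n - f‖ * (‖fn n‖ + ‖f‖))) atTop (𝓝 0) := by
    have a := (tendsto_iff_norm_sub_tendsto_zero.1 hf).mul (hf.norm.add_const ‖f‖)
    simpa using a.const_mul (L ^ 4 * (2 + M))
  have h3 : Tendsto (fun n => G.form (cn n) (fn n) (fn n) - G.form (cn n) f f) atTop (𝓝 0) := by
    refine squeeze_zero_norm (fun n => ?_) h2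
    have e : G.form (cn n) (fn n) (fn n) - G.form (cn n) f f
        = G.form (cn n) (fn n - f) (fn n) + G.form (cn n) (fn n - f) f := by
      rw [form_sub_left hb (hcn n) (hMn n), form_sub_left hb (hcn n) (hMn n), form_symm (fn n) f]
      ring
    rw [e]
    refine (norm_add_le _ _).trans ?_
    refine (add_le_add (abs_form_le hb (hcn n) (hMn n) _ _)
      (abs_form_le hb (hcn n) (hMn n) _ _)).trans_eq ?_
    ring
  simpa using h3.add h1

end AdmissibleMetric

end RiemSpline
end

noncomputable section

namespace RiemSpline

variable {V Y : Type*} [NormedAddCommGroup V] [InnerProductSpace ℝ V] [CompleteSpace V]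
  [NormedAddCommGroup Y] [NormedSpace ℝ Y] {ι : V →L[ℝ] Y}

/-! ### Weak convergence and compact embeddings -/

theorem WeakTendsto.exists_norm_le {E : Type*} [NormedAddCommGroup E] [NormedSpace ℝ E] {x : ℕ → E}
    {a : E} (h : WeakTendsto x a) : ∃ M : ℝ, ∀ n, ‖x n‖ ≤ M := by
  obtain ⟨C, hC⟩ := banach_steinhaus (g := fun n => NormedSpace.inclusionInDoubleDual ℝ E (x n))
    fun φ => by
      obtain ⟨D, hD⟩ := (Metric.isBounded_range_of_tendsto _ (h φ)).exists_norm_le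
      exact ⟨D, fun n => by simpa using hD _ (mem_range_self n)⟩
  exact ⟨C, fun n => by
    rw [← (NormedSpace.inclusionInDoubleDualLi (E := E) ℝ).norm_map (x n)]; exact hC n⟩

theorem WeakTendsto.of_tendsto {E : Type*} [NormedAddCommGroup E] [NormedSpace ℝ E] {x : ℕ → E}
    {a : E} (h : Tendsto x atTop (𝓝 a)) : WeakTendsto x a :=
  fun φ => (φ.continuous.tendsto a).comp h

theorem WeakTendsto.add {E : Type*} [NormedAddCommGroup E] [NormedSpace ℝ E] {x y : ℕ → E}
    {a b : E} (h : WeakTendsto x a) (h' : WeakTendsto y b) :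
    WeakTendsto (fun n => x n + y n) (a + b) := fun φ => by
  simp only [map_add]; exact (h φ).add (h' φ)

theorem WeakTendsto.unique {E : Type*} [NormedAddCommGroup E] [NormedSpace ℝ E] {x : ℕ → E}
    {a b : E} (h : WeakTendsto x a) (h' : WeakTendsto x b) : a = b :=
  (SeparatingDual.eq_iff_forall_dual_eq (R := ℝ)).2 fun φ => tendsto_nhds_unique (h φ) (h' φ)

/-- Compact operators are completely continuous. -/
theorem WeakTendsto.tendsto_compact (hι : IsCompactOperator ι) {x : ℕ → V} {a : V}
    (h : WeakTendsto x a) : Tendsto (fun n => ι (x n)) atTop (𝓝 (ι a)) := by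
  obtain ⟨M, hM⟩ := h.exists_norm_le
  have hι' : IsCompactOperator (ι : V →ₗ[ℝ] Y) := hι
  obtain ⟨K, hK, hKs⟩ := hι'.image_closedBall_subset_compact M
  refine tendsto_of_subseq_tendsto fun ns hns => ?_
  obtain ⟨y, -, φ, hφ, hy⟩ := hK.tendsto_subseq (x := fun n => ι (x (ns n)))
    fun n => hKs ⟨_, by simpa using hM (ns n), rfl⟩
  refine ⟨φ, ?_⟩
  have e : y = ι a := (WeakTendsto.of_tendsto hy).unique
    ((h.map ι).subseq (hns.comp hφ.tendsto_atTop))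
  exact e ▸ hy

/-! ### The regularized spline energy of a Sobolev curve -/

namespace AdmissibleMetric

variable (G : AdmissibleMetric ι)

/-- The Christoffel term `Γ_y(y', y')` along a Sobolev curve. -/
def christoffelCurve (u : W22 V) (t : ℝ) : V := G.christoffel (u.c t) (u.v t) (u.v t)

theorem continuous_christoffelCurve (u : W22 V) : Continuous (G.christoffelCurve u) := by
  obtain ⟨b, L, hb⟩ := G.exists_bounds
  obtain ⟨C, hC0, hC⟩ := hb.exists_christoffel_lip (3 * ‖u‖)
  rw [continuous_iff_continuousAt]
  intro t
  rw [ContinuousAt, tendsto_iff_norm_sub_tendsto_zero]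
  have h1 : Tendsto (fun s => C * (‖ι (u.c s) - ι (u.c t)‖ + ‖ι (u.v s) - ι (u.v t)‖)) (𝓝 t)
      (𝓝 (C * (‖ι (u.c t) - ι (u.c t)‖ + ‖ι (u.v t) - ι (u.v t)‖))) := by
    have : Continuous fun s => C * (‖ι (u.c s) - ι (u.c t)‖ + ‖ι (u.v s) - ι (u.v t)‖) := by
      have := u.continuous_c
      have := u.continuous_v
      fun_prop
    exact this.tendsto t
  simp only [sub_self, norm_zero, add_zero, mul_zero] at h1
  exact squeeze_zero (fun _ => norm_nonneg _)
    (fun s => hC _ _ _ _ (u.norm_v_le s) (u.norm_v_le t)) h1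

variable {G} in
theorem Bounds.norm_christoffelCurve_le {b L : ℝ} (hb : G.Bounds b L) {u : W22 V} {M : ℝ}
    (hM : ‖u‖ ≤ M) (t : ℝ) : ‖G.christoffelCurve u t‖ ≤ 2 * L ^ 4 * (3 * M) * (3 * M) / b := by
  have := hb.L_nonneg
  rw [le_div_iff₀ hb.c_pos, mul_comm]
  have h : ‖u.v t‖ ≤ 3 * M := (u.norm_v_le t).trans (by linarith)
  have hM0 : 0 ≤ M := (norm_nonneg _).trans hM
  exact (hb.norm_christoffel_le _ _ _).trans (by gcongr)

theorem memLp_christoffelCurve (u : W22 V) : MemLp (G.christoffelCurve u) 2 unitMeasure := by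
  obtain ⟨b, L, hb⟩ := G.exists_bounds
  exact MemLp.of_bound (G.continuous_christoffelCurve u).aestronglyMeasurable _
    (Eventually.of_forall (hb.norm_christoffelCurve_le le_rfl))

/-- The Christoffel term along a Sobolev curve as an element of `L²`. -/
def christoffelL2 (u : W22 V) : L2 V := (G.memLp_christoffelCurve u).toLp _

theorem christoffelL2_ae (u : W22 V) :
    G.christoffelL2 u =ᵐ[unitMeasure] G.christoffelCurve u := MemLp.coeFn_toLp _

/-- The covariant acceleration of a Sobolev curve as an element of `L²`. -/
def covL2 (u : W22 V) : L2 V := u.acc + G.christoffelL2 u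

theorem covL2_ae (u : W22 V) :
    G.covL2 u =ᵐ[unitMeasure] fun t => u.acc t + G.christoffelCurve u t := by
  filter_upwards [Lp.coeFn_add u.acc (G.christoffelL2 u), G.christoffelL2_ae u] with t h1 h2
  rw [covL2, h1, Pi.add_apply, h2]

/-- The regularized spline energy as a real number. -/
def energy (σ : ℝ) (u : W22 V) : ℝ :=
  G.form u.c (G.covL2 u) (G.covL2 u) + σ * G.form u.c u.vel u.vel

theorem integrable_form_curve (u : W22 V) (f h : L2 V) :
    Integrable (fun t => G.g (u.c t) (f t) (h t)) unitMeasure := by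
  obtain ⟨b, L, hb⟩ := G.exists_bounds
  exact integrable_form hb u.continuous_c u.norm_c_le f h

theorem form_self_nonneg' (c : ℝ → V) (f : L2 V) : 0 ≤ G.form c f f := by
  obtain ⟨b, L, hb⟩ := G.exists_bounds
  exact form_self_nonneg hb f

theorem lintegral_g_self (u : W22 V) (f : L2 V) :
    ∫⁻ t, ENNReal.ofReal (G.g (u.c t) (f t) (f t)) ∂unitMeasure
      = ENNReal.ofReal (G.form u.c f f) := by
  obtain ⟨b, L, hb⟩ := G.exists_bounds
  rw [form, ofReal_integral_eq_lintegral_ofReal (G.integrable_form_curve u f f)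
    (Eventually.of_forall fun t => hb.g_self_nonneg _ _)]

theorem splineEnergy_eq (u : W22 V) :
    G.splineEnergy u = ENNReal.ofReal (G.form u.c (G.covL2 u) (G.covL2 u)) := by
  rw [← lintegral_g_self, splineEnergy]
  refine lintegral_congr_ae ?_
  filter_upwards [u.curve_ae, u.vel_ae, G.covL2_ae u] with t h1 h2 h3
  rw [h3, covAcc, h1, h2, christoffelCurve]

theorem pathEnergy_eq (u : W22 V) : G.pathEnergy u = ENNReal.ofReal (G.form u.c u.vel u.vel) := by
  rw [← lintegral_g_self, pathEnergy]
  refine lintegral_congr_ae ?_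
  filter_upwards [u.curve_ae] with t h1
  rw [h1]

theorem regSplineEnergy_eq {σ : ℝ} (hσ : 0 ≤ σ) (u : W22 V) :
    G.regSplineEnergy σ u = ENNReal.ofReal (G.energy σ u) := by
  rw [regSplineEnergy, splineEnergy_eq, pathEnergy_eq, energy,
    ENNReal.ofReal_add (G.form_self_nonneg' _ _) (mul_nonneg hσ (G.form_self_nonneg' _ _)),
    ENNReal.ofReal_mul hσ]

/-- Convergence of the Christoffel terms along a weakly convergent sequence of Sobolev curves. -/
theorem tendsto_christoffelL2 {x : ℕ → W22 V} {u : W22 V} {M : ℝ} (hM : ∀ n, ‖x n‖ ≤ M)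
    (huM : ‖u‖ ≤ M)
    (hc : ∀ t, Tendsto (fun n => ι ((x n).c t)) atTop (𝓝 (ι (u.c t))))
    (hv : ∀ t, Tendsto (fun n => ι ((x n).v t)) atTop (𝓝 (ι (u.v t)))) :
    Tendsto (fun n => G.christoffelL2 (x n)) atTop (𝓝 (G.christoffelL2 u)) := by
  obtain ⟨b, L, hb⟩ := G.exists_bounds
  obtain ⟨C, hC0, hC⟩ := hb.exists_christoffel_lip (3 * M)
  have hpt : ∀ t, Tendsto (fun n => G.christoffelCurve (x n) t) atTop
      (𝓝 (G.christoffelCurve u t)) := fun t => by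
    rw [tendsto_iff_norm_sub_tendsto_zero]
    have h1 := ((tendsto_iff_norm_sub_tendsto_zero.1 (hc t)).add
      (tendsto_iff_norm_sub_tendsto_zero.1 (hv t))).const_mul C
    rw [add_zero, mul_zero] at h1
    refine squeeze_zero (fun _ => norm_nonneg _) (fun n => hC _ _ _ _ ?_ ?_) h1
    · exact ((x n).norm_v_le t).trans (by linarith [hM n])
    · exact (u.norm_v_le t).trans (by linarith)
  set B := 2 * L ^ 4 * (3 * M) * (3 * M) / b
  have hB0 : 0 ≤ B := (norm_nonneg _).trans (hb.norm_christoffelCurve_le huM 0)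
  have key : Tendsto (fun n => ‖G.christoffelL2 (x n) - G.christoffelL2 u‖ ^ 2) atTop (𝓝 0) := by
    have e : ∀ n, ‖G.christoffelL2 (x n) - G.christoffelL2 u‖ ^ 2
        = ∫ t, ‖G.christoffelCurve (x n) t - G.christoffelCurve u t‖ ^ 2 ∂unitMeasure := fun n => by
      rw [L2.norm_sq_eq]
      refine integral_congr_ae ?_
      filter_upwards [Lp.coeFn_sub (G.christoffelL2 (x n)) (G.christoffelL2 u),
        G.christoffelL2_ae u, G.christoffelL2_ae (x n)] with t h1 h2 h3
      rw [h1, Pi.sub_apply, h2, h3]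
    simp only [e]
    rw [← integral_zero ℝ ℝ (μ := unitMeasure)]
    refine tendsto_integral_of_dominated_convergence (fun _ => (2 * B) ^ 2)
      (fun n => (((G.continuous_christoffelCurve (x n)).sub
        (G.continuous_christoffelCurve u)).norm.pow 2).aestronglyMeasurable)
      (integrable_const _) (fun n => Eventually.of_forall fun t => ?_)
      (Eventually.of_forall fun t => ?_)
    · rw [norm_pow, norm_norm]
      have := (norm_sub_le (G.christoffelCurve (x n) t) (G.christoffelCurve u t)).trans
        (add_le_add (hb.norm_christoffelCurve_le (hM n) t) (hb.norm_christoffelCurve_le huM t))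
      gcongr
      linarith
    · have h1 := ((tendsto_iff_norm_sub_tendsto_zero.1 (hpt t))).pow 2
      simpa using h1
  rw [tendsto_iff_norm_sub_tendsto_zero]
  simpa using key.sqrt

/-- The regularized spline energy is lower semicontinuous with respect to weak convergence. -/
theorem eventually_energy_le (hι : IsCompactOperator ι) {σ : ℝ} (hσ : 0 < σ) {x : ℕ → W22 V}
    {u : W22 V} (hx : WeakTendsto x u) {ε : ℝ} (hε : 0 < ε) :
    ∀ᶠ n in atTop, G.energy σ u ≤ G.energy σ (x n) + ε := by
  obtain ⟨b, L, hb⟩ := G.exists_bounds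
  obtain ⟨M', hM'⟩ := hx.exists_norm_le
  set M := max M' ‖u‖
  have hM : ∀ n, ‖x n‖ ≤ M := fun n => (hM' n).trans (le_max_left _ _)
  have huM : ‖u‖ ≤ M := le_max_right _ _
  have hc : ∀ t, Tendsto (fun n => ι ((x n).c t)) atTop (𝓝 (ι (u.c t))) := fun t =>
    (hx.map (W22.evalC t)).tendsto_compact hι
  have hv : ∀ t, Tendsto (fun n => ι ((x n).v t)) atTop (𝓝 (ι (u.v t))) := fun t =>
    (hx.map (W22.evalV t)).tendsto_compact hι
  have hcM : ∀ n t, ‖(x n).c t‖ ≤ 3 * M := fun n t => ((x n).norm_c_le t).trans (by linarith [hM n])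
  have hucM : ∀ t, ‖u.c t‖ ≤ 3 * M := fun t => (u.norm_c_le t).trans (by linarith)
  -- the accelerations converge weakly, and the Christoffel terms strongly because they depend only
  -- on the images of position and velocity in `Y`
  have hR : WeakTendsto (fun n => G.covL2 (x n)) (G.covL2 u) :=
    (hx.map W22.accL).add (WeakTendsto.of_tendsto (G.tendsto_christoffelL2 hM huM hc hv))
  obtain ⟨D, hD⟩ := hR.exists_norm_le
  have h1 := eventually_form_le hb u.continuous_c hucM (fun n => (x n).continuous_c) hcM
    (fun t _ => hc t) hR hD (half_pos hε)
  have h2 := eventually_form_le hb u.continuous_c hucM (fun n => (x n).continuous_c) hcM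
    (fun t _ => hc t) (hx.map W22.velL) (fun n => (x n).norm_vel_le.trans (hM n))
    (div_pos (half_pos hε) hσ)
  filter_upwards [h1, h2] with n h1 h2
  have h3 := mul_le_mul_of_nonneg_left h2 hσ.le
  rw [mul_add, mul_div_cancel₀ _ hσ.ne'] at h3
  simp only [W22.velL_apply] at h3
  rw [energy, energy]
  linarith

/-- The regularized spline energy is continuous with respect to strong convergence. -/
theorem tendsto_energy {σ : ℝ} {x : ℕ → W22 V} {u : W22 V} (hx : Tendsto x atTop (𝓝 u)) :
    Tendsto (fun n => G.energy σ (x n)) atTop (𝓝 (G.energy σ u)) := by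
  obtain ⟨b, L, hb⟩ := G.exists_bounds
  obtain ⟨M', hM'⟩ := (WeakTendsto.of_tendsto hx).exists_norm_le
  set M := max M' ‖u‖
  have hM : ∀ n, ‖x n‖ ≤ M := fun n => (hM' n).trans (le_max_left _ _)
  have huM : ‖u‖ ≤ M := le_max_right _ _
  have hc : ∀ t, Tendsto (fun n => ι ((x n).c t)) atTop (𝓝 (ι (u.c t))) := fun t =>
    ((ι.comp (W22.evalC t)).continuous.tendsto u).comp hx
  have hv : ∀ t, Tendsto (fun n => ι ((x n).v t)) atTop (𝓝 (ι (u.v t))) := fun t =>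
    ((ι.comp (W22.evalV t)).continuous.tendsto u).comp hx
  have hcM : ∀ n t, ‖(x n).c t‖ ≤ 3 * M := fun n t => ((x n).norm_c_le t).trans (by linarith [hM n])
  have hucM : ∀ t, ‖u.c t‖ ≤ 3 * M := fun t => (u.norm_c_le t).trans (by linarith)
  have hR : Tendsto (fun n => G.covL2 (x n)) atTop (𝓝 (G.covL2 u)) :=
    ((W22.accL.continuous.tendsto u).comp hx).add (G.tendsto_christoffelL2 hM huM hc hv)
  have h1 := tendsto_form hb u.continuous_c hucM (fun n => (x n).continuous_c) hcM
    (fun t _ => hc t) hR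
  have h2 := tendsto_form hb u.continuous_c hucM (fun n => (x n).continuous_c) hcM
    (fun t _ => hc t) ((W22.velL.continuous.tendsto u).comp hx)
  exact h1.add (h2.const_mul σ)

end AdmissibleMetric

end RiemSpline
end

noncomputable section

namespace RiemSpline

variable {V : Type*} [NormedAddCommGroup V] [InnerProductSpace ℝ V] [CompleteSpace V]

/-! ### Step functions and discrete accelerations -/

theorem integral_comp_floor {K : ℕ} (hK : 0 < K) (F : ℤ → ℝ) :
    ∫ t, F ⌊(K : ℝ) * t⌋ ∂unitMeasure = (1 / K : ℝ) * ∑ j ∈ Finset.range K, F j := by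
  have hK' : (0 : ℝ) < K := by exact_mod_cast hK
  have hle : ∀ j : ℕ, (j : ℝ) / K ≤ ((j + 1 : ℕ) : ℝ) / K := fun j => by
    gcongr; exact j.le_succ
  have hpt : ∀ j : ℕ, EqOn (fun _ => F j) (fun t => F ⌊(K : ℝ) * t⌋)
      (Ioo ((j : ℝ) / K) (((j + 1 : ℕ) : ℝ) / K)) := fun j t ht => by
    have h1 := (div_lt_iff₀ hK').1 ht.1
    have h2 := (lt_div_iff₀ hK').1 ht.2
    have : ⌊(K : ℝ) * t⌋ = j := by
      rw [Int.floor_eq_iff]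
      push_cast at h2 ⊢
      constructor <;> linarith
    simp only [this]
  have h1 := intervalIntegral.sum_integral_adjacent_intervals (μ := volume)
    (f := fun t => F ⌊(K : ℝ) * t⌋) (a := fun j : ℕ => (j : ℝ) / K) (n := K) (fun j _ =>
      IntervalIntegrable.congr_uIoo intervalIntegrable_const (by
        rw [uIoo_of_le (hle j)]; exact hpt j))
  have h2 : ((K : ℕ) : ℝ) / K = 1 := div_self hK'.ne'
  rw [unitMeasure, ← integral_Ioc_eq_integral_Ioo, ← intervalIntegral.integral_of_le zero_le_one]
  simp only [h2, Nat.cast_zero, zero_div] at h1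
  rw [← h1, Finset.mul_sum]
  refine Finset.sum_congr rfl fun j _ => ?_
  rw [← intervalIntegral.integral_congr_Ioo_of_le (hle j) (hpt j),
    intervalIntegral.integral_const, smul_eq_mul]
  push_cast
  ring

theorem sum_range_two_mul (f : ℕ → ℝ) (n : ℕ) : ∑ i ∈ Finset.range (2 * n), f i
    = ∑ j ∈ Finset.range n, (f (2 * j) + f (2 * j + 1)) := by
  induction n with
  | zero => simp
  | succ n ih =>
    rw [show 2 * (n + 1) = 2 * n + 1 + 1 by ring, Finset.sum_range_succ, Finset.sum_range_succ,
      Finset.sum_range_succ, ih]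
    ring

/-- The integral of a step function on the cells, in which the two end cells have half length. -/
theorem integral_cell {K : ℕ} (hK : 0 < K) (F : ℤ → ℝ) :
    ∫ t, F (cell K t) ∂unitMeasure = (1 / (2 * K) : ℝ) *
      (∑ j ∈ Finset.range K, F j + ∑ j ∈ Finset.range K, F (j + 1)) := by
  have hcell : ∀ t, cell K t = (⌊((2 * K : ℕ) : ℝ) * t⌋ + 1) / 2 := fun t => by
    refine cell_eq ?_ ?_
    · have h1 : ((⌊((2 * K : ℕ) : ℝ) * t⌋ + 1) / 2) * 2 ≤ ⌊((2 * K : ℕ) : ℝ) * t⌋ + 1 :=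
        Int.ediv_mul_le _ (by norm_num)
      have h2 := Int.floor_le (((2 * K : ℕ) : ℝ) * t)
      have h3 : (((⌊((2 * K : ℕ) : ℝ) * t⌋ + 1) / 2 : ℤ) : ℝ) * 2
        ≤ (⌊((2 * K : ℕ) : ℝ) * t⌋ : ℝ) + 1 := by exact_mod_cast h1
      have h4 : ((2 * K : ℕ) : ℝ) * t = 2 * (K * t) := by push_cast; ring
      linarith
    · have h1 : ⌊((2 * K : ℕ) : ℝ) * t⌋ ≤ ((⌊((2 * K : ℕ) : ℝ) * t⌋ + 1) / 2) * 2 := by omega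
      have h2 := Int.lt_floor_add_one (((2 * K : ℕ) : ℝ) * t)
      have h3 : (⌊((2 * K : ℕ) : ℝ) * t⌋ : ℝ)
        ≤ (((⌊((2 * K : ℕ) : ℝ) * t⌋ + 1) / 2 : ℤ) : ℝ) * 2 := by exact_mod_cast h1
      have h4 : ((2 * K : ℕ) : ℝ) * t = 2 * (K * t) := by push_cast; ring
      linarith
  simp only [hcell]
  rw [integral_comp_floor (by omega) fun i => F ((i + 1) / 2),
    sum_range_two_mul (fun i : ℕ => F (((i : ℤ) + 1) / 2)), ← Finset.sum_add_distrib]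
  push_cast
  congr 1
  refine Finset.sum_congr rfl fun j _ => ?_
  have e1 : (2 * (j : ℤ) + 1) / 2 = j := by omega
  have e2 : (2 * (j : ℤ) + 1 + 1) / 2 = j + 1 := by omega
  rw [e1, e2]

theorem integrable_cell (F : ℤ → ℝ) (K : ℕ) : Integrable (fun t => F (cell K t)) unitMeasure :=
  (memLp_cell F K).integrable (by norm_num)

theorem sum_succ_le_integral_cell {K : ℕ} (hK : 0 < K) {F : ℤ → ℝ} (hF : ∀ k, 0 ≤ F k) :
    (1 / K : ℝ) * ∑ j ∈ Finset.range K, F (j + 1) ≤ 2 * ∫ t, F (cell K t) ∂unitMeasure := by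
  have hK' : (0 : ℝ) < K := by exact_mod_cast hK
  rw [integral_cell hK, ← mul_assoc, show 2 * (1 / (2 * K) : ℝ) = 1 / K by field_simp]
  gcongr
  have : 0 ≤ ∑ j ∈ Finset.range K, F j := Finset.sum_nonneg fun _ _ => hF _
  linarith

theorem le_integral_cell {K : ℕ} (hK : 0 < K) {F : ℤ → ℝ} (hF : ∀ k, 0 ≤ F k) {k : ℕ}
    (hk : k ≤ K) : (1 / K : ℝ) * F k ≤ 2 * ∫ t, F (cell K t) ∂unitMeasure := by
  have hK' : (0 : ℝ) < K := by exact_mod_cast hK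
  rw [integral_cell hK, ← mul_assoc, show 2 * (1 / (2 * K) : ℝ) = 1 / K by field_simp]
  gcongr
  have h1 : 0 ≤ ∑ j ∈ Finset.range K, F j := Finset.sum_nonneg fun _ _ => hF _
  have h2 : 0 ≤ ∑ j ∈ Finset.range K, F (j + 1) := Finset.sum_nonneg fun _ _ => hF _
  rcases Nat.lt_or_ge k K with h | h
  · have := Finset.single_le_sum (f := fun j : ℕ => F j) (fun j _ => hF j) (Finset.mem_range.2 h)
    linarith
  · obtain ⟨j, rfl⟩ : ∃ j, k = j + 1 := ⟨k - 1, by omega⟩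
    have := Finset.single_le_sum (f := fun j : ℕ => F (j + 1)) (fun j _ => hF (j + 1))
      (Finset.mem_range.2 (show j < K by omega))
    push_cast
    linarith

variable (Y : ℤ → V) {K : ℕ}

/-- The discrete acceleration `K² (Y_{k+1} - 2 Y_k + Y_{k-1})`. -/
def discAcc (Y : ℤ → V) (K : ℕ) (k : ℤ) : V := (K : ℝ) ^ 2 • secDiff Y k

/-- The discrete velocity `K (Y_{k+1} - Y_k)`. -/
def discVel (Y : ℤ → V) (K : ℕ) (k : ℤ) : V := (K : ℝ) • (Y (k + 1) - Y k)

theorem norm_acc_eta_sq : ‖(eta Y K).acc‖ ^ 2 = ∫ t, ‖discAcc Y K (cell K t)‖ ^ 2 ∂unitMeasure := by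
  rw [L2.norm_sq_eq]
  refine integral_congr_ae ?_
  filter_upwards [eta_acc_ae Y (K := K)] with t ht
  rw [ht, discAcc]

section bounds

-- The natural scale is `s = K^{-1/2}`: square integrability of the acceleration bounds the second
-- differences by `O(s³)` only, whereas the first differences are `O(s²)`.
variable {Y} {s M : ℝ} (hs : 0 < s) (hKs : K * s ^ 2 = 1) (hM : ‖eta Y K‖ ≤ M)

include hs hKs

theorem step_pos : 0 < K := by
  rcases Nat.eq_zero_or_pos K with h | h
  · subst h; simp at hKs
  · exact h

theorem step_le_one : s ≤ 1 := by
  have h : (1 : ℝ) ≤ K := by exact_mod_cast step_pos hs hKs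
  by_contra hlt
  nlinarith [not_le.1 hlt]

theorem inv_eq_step_sq : (1 / K : ℝ) = s ^ 2 := by
  have h : (0 : ℝ) < K := by exact_mod_cast step_pos hs hKs
  rw [div_eq_iff h.ne', mul_comm, hKs]

theorem secDiff_eq_discAcc (k : ℤ) : secDiff Y k = s ^ 4 • discAcc Y K k := by
  rw [discAcc, smul_smul, show s ^ 4 * (K : ℝ) ^ 2 = (K * s ^ 2) ^ 2 by ring, hKs, one_pow,
    one_smul]

theorem sub_eq_discVel (k : ℤ) : Y (k + 1) - Y k = s ^ 2 • discVel Y K k := by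
  rw [discVel, smul_smul, mul_comm, hKs, one_smul]

include hM

theorem step_mul_norm_discAcc_le {k : ℕ} (hk : k ≤ K) : s * ‖discAcc Y K k‖ ≤ 2 * M := by
  have hM0 : 0 ≤ M := (norm_nonneg _).trans hM
  have h1 := le_integral_cell (step_pos hs hKs) (F := fun k => ‖discAcc Y K k‖ ^ 2)
    (fun _ => sq_nonneg _) hk
  rw [← norm_acc_eta_sq, inv_eq_step_sq hs hKs] at h1
  have h2 : ‖(eta Y K).acc‖ ^ 2 ≤ M ^ 2 :=
    pow_le_pow_left₀ (norm_nonneg _) ((W22.norm_acc_le _).trans hM) 2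
  refine abs_le_of_sq_le_sq' ?_ (by positivity) |>.2
  nlinarith

theorem sq_mul_norm_discAcc_le {k : ℕ} (hk : k ≤ K) : s ^ 2 * ‖discAcc Y K k‖ ≤ 2 * M := by
  have h1 := step_mul_norm_discAcc_le hs hKs hM hk
  have h2 := step_le_one hs hKs
  have h3 : s * (s * ‖discAcc Y K k‖) ≤ 1 * (s * ‖discAcc Y K k‖) := by gcongr
  nlinarith

theorem norm_secDiff_le {k : ℕ} (hk : k ≤ K) : ‖secDiff Y k‖ ≤ 2 * M * s ^ 3 := by
  rw [secDiff_eq_discAcc hs hKs, norm_smul, Real.norm_of_nonneg (by positivity)]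
  have h1 := step_mul_norm_discAcc_le hs hKs hM hk
  calc s ^ 4 * ‖discAcc Y K k‖ = (s * ‖discAcc Y K k‖) * s ^ 3 := by ring
    _ ≤ _ := by gcongr

theorem norm_node_le {k : ℕ} (hk : k ≤ K) : ‖Y k‖ ≤ 4 * M := by
  have hM0 : 0 ≤ M := (norm_nonneg _).trans hM
  have h1 := (eta_node Y (step_pos hs hKs) hk).1
  have h2 := norm_secDiff_le hs hKs hM hk
  have h3 := (W22.norm_c_le (eta Y K) ((k : ℝ) / K)).trans
    (mul_le_mul_of_nonneg_left hM zero_le_three)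
  have h4 : Y k = (eta Y K).c ((k : ℝ) / K) - (1 / 8 : ℝ) • secDiff Y k := by rw [h1]; abel
  have h5 : s ^ 3 ≤ 1 := pow_le_one₀ hs.le (step_le_one hs hKs)
  rw [h4]
  refine (norm_sub_le _ _).trans ?_
  rw [norm_smul, Real.norm_of_nonneg (by norm_num)]
  have h6 : 2 * M * s ^ 3 ≤ 2 * M * 1 := by gcongr
  linarith

theorem norm_discVel_le {k : ℕ} (hk : k ≤ K) : ‖discVel Y K k‖ ≤ 4 * M := by
  have h1 := (eta_node Y (step_pos hs hKs) hk).2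
  have h2 := sq_mul_norm_discAcc_le hs hKs hM hk
  have h3 := (W22.norm_v_le (eta Y K) ((k : ℝ) / K)).trans
    (mul_le_mul_of_nonneg_left hM zero_le_three)
  have h4 : discVel Y K k = (eta Y K).v ((k : ℝ) / K) + (s ^ 2 / 2) • discAcc Y K k := by
    have e : (s ^ 2 / 2) • discAcc Y K k = (K : ℝ) • ((1 / 2 : ℝ) • secDiff Y k) := by
      rw [secDiff_eq_discAcc hs hKs, smul_smul, smul_smul]
      congr 1
      linear_combination (- s ^ 2 / 2) * hKs
    rw [h1, e, discVel, ← smul_add]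
    congr 1
    simp only [secDiff]
    module
  rw [h4]
  refine (norm_add_le _ _).trans ?_
  rw [norm_smul, Real.norm_of_nonneg (by positivity)]
  linarith

theorem norm_sub_le_right {k : ℕ} (hk : k ≤ K) : ‖Y (k + 1) - Y k‖ ≤ 4 * M * s ^ 2 := by
  rw [sub_eq_discVel hs hKs, norm_smul, Real.norm_of_nonneg (by positivity), mul_comm]
  gcongr
  exact norm_discVel_le hs hKs hM hk

theorem norm_sub_le_left {k : ℕ} (hk : k ≤ K) : ‖Y (k - 1) - Y k‖ ≤ 6 * M * s ^ 2 := by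
  have hM0 : 0 ≤ M := (norm_nonneg _).trans hM
  have e : Y (k - 1) - Y k = secDiff Y k - (Y (k + 1) - Y k) := by simp only [secDiff]; module
  rw [e]
  refine (norm_sub_le _ _).trans ?_
  have h1 := norm_secDiff_le hs hKs hM hk
  have h2 := norm_sub_le_right hs hKs hM hk
  have h3 : 2 * M * s ^ 3 ≤ 2 * M * s ^ 2 := by
    gcongr ?_ * ?_
    exact pow_le_pow_of_le_one hs.le (step_le_one hs hKs) (by norm_num)
  linarith

theorem norm_c_sub_node_le {k : ℕ} (hk : k ≤ K) {t : ℝ} (ht : t ∈ Icc (0 : ℝ) 1)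
    (h : cell K t = k) : ‖(eta Y K).c t - Y k‖ ≤ 5 * M * s ^ 2 := by
  have hM0 : 0 ≤ M := (norm_nonneg _).trans hM
  have l1 := sub_half_le_of_cell K t
  have l2 := lt_add_half_of_cell K t
  rw [h] at l1 l2
  have h1 := (eta_cell Y (step_pos hs hKs) (h ▸ cell_mem K ht) ht l1 l2.le).1
  set r := (K : ℝ) * t - ((k : ℤ) - 1 / 2) with hr
  have r0 : 0 ≤ r := by linarith
  have r1 : r ≤ 1 := by linarith
  have e : (eta Y K).c t - Y k = (-(r - 1 / 2)) • (Y (k - 1) - Y k)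
      + (r ^ 2 / 2) • secDiff Y k := by
    rw [h1]; simp only [quadPiece, secDiff]; module
  rw [e]
  refine (norm_add_le _ _).trans ?_
  rw [norm_smul, norm_smul, Real.norm_of_nonneg (by positivity : 0 ≤ r ^ 2 / 2), norm_neg,
    Real.norm_eq_abs]
  have h2 := norm_sub_le_left hs hKs hM hk
  have h3 := norm_secDiff_le hs hKs hM hk
  have h4 : 2 * M * s ^ 3 ≤ 2 * M * s ^ 2 := by
    gcongr ?_ * ?_
    exact pow_le_pow_of_le_one hs.le (step_le_one hs hKs) (by norm_num)
  have h5 : |r - 1 / 2| ≤ 1 / 2 := abs_le.2 ⟨by linarith, by linarith⟩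
  have h6 : r ^ 2 / 2 ≤ 1 / 2 := by nlinarith
  have h7 : |r - 1 / 2| * ‖Y (k - 1) - Y k‖ ≤ 1 / 2 * (6 * M * s ^ 2) := by gcongr
  have h8 : r ^ 2 / 2 * ‖secDiff Y k‖ ≤ 1 / 2 * (2 * M * s ^ 3) := by gcongr
  nlinarith [mul_nonneg hM0 (sq_nonneg s)]

theorem norm_v_sub_discVel_le {k : ℕ} (hk : k ≤ K) {t : ℝ} (ht : t ∈ Icc (0 : ℝ) 1)
    (h : cell K t = k) : ‖(eta Y K).v t - discVel Y K k‖ ≤ 2 * M * s := by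
  have hM0 : 0 ≤ M := (norm_nonneg _).trans hM
  have l1 := sub_half_le_of_cell K t
  have l2 := lt_add_half_of_cell K t
  rw [h] at l1 l2
  have h1 := (eta_cell Y (step_pos hs hKs) (h ▸ cell_mem K ht) ht l1 l2.le).2
  set r := (K : ℝ) * t - ((k : ℤ) - 1 / 2) with hr
  have r0 : 0 ≤ r := by linarith
  have r1 : r ≤ 1 := by linarith
  have e : (eta Y K).v t - discVel Y K k = (s ^ 2 * (r - 1)) • discAcc Y K k := by
    have e1 : (eta Y K).v t - discVel Y K k = ((K : ℝ) * (r - 1)) • secDiff Y k := by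
      rw [h1, discVel]; simp only [secDiff]; module
    rw [e1, secDiff_eq_discAcc hs hKs, smul_smul]
    congr 1
    linear_combination (s ^ 2 * (r - 1)) * hKs
  rw [e, norm_smul, Real.norm_eq_abs, abs_mul, abs_of_nonneg (sq_nonneg s)]
  have h2 := step_mul_norm_discAcc_le hs hKs hM hk
  have h3 : |r - 1| ≤ 1 := abs_le.2 ⟨by linarith, by linarith⟩
  calc s ^ 2 * |r - 1| * ‖discAcc Y K k‖ ≤ s ^ 2 * 1 * ‖discAcc Y K k‖ := by gcongr
    _ = (s * ‖discAcc Y K k‖) * s := by ring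
    _ ≤ _ := by gcongr

end bounds

end RiemSpline
end

noncomputable section

namespace RiemSpline

variable {V Y : Type*} [NormedAddCommGroup V] [InnerProductSpace ℝ V] [CompleteSpace V]
  [NormedAddCommGroup Y] [NormedSpace ℝ Y] {ι : V →L[ℝ] Y}

/-! ### Consistency of the discrete energies -/

namespace AdmissibleMetric.Bounds

variable {G : AdmissibleMetric ι} {b L : ℝ} (hb : G.Bounds b L)

include hb

theorem abs_g_self_sub_le {y : V} {R : ℝ} (hy : ‖y‖ ≤ R) (x x' : V) :
    |G.g y x x - G.g y x' x'| ≤ L ^ 4 * (2 + R) * (‖x - x'‖ * (‖x‖ + ‖x'‖)) := by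
  have e : G.g y x x - G.g y x' x' = G.g y (x - x') x + G.g y (x - x') x' := by
    simp only [← bil_apply, map_sub, sub_apply]
    simp only [bil_apply]
    rw [G.g_symm y x' x]; ring
  have h : ∀ z : V, |G.g y (x - x') z| ≤ L ^ 4 * (2 + R) * (‖x - x'‖ * ‖z‖) := fun z => by
    have := hb.L_nonneg
    refine (hb.abs_g_le _ _ _).trans ?_
    rw [mul_assoc]
    gcongr
  rw [e]
  refine (abs_add_le _ _).trans ((add_le_add (h x) (h x')).trans_eq (by ring))

theorem norm_christoffel_self_le {y v : V} {R : ℝ} (hv : ‖v‖ ≤ R) :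
    ‖G.christoffel y v v‖ ≤ 2 * L ^ 4 * R * R / b := by
  have := hb.L_nonneg
  have hR : 0 ≤ R := (norm_nonneg _).trans hv
  rw [le_div_iff₀ hb.c_pos, mul_comm]
  exact (hb.norm_christoffel_le _ _ _).trans (by gcongr)

end AdmissibleMetric.Bounds

theorem AdmissibleMetric.g_smul_smul (G : AdmissibleMetric ι) (y x : V) (a : ℝ) :
    G.g y (a • x) (a • x) = a ^ 2 * G.g y x x := by
  simp only [← bil_apply, map_smul, smul_apply, smul_eq_mul]; ring

/-- The discrete covariant acceleration at a node. -/
def AdmissibleMetric.discCov (G : AdmissibleMetric ι) (Y : ℤ → V) (K : ℕ) (k : ℤ) : V :=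
  discAcc Y K k + G.christoffel (Y k) (discVel Y K k) (discVel Y K k)

theorem one_add_sq_le (x k : ℝ) : 1 + (x + k) ^ 2 ≤ (2 + 2 * k ^ 2) * (1 + x ^ 2) := by
  nlinarith [sq_nonneg (x - k), sq_nonneg (x * k)]

theorem abs_scale_le {K : ℕ} {s w q D T : ℝ} (hKs : K * s ^ 2 = 1)
    (h : |4 * w - s ^ 8 * q| ≤ D * s ^ 9 * T) :
    |4 * (K : ℝ) ^ 3 * w - s ^ 2 * q| ≤ D * s ^ 3 * T := by
  have hK3 : (K : ℝ) ^ 3 * s ^ 6 = 1 := by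
    rw [show (K : ℝ) ^ 3 * s ^ 6 = (K * s ^ 2) ^ 3 by ring, hKs, one_pow]
  have e : 4 * (K : ℝ) ^ 3 * w - s ^ 2 * q = (K : ℝ) ^ 3 * (4 * w - s ^ 8 * q) := by
    linear_combination s ^ 2 * q * hK3
  rw [e, abs_mul, abs_of_nonneg (by positivity)]
  calc (K : ℝ) ^ 3 * |4 * w - s ^ 8 * q| ≤ (K : ℝ) ^ 3 * (D * s ^ 9 * T) := by gcongr
    _ = _ := by linear_combination D * s ^ 3 * T * hK3

theorem abs_summand_le {B C1 C2 s N d w g q : ℝ} (hs : 0 ≤ s) (hs1 : s ≤ 1) (hB : 0 ≤ B)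
    (hC1 : 0 ≤ C1) (hC2 : 0 ≤ C2) (hw : |w - g| ≤ C2 * d ^ 3)
    (hg : |4 * g - s ^ 8 * q| ≤ B * (C1 * s ^ 5 * (s ^ 4 * N + s ^ 4 * N)))
    (hd : 4 * d ^ 3 ≤ C1 * s ^ 3 * (s ^ 4 * N) ^ 2) :
    |4 * w - s ^ 8 * q| ≤ (B * C1 + C1 * C2) * s ^ 9 * (1 + N ^ 2) := by
  have e : 4 * w - s ^ 8 * q = 4 * (w - g) + (4 * g - s ^ 8 * q) := by ring
  rw [e]
  refine (abs_add_le _ _).trans ?_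
  rw [abs_mul, abs_of_nonneg zero_le_four]
  have t1 : 4 * |w - g| ≤ C2 * (C1 * s ^ 3 * (s ^ 4 * N) ^ 2) :=
    calc 4 * |w - g| ≤ 4 * (C2 * d ^ 3) := by gcongr
      _ = C2 * (4 * d ^ 3) := by ring
      _ ≤ _ := by gcongr
  have t2 : s ^ 11 ≤ s ^ 9 := pow_le_pow_of_le_one hs hs1 (by norm_num)
  have t3 : C2 * (C1 * s ^ 3 * (s ^ 4 * N) ^ 2) ≤ C1 * C2 * s ^ 9 * N ^ 2 := by
    calc C2 * (C1 * s ^ 3 * (s ^ 4 * N) ^ 2) = C1 * C2 * s ^ 11 * N ^ 2 := by ring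
      _ ≤ _ := by gcongr
  have t4 : B * (C1 * s ^ 5 * (s ^ 4 * N + s ^ 4 * N)) ≤ B * C1 * s ^ 9 * (1 + N ^ 2) := by
    calc B * (C1 * s ^ 5 * (s ^ 4 * N + s ^ 4 * N)) = B * C1 * s ^ 9 * (2 * N) := by ring
      _ ≤ _ := by gcongr; nlinarith [sq_nonneg (N - 1)]
  have t5 : 0 ≤ C1 * C2 * s ^ 9 := by positivity
  linarith

/-- A single summand of the discrete spline energy, compared with the metric of the discrete
covariant acceleration. -/
theorem AdmissibleEnergy.exists_spline_summand {G : AdmissibleMetric ι} (A : AdmissibleEnergy G)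
    {M : ℝ} (hM0 : 0 ≤ M) : ∃ C s₀ : ℝ, 0 ≤ C ∧ 0 < s₀ ∧
    ∀ (s : ℝ) (Y : ℤ → V) (K k : ℕ) (m : V), 0 < s → s ≤ s₀ → K * s ^ 2 = 1 → ‖eta Y K‖ ≤ M →
      k ≤ K → IsMidpoint A.W (Y (k - 1)) (Y (k + 1)) m →
      |4 * (K : ℝ) ^ 3 * A.W (Y k) m - s ^ 2 * G.g (Y k) (G.discCov Y K k) (G.discCov Y K k)|
        ≤ C * s ^ 3 * (1 + ‖discAcc Y K k‖ ^ 2) := by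
  obtain ⟨b, L, hb⟩ := G.exists_bounds
  have hL := hb.L_nonneg
  obtain ⟨C1, s₀, hC1, hs₀, h1⟩ := A.exists_midpoint_estimate (6 * M)
  obtain ⟨C2, hC2, h2⟩ := A.exists_W_sub_g_le (4 * M + C1)
  set C3 := 2 * L ^ 4 * (4 * M) * (4 * M) / b with hC3
  have hC30 : 0 ≤ C3 := div_nonneg (by positivity) hb.c_pos.le
  set B := L ^ 4 * (2 + 4 * M) with hB
  have hB0 : 0 ≤ B := by positivity
  refine ⟨(B * C1 + C1 * C2) * (2 + 2 * (C1 + C3) ^ 2), s₀, by positivity, hs₀,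
    fun s Y K k m hs hss hKs hM hk hm => ?_⟩
  have hs1 := step_le_one hs hKs
  set y := Y k with hy
  set r := G.discCov Y K k with hr
  have ny := norm_node_le hs hKs hM hk
  have nb := norm_sub_le_right hs hKs hM hk
  have na := norm_sub_le_left hs hKs hM hk
  have nsd := norm_secDiff_le hs hKs hM hk
  have eab : (Y (k - 1) - Y k) + (Y (k + 1) - Y k) = secDiff Y k := by
    simp only [secDiff]; module
  obtain ⟨h3, h4⟩ := h1 s y (Y (k - 1) - y) (Y (k + 1) - y) m hs hss (by linarith) na
    (nb.trans (by gcongr; norm_num)) (by rw [eab]; exact nsd.trans (by gcongr; norm_num))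
    (by simpa using hm)
  rw [eab, secDiff_eq_discAcc hs hKs, sub_eq_discVel hs hKs, hb.christoffel_smul, ← pow_mul,
    sub_sub, ← smul_add] at h4
  change ‖(2 : ℝ) • (m - y) - s ^ 4 • r‖ ≤ C1 * s ^ 5 at h4
  obtain ⟨d, rfl⟩ : ∃ d, m = y + d := ⟨m - y, by abel⟩
  rw [add_sub_cancel_left] at h3 h4
  set x := ‖discAcc Y K k‖ with hx
  have hx0 : 0 ≤ x := norm_nonneg _
  have nr : ‖r‖ ≤ x + C3 :=
    (norm_add_le _ _).trans (add_le_add le_rfl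
      (hb.norm_christoffel_self_le (norm_discVel_le hs hKs hM hk)))
  set N := x + (C1 + C3) with hN
  have hN0 : 0 ≤ N := by positivity
  have s5 : s ^ 5 ≤ s ^ 4 := pow_le_pow_of_le_one hs.le hs1 (by norm_num)
  have n4 : ‖s ^ 4 • r‖ ≤ s ^ 4 * N := by
    rw [norm_smul, Real.norm_of_nonneg (by positivity)]
    gcongr; linarith
  have n2 : ‖(2 : ℝ) • d‖ ≤ s ^ 4 * N := by
    have e : (2 : ℝ) • d = ((2 : ℝ) • d - s ^ 4 • r) + s ^ 4 • r := by abel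
    rw [e]
    refine (norm_add_le _ _).trans ?_
    rw [norm_smul (s ^ 4), Real.norm_of_nonneg (by positivity)]
    have : s ^ 4 * ‖r‖ ≤ s ^ 4 * (x + C3) := by gcongr
    nlinarith [mul_le_mul_of_nonneg_left s5 hC1]
  have hW : |A.W y (y + d) - G.g y d d| ≤ C2 * ‖d‖ ^ 3 := by
    refine h2 y d (add_le_add ny (h3.trans ?_))
    exact mul_le_of_le_one_right hC1 (pow_le_one₀ hs.le hs1)
  have hg := hb.abs_g_self_sub_le ny ((2 : ℝ) • d) (s ^ 4 • r)
  have eg1 : G.g y ((2 : ℝ) • d) ((2 : ℝ) • d) = 4 * G.g y d d := by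
    rw [G.g_smul_smul]; norm_num
  have eg2 : G.g y (s ^ 4 • r) (s ^ 4 • r) = s ^ 8 * G.g y r r := by
    rw [G.g_smul_smul]; ring
  rw [eg1, eg2] at hg
  have hg' : |4 * G.g y d d - s ^ 8 * G.g y r r| ≤ B * (C1 * s ^ 5 * (s ^ 4 * N + s ^ 4 * N)) :=
    hg.trans (by gcongr)
  -- one factor `‖d‖ = O(s³)` is bounded uniformly and the other two by the acceleration, which is
  -- only square summable
  have hd : 4 * ‖d‖ ^ 3 ≤ C1 * s ^ 3 * (s ^ 4 * N) ^ 2 := by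
    rw [norm_smul, Real.norm_of_nonneg zero_le_two] at n2
    have q : (2 * ‖d‖) ^ 2 ≤ (s ^ 4 * N) ^ 2 := by gcongr
    calc 4 * ‖d‖ ^ 3 = ‖d‖ * (2 * ‖d‖) ^ 2 := by ring
      _ ≤ _ := by gcongr
  have main := abs_summand_le hs.le hs1 hB0 hC1 hC2 hW hg' hd
  refine (abs_scale_le hKs main).trans ?_
  calc (B * C1 + C1 * C2) * s ^ 3 * (1 + N ^ 2)
      ≤ (B * C1 + C1 * C2) * s ^ 3 * ((2 + 2 * (C1 + C3) ^ 2) * (1 + x ^ 2)) := by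
        gcongr; exact one_add_sq_le _ _
    _ = _ := by ring

/-- The spline energy density of the interpolation is almost constant on each cell. -/
theorem AdmissibleMetric.exists_spline_density (G : AdmissibleMetric ι) {M : ℝ} (hM0 : 0 ≤ M) :
    ∃ C : ℝ, 0 ≤ C ∧ ∀ (s : ℝ) (Y : ℤ → V) (K k : ℕ) (t : ℝ), 0 < s → K * s ^ 2 = 1 →
      ‖eta Y K‖ ≤ M → k ≤ K → t ∈ Icc (0 : ℝ) 1 → cell K t = k →
      |G.g ((eta Y K).c t) (discAcc Y K k + G.christoffelCurve (eta Y K) t)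
          (discAcc Y K k + G.christoffelCurve (eta Y K) t)
        - G.g (Y k) (G.discCov Y K k) (G.discCov Y K k)| ≤ C * s * (1 + ‖discAcc Y K k‖ ^ 2) := by
  obtain ⟨b, L, hb⟩ := G.exists_bounds
  have hL := hb.L_nonneg
  obtain ⟨C1, hC1, h1⟩ := hb.exists_christoffel_lip (4 * M)
  set C3 := 2 * L ^ 4 * (4 * M) * (4 * M) / b with hC3
  have hC30 : 0 ≤ C3 := div_nonneg (by positivity) hb.c_pos.le
  set B := L ^ 4 * (2 + 4 * M) with hB
  have hB0 : 0 ≤ B := by positivity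
  set D := C1 * (L * (7 * M)) with hD
  have hD0 : 0 ≤ D := by positivity
  refine ⟨(L ^ 4 * (5 * M) + B * D) * (2 + 2 * C3 ^ 2), by positivity,
    fun s Y K k t hs hKs hM hk ht hcell => ?_⟩
  have hs1 := step_le_one hs hKs
  have s2 : s ^ 2 ≤ s := by nlinarith
  set u := eta Y K with hu
  have ny := norm_node_le hs hKs hM hk
  have nc := norm_c_sub_node_le hs hKs hM hk ht hcell
  have nv := norm_v_sub_discVel_le hs hKs hM hk ht hcell
  set a := discAcc Y K k + G.christoffelCurve u t with ha
  set r := G.discCov Y K k with hr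
  set x := ‖discAcc Y K k‖ with hx
  have hx0 : 0 ≤ x := norm_nonneg _
  have nvt : ‖u.v t‖ ≤ 4 * M := (u.norm_v_le t).trans (by linarith)
  have na : ‖a‖ ≤ x + C3 :=
    (norm_add_le _ _).trans (add_le_add le_rfl (hb.norm_christoffel_self_le nvt))
  have nr : ‖r‖ ≤ x + C3 :=
    (norm_add_le _ _).trans (add_le_add le_rfl
      (hb.norm_christoffel_self_le (norm_discVel_le hs hKs hM hk)))
  have nar : ‖a - r‖ ≤ D * s := by
    have e : a - r = G.christoffel (u.c t) (u.v t) (u.v t)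
        - G.christoffel (Y k) (discVel Y K k) (discVel Y K k) := by
      rw [ha, hr, discCov, christoffelCurve]; abel
    rw [e]
    refine (h1 _ _ _ _ nvt (norm_discVel_le hs hKs hM hk)).trans ?_
    rw [← map_sub, ← map_sub]
    have i1 := (hb.norm_emb_apply (u.c t - Y k)).trans (mul_le_mul_of_nonneg_left nc hL)
    have i2 := (hb.norm_emb_apply (u.v t - discVel Y K k)).trans (mul_le_mul_of_nonneg_left nv hL)
    calc C1 * (‖ι (u.c t - Y k)‖ + ‖ι (u.v t - discVel Y K k)‖)
        ≤ C1 * (L * (5 * M * s ^ 2) + L * (2 * M * s)) := by gcongr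
      _ ≤ C1 * (L * (5 * M * s) + L * (2 * M * s)) := by gcongr
      _ = _ := by rw [hD]; ring
  set N := x + C3 with hN
  have hN0 : 0 ≤ N := by positivity
  have e : G.g (u.c t) a a - G.g (Y k) r r
      = (G.g (u.c t) a a - G.g (Y k) a a) + (G.g (Y k) a a - G.g (Y k) r r) := by ring
  rw [e]
  refine (abs_add_le _ _).trans ?_
  have t1 : |G.g (u.c t) a a - G.g (Y k) a a| ≤ L ^ 4 * (5 * M) * s * N ^ 2 := by
    refine (hb.g_sub_le' _ _ _ _).trans ?_
    calc L ^ 4 * ‖u.c t - Y k‖ * ‖a‖ * ‖a‖ ≤ L ^ 4 * (5 * M * s ^ 2) * N * N := by gcongr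
      _ ≤ L ^ 4 * (5 * M * s) * N * N := by gcongr
      _ = _ := by ring
  have t2 : |G.g (Y k) a a - G.g (Y k) r r| ≤ B * D * s * (1 + N ^ 2) := by
    refine (hb.abs_g_self_sub_le ny a r).trans ?_
    calc B * (‖a - r‖ * (‖a‖ + ‖r‖)) ≤ B * (D * s * (N + N)) := by gcongr
      _ = B * D * s * (2 * N) := by ring
      _ ≤ _ := by gcongr; nlinarith [sq_nonneg (N - 1)]
  have t3 : 0 ≤ L ^ 4 * (5 * M) * s := by positivity
  calc |G.g (u.c t) a a - G.g (Y k) a a| + |G.g (Y k) a a - G.g (Y k) r r|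
      ≤ (L ^ 4 * (5 * M) + B * D) * s * (1 + N ^ 2) := by linarith
    _ ≤ (L ^ 4 * (5 * M) + B * D) * s * ((2 + 2 * C3 ^ 2) * (1 + x ^ 2)) := by
      gcongr; exact one_add_sq_le _ _
    _ = _ := by ring

/-- A single summand of the discrete path energy. -/
theorem AdmissibleEnergy.exists_path_summand {G : AdmissibleMetric ι} (A : AdmissibleEnergy G)
    {M : ℝ} (hM0 : 0 ≤ M) : ∃ C : ℝ, 0 ≤ C ∧
    ∀ (s : ℝ) (Y : ℤ → V) (K k : ℕ), 0 < s → K * s ^ 2 = 1 → ‖eta Y K‖ ≤ M → k ≤ K →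
      |K * A.W (Y k) (Y (k + 1)) - s ^ 2 * G.g (Y k) (discVel Y K k) (discVel Y K k)|
        ≤ C * s ^ 4 := by
  obtain ⟨C2, hC2, h2⟩ := A.exists_W_sub_g_le (4 * M + 4 * M)
  refine ⟨C2 * (4 * M) ^ 3, by positivity, fun s Y K k hs hKs hM hk => ?_⟩
  have hs1 := step_le_one hs hKs
  have nb := norm_sub_le_right hs hKs hM hk
  have h := h2 (Y k) (Y (k + 1) - Y k) (add_le_add (norm_node_le hs hKs hM hk)
    (nb.trans (mul_le_of_le_one_right (by positivity) (pow_le_one₀ hs.le hs1))))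
  have eg : G.g (Y k) (Y (k + 1) - Y k) (Y (k + 1) - Y k)
      = s ^ 4 * G.g (Y k) (discVel Y K k) (discVel Y K k) := by
    rw [sub_eq_discVel hs hKs, G.g_smul_smul]; ring
  rw [add_sub_cancel, eg] at h
  have e : K * A.W (Y k) (Y (k + 1)) - s ^ 2 * G.g (Y k) (discVel Y K k) (discVel Y K k)
      = K * (A.W (Y k) (Y (k + 1)) - s ^ 4 * G.g (Y k) (discVel Y K k) (discVel Y K k)) := by
    linear_combination (s ^ 2 * G.g (Y k) (discVel Y K k) (discVel Y K k)) * hKs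
  rw [e, abs_mul, abs_of_nonneg (Nat.cast_nonneg _)]
  calc K * |A.W (Y k) (Y (k + 1)) - s ^ 4 * G.g (Y k) (discVel Y K k) (discVel Y K k)|
      ≤ K * (C2 * (4 * M * s ^ 2) ^ 3) := by
        gcongr
        exact h.trans (by gcongr)
    _ = _ := by linear_combination (C2 * (4 * M) ^ 3 * s ^ 4) * hKs

/-- The path energy density of the interpolation is almost constant on each interval between two
nodes. -/
theorem AdmissibleMetric.exists_path_density (G : AdmissibleMetric ι) {M : ℝ} (hM0 : 0 ≤ M) :
    ∃ C : ℝ, 0 ≤ C ∧ ∀ (s : ℝ) (Y : ℤ → V) (K k : ℕ) (t : ℝ), 0 < s → K * s ^ 2 = 1 →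
      ‖eta Y K‖ ≤ M → k < K → t ∈ Icc (0 : ℝ) 1 → ⌊(K : ℝ) * t⌋ = k →
      |G.g ((eta Y K).c t) ((eta Y K).v t) ((eta Y K).v t)
        - G.g (Y k) (discVel Y K k) (discVel Y K k)| ≤ C * s := by
  obtain ⟨b, L, hb⟩ := G.exists_bounds
  have hL := hb.L_nonneg
  set B := L ^ 4 * (2 + 4 * M) with hB
  have hB0 : 0 ≤ B := by positivity
  refine ⟨L ^ 4 * (4 * M) * (4 * M) ^ 2 + B * (M * (8 * M)), by positivity,
    fun s Y K k t hs hKs hM hk ht hfl => ?_⟩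
  have hs1 := step_le_one hs hKs
  have s2 : s ^ 2 ≤ s := by nlinarith
  have hK := step_pos hs hKs
  have hK' : (0 : ℝ) < K := by exact_mod_cast hK
  set u := eta Y K with hu
  obtain ⟨f1, f2⟩ := Int.floor_eq_iff.1 hfl
  push_cast at f1 f2
  have hkK : (k : ℝ) + 1 ≤ K := by exact_mod_cast hk
  have ny := norm_node_le hs hKs hM hk.le
  have nw := norm_discVel_le hs hKs hM hk.le
  have nvt : ‖u.v t‖ ≤ 4 * M := (u.norm_v_le t).trans (by linarith)
  have i1 : (1 / K : ℝ) = s ^ 2 := inv_eq_step_sq hs hKs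
  have nv : ‖u.v t - discVel Y K k‖ ≤ M * s := by
    have e := (eta_half Y hK k hk).2
    rw [discVel, ← e]
    have h := u.norm_v_sub_sq_le' (((k : ℝ) + 1 / 2) / K) t
    have h3 : |t - ((k : ℝ) + 1 / 2) / K| ≤ s ^ 2 := by
      rw [← i1, show t - ((k : ℝ) + 1 / 2) / K = (K * t - (k + 1 / 2)) / K by field_simp, abs_div,
        abs_of_pos hK']
      gcongr
      exact abs_le.2 ⟨by linarith, by linarith⟩
    refine abs_le_of_sq_le_sq' (h.trans ?_) (by positivity) |>.2
    calc |t - ((k : ℝ) + 1 / 2) / K| * ‖u‖ ^ 2 ≤ s ^ 2 * M ^ 2 := by gcongr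
      _ = _ := by ring
  have nc : ‖u.c t - Y k‖ ≤ 4 * M * s := by
    have e := (eta_node Y hK hk.le).1
    have h := u.norm_c_sub_le (div_mem_Icc hK (by positivity) (by linarith : (k : ℝ) ≤ K)) ht
    have h3 : |t - (k : ℝ) / K| ≤ s ^ 2 := by
      rw [← i1, show t - (k : ℝ) / K = (K * t - k) / K by field_simp, abs_div, abs_of_pos hK']
      gcongr
      exact abs_le.2 ⟨by linarith, by linarith⟩
    have e2 : u.c t - Y k = (u.c t - u.c ((k : ℝ) / K)) + (1 / 8 : ℝ) • secDiff Y k := by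
      rw [hu, e]; abel
    rw [e2]
    refine (norm_add_le _ _).trans ?_
    rw [norm_smul, Real.norm_of_nonneg (by norm_num)]
    have h4 := norm_secDiff_le hs hKs hM hk.le
    have h5 : 2 * M * s ^ 3 ≤ 2 * M * s := by
      gcongr ?_ * ?_
      exact pow_le_of_le_one hs.le hs1 (by norm_num)
    have h6 : 3 * ‖u‖ * |t - (k : ℝ) / K| ≤ 3 * M * s := by
      gcongr; linarith
    nlinarith [mul_nonneg hM0 hs.le]
  have e : G.g (u.c t) (u.v t) (u.v t) - G.g (Y k) (discVel Y K k) (discVel Y K k)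
      = (G.g (u.c t) (u.v t) (u.v t) - G.g (Y k) (u.v t) (u.v t))
        + (G.g (Y k) (u.v t) (u.v t) - G.g (Y k) (discVel Y K k) (discVel Y K k)) := by ring
  rw [e]
  refine (abs_add_le _ _).trans ?_
  have t1 : |G.g (u.c t) (u.v t) (u.v t) - G.g (Y k) (u.v t) (u.v t)|
      ≤ L ^ 4 * (4 * M * s) * (4 * M) * (4 * M) := by
    refine (hb.g_sub_le' _ _ _ _).trans ?_
    gcongr
  have t2 : |G.g (Y k) (u.v t) (u.v t) - G.g (Y k) (discVel Y K k) (discVel Y K k)|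
      ≤ B * (M * s * (4 * M + 4 * M)) := by
    refine (hb.abs_g_self_sub_le ny _ _).trans ?_
    gcongr
  linarith

end RiemSpline
end

noncomputable section

namespace RiemSpline

variable {V Y : Type*} [NormedAddCommGroup V] [InnerProductSpace ℝ V] [CompleteSpace V]
  [NormedAddCommGroup Y] [NormedSpace ℝ Y] {ι : V →L[ℝ] Y}

theorem sum_Icc_one_eq (f : ℕ → ℝ) (N : ℕ) :
    ∑ k ∈ Finset.Icc 1 N, f k = ∑ j ∈ Finset.range N, f (j + 1) := by
  rw [← Finset.Ico_add_one_right_eq_Icc, Finset.sum_Ico_eq_sum_range, Nat.add_sub_cancel]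
  exact Finset.sum_congr rfl fun j _ => by rw [add_comm]

/-- The sum over the auxiliary points agrees with the integral of the step function on the cells,
up to the values at the end points (which cancel in the periodic case). -/
theorem abs_sum_sub_integral_cell_le {bc : BoundaryCondition V} {K : ℕ} (hK : 0 < K) {q : ℤ → ℝ}
    {D : ℝ} (h0 : ¬ IsPeriodic bc → |q 0| ≤ D ∧ |q K| ≤ D) (hper : IsPeriodic bc → q 0 = q K)
    (hD : 0 ≤ D) :
    |(1 / K : ℝ) * ∑ k ∈ Finset.Icc 1 (numAux bc K), q k - ∫ t, q (cell K t) ∂unitMeasure|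
      ≤ (1 / K : ℝ) * D := by
  have hK' : (0 : ℝ) < K := by exact_mod_cast hK
  have e1 : (∑ j ∈ Finset.range K, q j) + q K = q 0 + ∑ j ∈ Finset.range K, q (j + 1) := by
    have a := Finset.sum_range_succ (fun j : ℕ => q j) K
    have b := Finset.sum_range_succ' (fun j : ℕ => q j) K
    push_cast at a b
    linarith
  have e2 := sum_Icc_one_eq (fun k => q k) (numAux bc K)
  push_cast at e2
  rw [integral_cell hK, e2]
  by_cases h : IsPeriodic bc
  · rw [numAux_of_periodic h]
    have : (1 / K : ℝ) * ∑ j ∈ Finset.range K, q (j + 1) - (1 / (2 * K) : ℝ) *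
        (∑ j ∈ Finset.range K, q j + ∑ j ∈ Finset.range K, q (j + 1)) = 0 := by
      rw [show (1 / (2 * K) : ℝ) = (1 / K) * (1 / 2) by ring, mul_assoc, ← mul_sub,
        show ∀ a b : ℝ, a - 1 / 2 * (b + a) = (a - b) / 2 by intros; ring]
      have := hper h
      rw [show ∑ j ∈ Finset.range K, q (j + 1) - ∑ j ∈ Finset.range K, q j = 0 by linarith]
      ring
    rw [this, abs_zero]
    positivity
  · obtain ⟨a0, aK⟩ := h0 h
    obtain ⟨n, rfl⟩ : ∃ n, K = n + 1 := ⟨K - 1, by omega⟩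
    rw [numAux_of_not_periodic h, Nat.add_sub_cancel]
    have e3 := Finset.sum_range_succ (fun j : ℕ => q (j + 1)) n
    push_cast at e1 e3 a0 aK ⊢
    have : (1 / ((n : ℝ) + 1)) * ∑ j ∈ Finset.range n, q (j + 1) - (1 / (2 * ((n : ℝ) + 1))) *
        (∑ j ∈ Finset.range (n + 1), q j + ∑ j ∈ Finset.range (n + 1), q (j + 1))
        = (1 / ((n : ℝ) + 1)) * (-(q 0 + q (n + 1)) / 2) := by
      rw [show (1 / (2 * ((n : ℝ) + 1))) = (1 / ((n : ℝ) + 1)) * (1 / 2) by field_simp, mul_assoc,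
        ← mul_sub]
      congr 1
      linarith
    rw [this, abs_mul, abs_of_nonneg (by positivity : 0 ≤ 1 / ((n : ℝ) + 1))]
    gcongr
    obtain ⟨b1, b2⟩ := abs_le.1 a0
    obtain ⟨b3, b4⟩ := abs_le.1 aK
    exact abs_le.2 ⟨by linarith, by linarith⟩

theorem numAux_le (bc : BoundaryCondition V) (K : ℕ) : numAux bc K ≤ K := by
  cases bc <;> simp [numAux]

theorem norm_discAcc_sq_eq {K : ℕ} (u : W22 V) (Y : ℤ → V) (hu : u = eta Y K) :
    ∫ t, (1 + ‖discAcc Y K (cell K t)‖ ^ 2) ∂unitMeasure = 1 + ‖u.acc‖ ^ 2 := by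
  rw [hu, norm_acc_eta_sq, integral_add (integrable_const _)
    (integrable_cell (fun k => ‖discAcc Y K k‖ ^ 2) K)]
  simp

/-- On bounded sets the discrete spline energy of a discrete path is close to the spline energy of
its interpolation. -/
theorem AdmissibleEnergy.exists_spline_consistency {G : AdmissibleMetric ι}
    (A : AdmissibleEnergy G) {M : ℝ} (hM0 : 0 ≤ M) : ∃ C s₀ : ℝ, 0 ≤ C ∧ 0 < s₀ ∧
    ∀ (s : ℝ) (K : ℕ) (bc : BoundaryCondition V) (p : Fin (K + 1) → V) (m : ℕ → V) (u : W22 V),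
      0 < s → s ≤ s₀ → K * s ^ 2 = 1 → ‖u‖ ≤ M → IsInterp bc p u → IsAux A.W bc p m →
      |discreteSplineEnergy A.W bc p m - G.form u.c (G.covL2 u) (G.covL2 u)| ≤ C * s := by
  obtain ⟨b, L, hb⟩ := G.exists_bounds
  have hL := hb.L_nonneg
  obtain ⟨C1, s₀, hC1, hs₀, h1⟩ := A.exists_spline_summand hM0
  obtain ⟨C2, hC2, h2⟩ := G.exists_spline_density hM0
  set C3 := 2 * L ^ 4 * (4 * M) * (4 * M) / b with hC3
  have hC30 : 0 ≤ C3 := div_nonneg (by positivity) hb.c_pos.le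
  set D := L ^ 4 * (2 + 4 * M) * (C3 * C3) with hD
  have hD0 : 0 ≤ D := by positivity
  refine ⟨(2 * C1 + C2) * (1 + M ^ 2) + D, s₀, by positivity, hs₀,
    fun s K bc p m u hs hss hKs hM hu hm => ?_⟩
  have hs1 := step_le_one hs hKs
  have hK := step_pos hs hKs
  have i1 : (1 / K : ℝ) = s ^ 2 := inv_eq_step_sq hs hKs
  set Y := extNode bc p with hY
  have hue : u = eta Y K := hu.eq_eta hK
  have hMe : ‖eta Y K‖ ≤ M := hue ▸ hM
  set q : ℤ → ℝ := fun k => G.g (Y k) (G.discCov Y K k) (G.discCov Y K k) with hq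
  have hacc : 1 + ‖u.acc‖ ^ 2 ≤ 1 + M ^ 2 := by
    gcongr; exact u.norm_acc_le.trans hM
  -- the sum of the summands
  have p1 : |discreteSplineEnergy A.W bc p m - s ^ 2 * ∑ k ∈ Finset.Icc 1 (numAux bc K), q k|
      ≤ 2 * C1 * (1 + M ^ 2) * s := by
    rw [discreteSplineEnergy, Finset.mul_sum, Finset.mul_sum, ← Finset.sum_sub_distrib]
    have a1 : ∀ k ∈ Finset.Icc 1 (numAux bc K),
        |4 * (K : ℝ) ^ 3 * A.W (node p k) (m k) - s ^ 2 * q k|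
          ≤ C1 * s ^ 3 * (1 + ‖discAcc Y K k‖ ^ 2) := fun k hk => by
      have hk' := Finset.mem_Icc.1 hk
      have hkK : k ≤ K := hk'.2.trans (numAux_le bc K)
      have e1 : Y k = node p k := extNode_natCast bc p hkK
      have e2 : Y (k - 1) = node p (k - 1) := by
        rw [show ((k : ℤ) - 1) = ((k - 1 : ℕ) : ℤ) by omega]
        exact extNode_natCast bc p (by omega)
      have e3 : Y (k + 1) = nextNode bc p k := (nextNode_eq bc p hk).symm
      have := h1 s Y K k (m k) hs hss hKs hMe hkK (by rw [e2, e3]; exact hm k hk)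
      rwa [show A.W (Y k) = A.W (node p k) by rw [e1]] at this
    refine (Finset.abs_sum_le_sum_abs _ _).trans ((Finset.sum_le_sum a1).trans ?_)
    rw [← Finset.mul_sum]
    have a2 : ∑ k ∈ Finset.Icc 1 (numAux bc K), (1 + ‖discAcc Y K k‖ ^ 2)
        ≤ ∑ j ∈ Finset.range K, (1 + ‖discAcc Y K (j + 1)‖ ^ 2) := by
      have := sum_Icc_one_eq (fun k => 1 + ‖discAcc Y K k‖ ^ 2) K
      push_cast at this
      rw [← this]
      refine Finset.sum_le_sum_of_subset_of_nonneg
        (Finset.Icc_subset_Icc_right (numAux_le bc K)) fun _ _ _ => by positivity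
    have a3 := sum_succ_le_integral_cell hK (F := fun k => 1 + ‖discAcc Y K k‖ ^ 2)
      (fun _ => by positivity)
    rw [norm_discAcc_sq_eq u Y hue, i1] at a3
    have a4 := a3.trans (mul_le_mul_of_nonneg_left hacc zero_le_two)
    calc C1 * s ^ 3 * ∑ k ∈ Finset.Icc 1 (numAux bc K), (1 + ‖discAcc Y K k‖ ^ 2)
        ≤ C1 * s ^ 3 * ∑ j ∈ Finset.range K, (1 + ‖discAcc Y K (j + 1)‖ ^ 2) := by gcongr
      _ = C1 * s * (s ^ 2 * ∑ j ∈ Finset.range K, (1 + ‖discAcc Y K (j + 1)‖ ^ 2)) := by ring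
      _ ≤ C1 * s * (2 * (1 + M ^ 2)) := by gcongr
      _ = _ := by ring
  -- the step function
  have p2 : |s ^ 2 * ∑ k ∈ Finset.Icc 1 (numAux bc K), q k - ∫ t, q (cell K t) ∂unitMeasure|
      ≤ D * s := by
    have hqb : ∀ k : ℕ, k ≤ K → secDiff Y k = 0 → |q k| ≤ D := fun k hk h0 => by
      have e : G.discCov Y K k = G.christoffel (Y k) (discVel Y K k) (discVel Y K k) := by
        rw [AdmissibleMetric.discCov, discAcc, h0, smul_zero, zero_add]
      have n1 : ‖G.discCov Y K k‖ ≤ C3 := by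
        rw [e]; exact hb.norm_christoffel_self_le (norm_discVel_le hs hKs hMe hk)
      refine (hb.abs_g_le _ _ _).trans ?_
      have := norm_node_le hs hKs hMe hk
      rw [hD, mul_assoc]
      gcongr
    have := abs_sum_sub_integral_cell_le (bc := bc) hK (q := q) (D := D)
      (fun h => ⟨by simpa using hqb 0 (Nat.zero_le _) (by simpa using secDiff_extNode_zero p hK h),
        hqb K le_rfl (secDiff_extNode_last p hK h)⟩)
      (fun h => by
        have hp := hu.closed' hK h
        have c1 : Y 0 = Y K := by
          have := extNode_natCast bc p (Nat.zero_le K)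
          rw [Nat.cast_zero] at this
          rw [hY, this, extNode_natCast bc p le_rfl, hp]
        have c2 := secDiff_extNode_periodic p hK h hp
        have c3 : Y (0 + 1) = Y (K + 1) := by
          have t1 : Y (0 + 1) = node p 1 := by
            have := extNode_natCast bc p (k := 1) hK
            rwa [Nat.cast_one] at this
          rw [t1, hY, extNode_succ]
          cases bc <;> simp_all [IsPeriodic, rightGhost]
        have c4 : discVel Y K 0 = discVel Y K K := by rw [discVel, discVel, c1, c3]
        have c5 : discAcc Y K 0 = discAcc Y K K := by rw [discAcc, discAcc, c2]
        simp only [hq, AdmissibleMetric.discCov, c1, c4, c5]) hD0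
    rw [i1] at this
    have s2 : s ^ 2 ≤ s := by nlinarith
    rw [mul_comm D s]
    exact this.trans (mul_le_mul_of_nonneg_right s2 hD0)
  have p3 : |∫ t, q (cell K t) ∂unitMeasure - G.form u.c (G.covL2 u) (G.covL2 u)|
      ≤ C2 * (1 + M ^ 2) * s := by
    rw [AdmissibleMetric.form, ← integral_sub (integrable_cell q K) (G.integrable_form_curve u _ _),
      ← Real.norm_eq_abs]
    have hint : Integrable (fun t => C2 * s * (1 + ‖discAcc Y K (cell K t)‖ ^ 2)) unitMeasure :=
      (integrable_cell (fun k => 1 + ‖discAcc Y K k‖ ^ 2) K).const_mul _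
    refine (norm_integral_le_of_norm_le hint ?_).trans ?_
    · filter_upwards [G.covL2_ae u, eta_acc_ae Y (K := K), ae_restrict_mem measurableSet_Ioo]
        with t ht1 ht2 ht
      have hti := Ioo_subset_Icc_self ht
      obtain ⟨k, hk⟩ := Int.eq_ofNat_of_zero_le (cell_mem K hti).1
      have hkK : k ≤ K := by have := (cell_mem K hti).2; omega
      have := h2 s Y K k t hs hKs hMe hkK hti hk
      rw [← hue] at this ht2
      rw [ht1, ht2, Real.norm_eq_abs, abs_sub_comm, hk]
      exact this
    · rw [integral_const_mul, norm_discAcc_sq_eq u Y hue]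
      calc C2 * s * (1 + ‖u.acc‖ ^ 2) ≤ C2 * s * (1 + M ^ 2) := by gcongr
        _ = _ := by ring
  calc |discreteSplineEnergy A.W bc p m - G.form u.c (G.covL2 u) (G.covL2 u)|
      ≤ 2 * C1 * (1 + M ^ 2) * s + D * s + C2 * (1 + M ^ 2) * s := by
        have t1 := abs_le.1 p1
        have t2 := abs_le.1 p2
        have t3 := abs_le.1 p3
        exact abs_le.2 ⟨by linarith, by linarith⟩
    _ = _ := by ring

/-- On bounded sets the discrete path energy of a discrete path is close to the path energy of its
interpolation. -/
theorem AdmissibleEnergy.exists_path_consistency {G : AdmissibleMetric ι}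
    (A : AdmissibleEnergy G) {M : ℝ} (hM0 : 0 ≤ M) : ∃ C : ℝ, 0 ≤ C ∧
    ∀ (s : ℝ) (K : ℕ) (bc : BoundaryCondition V) (p : Fin (K + 1) → V) (u : W22 V),
      0 < s → K * s ^ 2 = 1 → ‖u‖ ≤ M → IsInterp bc p u →
      |discretePathEnergy A.W p - G.form u.c u.vel u.vel| ≤ C * s := by
  obtain ⟨C1, hC1, h1⟩ := A.exists_path_summand hM0
  obtain ⟨C2, hC2, h2⟩ := G.exists_path_density hM0
  refine ⟨C1 + C2, by positivity, fun s K bc p u hs hKs hM hu => ?_⟩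
  have hs1 := step_le_one hs hKs
  have hK := step_pos hs hKs
  have hK' : (0 : ℝ) < K := by exact_mod_cast hK
  have i1 : (1 / K : ℝ) = s ^ 2 := inv_eq_step_sq hs hKs
  set Y := extNode bc p with hY
  have hue : u = eta Y K := hu.eq_eta hK
  have hMe : ‖eta Y K‖ ≤ M := hue ▸ hM
  set q : ℤ → ℝ := fun k => G.g (Y k) (discVel Y K k) (discVel Y K k) with hq
  have p1 : |discretePathEnergy A.W p - ∫ t, q ⌊(K : ℝ) * t⌋ ∂unitMeasure| ≤ C1 * s := by
    rw [integral_comp_floor hK, i1, discretePathEnergy,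
      sum_Icc_one_eq (fun k => A.W (node p (k - 1)) (node p k)), Finset.mul_sum, Finset.mul_sum,
      ← Finset.sum_sub_distrib]
    have a1 : ∀ j ∈ Finset.range K,
        |K * A.W (node p (j + 1 - 1)) (node p (j + 1)) - s ^ 2 * q j| ≤ C1 * s ^ 4 := fun j hj => by
      have hjK := Finset.mem_range.1 hj
      have e1 : Y j = node p (j + 1 - 1) := by
        rw [Nat.add_sub_cancel]; exact extNode_natCast bc p hjK.le
      have e2 : Y (j + 1) = node p (j + 1) := by
        rw [← Nat.cast_succ]; exact extNode_natCast bc p hjK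
      have := h1 s Y K j hs hKs hMe hjK.le
      rwa [e2, show A.W (Y j) = A.W (node p (j + 1 - 1)) by rw [e1]] at this
    refine (Finset.abs_sum_le_sum_abs _ _).trans ((Finset.sum_le_sum a1).trans ?_)
    rw [Finset.sum_const, Finset.card_range, nsmul_eq_mul]
    calc (K : ℝ) * (C1 * s ^ 4) = C1 * s ^ 2 := by linear_combination (C1 * s ^ 2) * hKs
      _ ≤ C1 * s := by gcongr; nlinarith
  have p2 : |∫ t, q ⌊(K : ℝ) * t⌋ ∂unitMeasure - G.form u.c u.vel u.vel| ≤ C2 * s := by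
    have hcell : ∀ t ∈ Ioo (0 : ℝ) 1, ∃ k : ℕ, k < K ∧ ⌊(K : ℝ) * t⌋ = k := fun t ht => by
      have h0 : 0 ≤ ⌊(K : ℝ) * t⌋ := Int.floor_nonneg.2 (mul_pos hK' ht.1).le
      obtain ⟨k, hk⟩ := Int.eq_ofNat_of_zero_le h0
      refine ⟨k, ?_, hk⟩
      have h3 : ⌊(K : ℝ) * t⌋ < (K : ℤ) :=
        Int.floor_lt.2 (by push_cast; exact mul_lt_of_lt_one_right hK' ht.2)
      omega
    have hpt : ∀ᵐ t ∂unitMeasure, |q ⌊(K : ℝ) * t⌋ - G.g (u.c t) (u.vel t) (u.vel t)| ≤ C2 * s := by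
      filter_upwards [u.vel_ae, ae_restrict_mem measurableSet_Ioo] with t ht1 ht
      obtain ⟨k, hk, hfl⟩ := hcell t ht
      have := h2 s Y K k t hs hKs hMe hk (Ioo_subset_Icc_self ht) hfl
      rw [← hue] at this
      rw [ht1, abs_sub_comm, hfl]
      exact this
    have hqi : Integrable (fun t => q ⌊(K : ℝ) * t⌋) unitMeasure := by
      have hm : AEStronglyMeasurable (fun t => q ⌊(K : ℝ) * t⌋) unitMeasure :=
        ((measurable_of_countable q).comp
          (Int.measurable_floor.comp (measurable_const_mul (K : ℝ)))).aestronglyMeasurable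
      refine ((G.integrable_form_curve u u.vel u.vel).norm.add
        (integrable_const (C2 * s))).mono' hm ?_
      filter_upwards [hpt] with t ht
      have := abs_sub_abs_le_abs_sub (q ⌊(K : ℝ) * t⌋) (G.g (u.c t) (u.vel t) (u.vel t))
      simp only [Pi.add_apply, Real.norm_eq_abs]
      linarith
    rw [AdmissibleMetric.form, ← integral_sub hqi (G.integrable_form_curve u _ _),
      ← Real.norm_eq_abs]
    refine (norm_integral_le_of_norm_le (integrable_const (C2 * s)) hpt).trans ?_
    simp
  calc |discretePathEnergy A.W p - G.form u.c u.vel u.vel| ≤ C1 * s + C2 * s := by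
        have t1 := abs_le.1 p1
        have t2 := abs_le.1 p2
        exact abs_le.2 ⟨by linarith, by linarith⟩
    _ = _ := by ring

/-- On bounded sets the discrete regularized spline energy of a discrete path is close to the
regularized spline energy of its interpolation. -/
theorem AdmissibleEnergy.exists_consistency {G : AdmissibleMetric ι} (A : AdmissibleEnergy G)
    (M σ : ℝ) : ∃ e : ℕ → ℝ, Tendsto e atTop (𝓝 0) ∧ ∃ K₀ : ℕ,
    ∀ (K : ℕ) (bc : BoundaryCondition V) (p : Fin (K + 1) → V) (m : ℕ → V) (u : W22 V),
      K₀ ≤ K → ‖u‖ ≤ M → IsInterp bc p u → IsAux A.W bc p m →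
      |discreteSplineEnergy A.W bc p m + σ * discretePathEnergy A.W p - G.energy σ u| ≤ e K := by
  obtain ⟨C1, s₀, hC1, hs₀, h1⟩ := A.exists_spline_consistency (abs_nonneg M)
  obtain ⟨C2, hC2, h2⟩ := A.exists_path_consistency (abs_nonneg M)
  have hlim : Tendsto (fun K : ℕ => √(1 / (K : ℝ))) atTop (𝓝 0) := by
    have := tendsto_one_div_atTop_nhds_zero_nat.sqrt
    rwa [Real.sqrt_zero] at this
  obtain ⟨K₀, hK₀⟩ := eventually_atTop.1 (hlim.eventually (ge_mem_nhds hs₀))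
  refine ⟨fun K => (C1 + |σ| * C2) * √(1 / (K : ℝ)), by simpa using hlim.const_mul (C1 + |σ| * C2),
    K₀ + 1, fun K bc p m u hK hM hu hm => ?_⟩
  have hK' : (0 : ℝ) < K := by exact_mod_cast (show 0 < K by omega)
  have hs : 0 < √(1 / (K : ℝ)) := Real.sqrt_pos.2 (by positivity)
  have hKs : (K : ℝ) * √(1 / (K : ℝ)) ^ 2 = 1 := by
    rw [Real.sq_sqrt (by positivity)]; field_simp
  have t1 := h1 _ K bc p m u hs (hK₀ K (by omega)) hKs (hM.trans (le_abs_self M)) hu hm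
  have t2 := h2 _ K bc p u hs hKs (hM.trans (le_abs_self M)) hu
  have e : discreteSplineEnergy A.W bc p m + σ * discretePathEnergy A.W p - G.energy σ u
      = (discreteSplineEnergy A.W bc p m - G.form u.c (G.covL2 u) (G.covL2 u))
        + σ * (discretePathEnergy A.W p - G.form u.c u.vel u.vel) := by
    rw [AdmissibleMetric.energy]; ring
  rw [e]
  refine (abs_add_le _ _).trans ?_
  simp only [abs_mul, add_mul, mul_assoc |σ|]
  gcongr

end RiemSpline
end

noncomputable section

namespace RiemSpline

variable {V : Type*} [NormedAddCommGroup V] [InnerProductSpace ℝ V] [CompleteSpace V]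

/-! ### Recovery of a Sobolev curve from its nodal values -/

/-- The velocity is Hölder continuous of exponent `1/2`. -/
theorem W22.norm_v_sub_sq_le_of_mem (u : W22 V) {a b r e : ℝ} (hr : r ∈ Icc a b)
    (he : e ∈ Icc a b) :
    ‖u.v r - u.v e‖ ^ 2 ≤ (b - a) * ∫ x in a..b, ‖u.acc.ext0 x‖ ^ 2 := by
  wlog h : e ≤ r generalizing e r
  · rw [norm_sub_rev]; exact this he hr (le_of_not_ge h)
  refine (u.norm_v_sub_sq_le h).trans ?_
  have h1 : 0 ≤ ∫ x in e..r, ‖u.acc.ext0 x‖ ^ 2 :=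
    intervalIntegral.integral_nonneg h fun _ _ => sq_nonneg _
  have h2 : ∫ x in e..r, ‖u.acc.ext0 x‖ ^ 2 ≤ ∫ x in a..b, ‖u.acc.ext0 x‖ ^ 2 :=
    intervalIntegral.integral_mono_interval he.1 h hr.2
      (Eventually.of_forall fun _ => sq_nonneg _) (W22.integrable_ext0_sq _).intervalIntegrable
  have h3 : r - e ≤ b - a := by linarith [he.1, hr.2]
  have h4 : 0 ≤ r - e := sub_nonneg.2 h
  have h5 : 0 ≤ b - a := h4.trans h3
  gcongr

/-- A first-order Taylor estimate for Sobolev curves. -/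
theorem W22.norm_c_sub_smul_v_sq_le (u : W22 V) {a b e : ℝ} (ha : 0 ≤ a) (hb : b ≤ 1)
    (he : e ∈ Icc a b) : ‖u.c b - u.c a - (b - a) • u.v e‖ ^ 2
      ≤ (b - a) ^ 3 * ∫ x in a..b, ‖u.acc.ext0 x‖ ^ 2 := by
  have hab : a ≤ b := he.1.trans he.2
  set J := ∫ x in a..b, ‖u.acc.ext0 x‖ ^ 2 with hJ
  have hJ0 : 0 ≤ J := intervalIntegral.integral_nonneg hab fun _ _ => sq_nonneg _
  have hab0 : 0 ≤ b - a := sub_nonneg.2 hab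
  have e1 : u.c b - u.c a - (b - a) • u.v e = ∫ r in a..b, (u.v r - u.v e) := by
    rw [intervalIntegral.integral_sub (u.continuous_v.intervalIntegrable _ _) (by simp),
      intervalIntegral.integral_const, u.c_sub ⟨ha, hab.trans hb⟩ ⟨ha.trans hab, hb⟩]
  have h1 : ‖∫ r in a..b, (u.v r - u.v e)‖ ≤ √((b - a) * J) * |b - a| := by
    refine intervalIntegral.norm_integral_le_of_norm_le_const fun r hr => ?_
    rw [uIoc_of_le hab] at hr
    exact Real.le_sqrt_of_sq_le (u.norm_v_sub_sq_le_of_mem ⟨hr.1.le, hr.2⟩ he)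
  rw [e1]
  refine (pow_le_pow_left₀ (norm_nonneg _) h1 2).trans_eq ?_
  rw [mul_pow, Real.sq_sqrt (mul_nonneg hab0 hJ0), sq_abs]
  ring

/-- The nodes `Y` interpolate the curve `u` at the times `k / K`. -/
def IsNodal (u : W22 V) (Y : ℤ → V) (K : ℕ) : Prop := ∀ k : ℕ, k ≤ K → Y k = u.c ((k : ℝ) / K)

section Nodal

variable {u : W22 V} {Y : ℤ → V} {K : ℕ} (hY : IsNodal u Y K)

include hY

/-- An inner second difference is `∫₀^τ (u'(t_k + r) - u'(t_{k-1} + r)) dr` with `τ = 1/K`; its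
square is bounded by averages of `‖u''‖²` over intervals of length `τ`, written as a difference so
that the sum over all nodes telescopes. -/
theorem IsNodal.norm_secDiff_sq_le {j : ℕ} (hj : j + 2 ≤ K) :
    ‖secDiff Y (j + 1 : ℕ)‖ ^ 2 ≤ (1 / K : ℝ) ^ 2 *
      ((∫ r in (0 : ℝ)..(1 / K), ∫ x in (0 : ℝ)..(((j + 1 : ℕ) : ℝ) / K + r), ‖u.acc.ext0 x‖ ^ 2)
        - ∫ r in (0 : ℝ)..(1 / K), ∫ x in (0 : ℝ)..((j : ℝ) / K + r), ‖u.acc.ext0 x‖ ^ 2) := by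
  have hK : (0 : ℝ) < K := by exact_mod_cast (show 0 < K by omega)
  have hj' : (j : ℝ) + 2 ≤ K := by exact_mod_cast hj
  set τ : ℝ := 1 / K with hτ
  have hτ0 : 0 < τ := by positivity
  have y0 := hY j (by omega)
  have y1 := hY (j + 1) (by omega)
  have y2 := hY (j + 2) hj
  have m0 := div_mem_Icc (K := K) (by omega) (Nat.cast_nonneg j) (by linarith)
  have m1 := div_mem_Icc (K := K) (by omega) (Nat.cast_nonneg (j + 1)) (by push_cast; linarith)
  have m2 := div_mem_Icc (K := K) (by omega) (Nat.cast_nonneg (j + 2)) (by push_cast; linarith)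
  have s1 : ((j + 1 : ℕ) : ℝ) / K = (j : ℝ) / K + τ := by push_cast; rw [hτ]; ring
  have s2 : ((j + 2 : ℕ) : ℝ) / K = (j : ℝ) / K + τ + τ := by push_cast; rw [hτ]; ring
  rw [s1] at y1 m1 ⊢
  rw [s2] at y2 m2
  set x₀ := (j : ℝ) / K
  have i1 : ((j + 1 : ℕ) : ℤ) + 1 = ((j + 2 : ℕ) : ℤ) := by push_cast; ring
  have i2 : ((j + 1 : ℕ) : ℤ) - 1 = (j : ℤ) := by push_cast; ring
  have cv := u.continuous_v
  have e1 : secDiff Y (j + 1 : ℕ) = ∫ r in (0 : ℝ)..τ, (u.v (x₀ + τ + r) - u.v (x₀ + r)) := by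
    have a1 := u.c_sub m1 m2
    have a0 := u.c_sub m0 m1
    rw [intervalIntegral.integral_sub (Continuous.intervalIntegrable (by fun_prop) _ _)
      (Continuous.intervalIntegrable (by fun_prop) _ _),
      intervalIntegral.integral_comp_add_left, intervalIntegral.integral_comp_add_left, add_zero,
      add_zero, ← a1, ← a0, secDiff, i1, i2, y0, y1, y2]
    module
  set Ψ : ℝ → ℝ := fun t => ∫ x in (0 : ℝ)..t, ‖u.acc.ext0 x‖ ^ 2 with hΨ
  have hint := fun a b : ℝ => (W22.integrable_ext0_sq u.acc).intervalIntegrable (a := a) (b := b)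
  have cΨ : Continuous Ψ := intervalIntegral.continuous_primitive hint 0
  -- the Cauchy-Schwarz inequality with respect to `r`
  have h1 : ‖secDiff Y (j + 1 : ℕ)‖ ^ 2
      ≤ τ * ∫ r in (0 : ℝ)..τ, ‖u.v (x₀ + τ + r) - u.v (x₀ + r)‖ ^ 2 := by
    rw [e1, intervalIntegral.integral_of_le hτ0.le, intervalIntegral.integral_of_le hτ0.le]
    have hm : MemLp (fun r => ‖u.v (x₀ + τ + r) - u.v (x₀ + r)‖) 2 (volume.restrict (Ioc 0 τ)) :=
      MemLp.of_bound (Continuous.aestronglyMeasurable (by fun_prop)) (3 * ‖u‖ + 3 * ‖u‖)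
        (Eventually.of_forall fun r => by
          rw [norm_norm]
          exact (norm_sub_le _ _).trans (add_le_add (u.norm_v_le _) (u.norm_v_le _)))
    have h2 := sq_integral_le hm
    have h3 : (volume.restrict (Ioc 0 τ)).real univ = τ := by
      simp [measureReal_def, ENNReal.toReal_ofReal hτ0.le]
    rw [h3] at h2
    exact (pow_le_pow_left₀ (norm_nonneg _) (norm_integral_le_integral_norm _) 2).trans h2
  have h2 : ∫ r in (0 : ℝ)..τ, ‖u.v (x₀ + τ + r) - u.v (x₀ + r)‖ ^ 2
      ≤ ∫ r in (0 : ℝ)..τ, τ * (Ψ (x₀ + τ + r) - Ψ (x₀ + r)) := by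
    refine intervalIntegral.integral_mono_on hτ0.le
      (Continuous.intervalIntegrable (by fun_prop) _ _)
      (Continuous.intervalIntegrable (by fun_prop) _ _) fun r _ => ?_
    have := u.norm_v_sub_sq_le (s := x₀ + r) (t := x₀ + τ + r) (by linarith)
    rwa [show x₀ + τ + r - (x₀ + r) = τ by ring,
      ← intervalIntegral.integral_interval_sub_left (hint 0 _) (hint 0 _)] at this
  rw [intervalIntegral.integral_const_mul, intervalIntegral.integral_sub
    (Continuous.intervalIntegrable (by fun_prop) _ _)
    (Continuous.intervalIntegrable (by fun_prop) _ _)] at h2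
  refine h1.trans ((mul_le_mul_of_nonneg_left h2 hτ0.le).trans_eq ?_)
  ring

/-- The acceleration of the interpolation of the nodal values does not exceed, in `L²`, the
acceleration of the curve. -/
theorem IsNodal.norm_acc_eta_le (hK : 0 < K) (h0 : secDiff Y 0 = 0) (hl : secDiff Y K = 0) :
    ‖(eta Y K).acc‖ ≤ ‖u.acc‖ := by
  obtain ⟨n, rfl⟩ : ∃ n, K = n + 1 := ⟨K - 1, by omega⟩
  set τ : ℝ := 1 / ((n + 1 : ℕ) : ℝ) with hτ
  have hK' : (0 : ℝ) < ((n + 1 : ℕ) : ℝ) := by positivity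
  have hτ0 : 0 < τ := by positivity
  have hKτ : ((n + 1 : ℕ) : ℝ) * τ = 1 := by rw [hτ]; field_simp
  set a : ℕ → ℝ := fun j => ∫ r in (0 : ℝ)..τ, ∫ x in (0 : ℝ)..((j : ℝ) / ((n + 1 : ℕ) : ℝ) + r),
    ‖u.acc.ext0 x‖ ^ 2 with ha
  have h1 : ∀ j ∈ Finset.range n, ‖discAcc Y (n + 1) (j + 1 : ℕ)‖ ^ 2
      ≤ ((n + 1 : ℕ) : ℝ) ^ 4 * (τ ^ 2 * (a (j + 1) - a j)) := fun j hj => by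
    have := hY.norm_secDiff_sq_le (j := j) (by have := Finset.mem_range.1 hj; omega)
    rw [discAcc, norm_smul, mul_pow, Real.norm_of_nonneg (by positivity), ← pow_mul]
    gcongr
  have h2 := Finset.sum_le_sum h1
  rw [← Finset.mul_sum, ← Finset.mul_sum, Finset.sum_range_sub] at h2
  have hint := fun a b : ℝ => (W22.integrable_ext0_sq u.acc).intervalIntegrable (a := a) (b := b)
  have cΨ : Continuous fun t => ∫ x in (0 : ℝ)..t, ‖u.acc.ext0 x‖ ^ 2 :=
    intervalIntegral.continuous_primitive hint 0
  -- the bounds for the second differences telescope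
  have h3 : a n ≤ τ * ‖u.acc‖ ^ 2 := by
    have : a n ≤ ∫ _ in (0 : ℝ)..τ, ‖u.acc‖ ^ 2 := by
      refine intervalIntegral.integral_mono_on hτ0.le
        (Continuous.intervalIntegrable (cΨ.comp (by fun_prop)) _ _) (by simp) fun r hr => ?_
      exact W22.integral_ext0_sq_le _ (add_nonneg (by positivity) hr.1)
    refine this.trans_eq ?_
    simp
  have h4 : 0 ≤ a 0 := by
    refine intervalIntegral.integral_nonneg hτ0.le fun r hr => ?_
    exact intervalIntegral.integral_nonneg (add_nonneg (by positivity) hr.1) fun _ _ => sq_nonneg _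
  have h5 : ‖(eta Y (n + 1)).acc‖ ^ 2 = τ *
      ∑ j ∈ Finset.range n, ‖discAcc Y (n + 1) (j + 1 : ℕ)‖ ^ 2 := by
    have z0 : discAcc Y (n + 1) 0 = 0 := by rw [discAcc, h0, smul_zero]
    have zl : discAcc Y (n + 1) (n + 1) = 0 := by
      push_cast at hl; rw [discAcc, hl, smul_zero]
    rw [norm_acc_eta_sq, integral_cell hK (fun k => ‖discAcc Y (n + 1) k‖ ^ 2),
      Finset.sum_range_succ', Finset.sum_range_succ, hτ]
    push_cast
    rw [z0, zl, norm_zero]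
    field_simp
    ring
  have h6 : ‖(eta Y (n + 1)).acc‖ ^ 2 ≤ ‖u.acc‖ ^ 2 := by
    rw [h5]
    calc τ * ∑ j ∈ Finset.range n, ‖discAcc Y (n + 1) (j + 1 : ℕ)‖ ^ 2
        ≤ τ * (((n + 1 : ℕ) : ℝ) ^ 4 * (τ ^ 2 * (τ * ‖u.acc‖ ^ 2))) := by
          gcongr
          refine h2.trans ?_
          gcongr
          linarith
      _ = (((n + 1 : ℕ) : ℝ) * τ) ^ 4 * ‖u.acc‖ ^ 2 := by ring
      _ = _ := by rw [hKτ]; ring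
  exact abs_le_of_sq_le_sq' h6 (norm_nonneg _) |>.2

/-- The velocity of the interpolation of the nodal values is uniformly close to the velocity of the
curve. -/
theorem IsNodal.norm_v_eta_sub_le (hK : 0 < K) (h0 : secDiff Y 0 = 0) (hl : secDiff Y K = 0)
    {t : ℝ} (ht : t ∈ Icc (0 : ℝ) 1) : ‖(eta Y K).v t - u.v t‖ ≤ 3 * √(1 / K) * ‖u.acc‖ := by
  have hK' : (0 : ℝ) < K := by exact_mod_cast hK
  set τ : ℝ := 1 / K with hτ
  have hτ0 : 0 < τ := by positivity
  obtain ⟨k, hk, h1, h2⟩ : ∃ k : ℕ, k < K ∧ (k : ℝ) / K ≤ t ∧ t ≤ (k : ℝ) / K + τ := by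
    rcases ht.2.eq_or_lt with rfl | hlt
    · refine ⟨K - 1, by omega, ?_, ?_⟩ <;> rw [Nat.cast_sub hK, Nat.cast_one]
      · rw [div_le_one hK']; linarith
      · rw [hτ, ← add_div, sub_add_cancel, div_self hK'.ne']
    · have htK : 0 ≤ (K : ℝ) * t := mul_nonneg hK'.le ht.1
      refine ⟨⌊(K : ℝ) * t⌋₊, (Nat.floor_lt htK).2 (mul_lt_of_lt_one_right hK' hlt), ?_, ?_⟩
      · rw [div_le_iff₀ hK', mul_comm t]; exact Nat.floor_le htK
      · rw [hτ, ← add_div, le_div_iff₀ hK', mul_comm]; exact (Nat.lt_floor_add_one _).le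
  set a := (k : ℝ) / K with ha
  have ha0 : 0 ≤ a := by positivity
  have hb1 : a + τ ≤ 1 := by
    rw [ha, hτ, ← add_div, div_le_one hK']; exact_mod_cast hk
  set h := ((k : ℝ) + 1 / 2) / K with hh
  have hmem : h ∈ Icc a (a + τ) := by
    have : h = a + τ / 2 := by rw [hh, ha, hτ]; ring
    rw [this]; constructor <;> linarith
  have hJ : ∀ w : W22 V, (∫ x in a..(a + τ), ‖w.acc.ext0 x‖ ^ 2) ≤ ‖w.acc‖ ^ 2 := fun w =>
    W22.integral_ext0_sq_le _ (by linarith)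
  have hv : ∀ w : W22 V, ‖w.v t - w.v h‖ ≤ √τ * ‖w.acc‖ := fun w => by
    have := w.norm_v_sub_sq_le_of_mem ⟨h1, h2⟩ hmem
    rw [add_sub_cancel_left] at this
    refine abs_le_of_sq_le_sq' ?_ (by positivity) |>.2
    rw [mul_pow, Real.sq_sqrt hτ0.le]
    exact this.trans (by gcongr; exact hJ w)
  have hacc := hY.norm_acc_eta_le hK h0 hl
  have h3 := (hv (eta Y K)).trans (mul_le_mul_of_nonneg_left hacc (Real.sqrt_nonneg _))
  have h4 := hv u
  have h5 : ‖(eta Y K).v h - u.v h‖ ≤ √τ * ‖u.acc‖ := by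
    have e1 := (eta_half Y hK k hk).2
    have y1 := hY (k + 1) hk
    have y0 := hY k hk.le
    have e2 : ((k + 1 : ℕ) : ℝ) / K = a + τ := by rw [ha, hτ]; push_cast; ring
    rw [e2] at y1
    push_cast at y1
    have h6 := u.norm_c_sub_smul_v_sq_le ha0 hb1 hmem
    rw [add_sub_cancel_left] at h6
    have e3 : (eta Y K).v h - u.v h = (K : ℝ) • (u.c (a + τ) - u.c a - τ • u.v h) := by
      rw [e1, y1, y0, smul_sub (K : ℝ) _ (τ • u.v h), smul_smul, hτ, mul_one_div_cancel hK'.ne',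
        one_smul]
    refine abs_le_of_sq_le_sq' ?_ (by positivity) |>.2
    rw [e3, norm_smul, Real.norm_of_nonneg hK'.le, mul_pow, mul_pow, Real.sq_sqrt hτ0.le]
    calc (K : ℝ) ^ 2 * ‖u.c (a + τ) - u.c a - τ • u.v h‖ ^ 2
        ≤ (K : ℝ) ^ 2 * (τ ^ 3 * ‖u.acc‖ ^ 2) := by
          gcongr
          refine h6.trans ?_
          gcongr
          exact hJ u
      _ = ((K : ℝ) * τ) ^ 2 * (τ * ‖u.acc‖ ^ 2) := by ring
      _ = _ := by rw [hτ, mul_one_div_cancel hK'.ne']; ring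
  have e : (eta Y K).v t - u.v t
      = ((eta Y K).v t - (eta Y K).v h) + ((eta Y K).v h - u.v h) - (u.v t - u.v h) := by abel
  rw [e]
  refine (norm_sub_le _ _).trans ((add_le_add (norm_add_le _ _) le_rfl).trans ?_)
  linarith

end Nodal

end RiemSpline
end

noncomputable section

namespace RiemSpline

variable {V : Type*} [NormedAddCommGroup V] [InnerProductSpace ℝ V] [CompleteSpace V]

/-- An `L²` function whose primitive vanishes is zero. -/
theorem L2.eq_zero_of_prim {h : L2 V} (h0 : ∀ t ∈ Icc (0 : ℝ) 1, h.prim t = 0) : h = 0 := by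
  have hz : ∀ t ∈ Icc (0 : ℝ) 1, (W22.ofAcc 0 0 h).v t = 0 := fun t ht => by
    rw [W22.v, W22.vel0_ofAcc, W22.acc_ofAcc, h0 t ht, add_zero]
  have hc : ∀ t ∈ Icc (0 : ℝ) 1, (W22.ofAcc 0 0 h).c t = 0 := fun t ht => by
    rw [W22.c_eq_integral _ ht, W22.pos0_ofAcc, zero_add]
    rw [intervalIntegral.integral_congr (g := fun _ => (0 : V)) fun r hr => ?_]
    · simp
    · rw [uIcc_of_le ht.1] at hr
      exact hz r ⟨hr.1, hr.2.trans ht.2⟩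
  have e : W22.ofAcc 0 0 h = 0 := by
    refine W22.ext_of_curve ((W22.curve_ae _).trans ?_)
    have : (0 : W22 V).curve =ᵐ[unitMeasure] (0 : ℝ → V) := Lp.coeFn_zero V 2 unitMeasure
    refine EventuallyEq.trans ?_ this.symm
    filter_upwards [ae_restrict_mem measurableSet_Ioo] with t ht
    exact hc t (Ioo_subset_Icc_self ht)
  calc h = (W22.ofAcc 0 0 h).acc := rfl
    _ = (0 : W22 V).acc := by rw [e]
    _ = 0 := rfl

/-- If the norms do not exceed that of the limit and the primitives converge pointwise, then a
sequence in `L²` converges strongly. -/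
theorem L2.tendsto_of_prim {f : L2 V} {fn : ℕ → L2 V} (hn : ∀ n, ‖fn n‖ ≤ ‖f‖)
    (hp : ∀ t ∈ Icc (0 : ℝ) 1, Tendsto (fun n => (fn n).prim t) atTop (𝓝 (f.prim t))) :
    Tendsto fn atTop (𝓝 f) := by
  -- the functions against which the sequence converges weakly
  let S : Submodule ℝ (L2 V) :=
    { carrier := {h | Tendsto (fun n => inner ℝ h (fn n - f)) atTop (𝓝 0)}
      add_mem' := fun {a b} ha hb => by
        have := Tendsto.add ha hb
        simpa [inner_add_left] using this
      zero_mem' := by simp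
      smul_mem' := fun c a ha => by
        have := Tendsto.const_mul c ha
        simpa [inner_smul_left] using this }
  have hclosed : IsClosed (S : Set (L2 V)) := by
    refine isClosed_of_closure_subset fun h hh => ?_
    change Tendsto (fun n => inner ℝ h (fn n - f)) atTop (𝓝 0)
    rw [Metric.tendsto_atTop]
    intro ε hε
    obtain ⟨h', hh', hd⟩ := Metric.mem_closure_iff.1 hh (ε / 2 / (2 * ‖f‖ + 1)) (by positivity)
    obtain ⟨N, hN⟩ := Metric.tendsto_atTop.1
      (show Tendsto (fun n => inner ℝ h' (fn n - f)) atTop (𝓝 0) from hh') (ε / 2) (half_pos hε)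
    refine ⟨N, fun n hnN => ?_⟩
    have h1 := hN n hnN
    rw [dist_zero_right] at h1 ⊢
    have e : inner ℝ h (fn n - f) = inner ℝ (h - h') (fn n - f) + inner ℝ h' (fn n - f) := by
      rw [inner_sub_left]; ring
    rw [e]
    have h2 : ‖fn n - f‖ ≤ 2 * ‖f‖ + 1 := (norm_sub_le _ _).trans (by linarith [hn n])
    have h3 : ‖inner ℝ (h - h') (fn n - f)‖ ≤ ε / 2 := by
      refine (norm_inner_le_norm _ _).trans ?_
      rw [dist_eq_norm] at hd
      calc ‖h - h'‖ * ‖fn n - f‖ ≤ ε / 2 / (2 * ‖f‖ + 1) * (2 * ‖f‖ + 1) := by gcongr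
        _ = ε / 2 := by field_simp
    exact (norm_add_le _ _).trans_lt (by linarith)
  have hind : ∀ t ∈ Icc (0 : ℝ) 1, ∀ w : V,
      ∀ g : L2 V, inner ℝ (indicatorConstLp 2 (measurableSet_Ioc : MeasurableSet (Ioc 0 t))
        (measure_ne_top unitMeasure _) w) g = inner ℝ w (g.prim t) := fun t ht w g => by
    rw [L2.inner_indicatorConstLp_eq_inner_setIntegral, prim, intervalIntegral.integral_of_le ht.1,
      Measure.restrict_restrict measurableSet_Ioc]
    congr 1
    rw [inter_comm, ← Measure.restrict_restrict measurableSet_Ioo,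
      ← integral_indicator measurableSet_Ioo]
    rfl
  -- `S` is closed and contains the step functions, which are dense
  have horth : Sᗮ = ⊥ := by
    rw [Submodule.eq_bot_iff]
    intro h hh
    refine L2.eq_zero_of_prim fun t ht => ?_
    have hmem : indicatorConstLp 2 (measurableSet_Ioc : MeasurableSet (Ioc 0 t))
        (measure_ne_top unitMeasure _) (h.prim t) ∈ S := by
      change Tendsto _ _ _
      have e : ∀ n, (fn n - f).prim t = (fn n).prim t - f.prim t := fun n =>
        map_sub (primL (V := V) t) (fn n) f
      simp only [hind t ht, e, inner_sub_right]
      have := (Filter.Tendsto.inner (𝕜 := ℝ) (tendsto_const_nhds (x := h.prim t))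
        (hp t ht)).sub_const (inner ℝ (h.prim t) (f.prim t))
      simpa using this
    have := (Submodule.mem_orthogonal S h).1 hh _ hmem
    rw [hind t ht] at this
    exact inner_self_eq_zero.1 this
  have htop : S = ⊤ := by
    rw [← hclosed.submodule_topologicalClosure_eq]
    exact Submodule.topologicalClosure_eq_top_iff.2 horth
  have hf : Tendsto (fun n => inner ℝ f (fn n - f)) atTop (𝓝 0) := by
    have : f ∈ S := htop ▸ Submodule.mem_top
    exact this
  -- weak convergence without gain of norm is strong convergence
  have hsq : Tendsto (fun n => ‖fn n - f‖ ^ 2) atTop (𝓝 0) := by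
    refine squeeze_zero (fun _ => sq_nonneg _) (fun n => ?_)
      (by simpa using hf.const_mul (-2 : ℝ))
    have h1 := norm_sub_sq_real (fn n) f
    have h2 : ‖fn n‖ ^ 2 ≤ ‖f‖ ^ 2 := by gcongr; exact hn n
    rw [inner_sub_right, real_inner_self_eq_norm_sq, real_inner_comm]
    linarith
  rw [tendsto_iff_norm_sub_tendsto_zero]
  simpa using hsq.sqrt

theorem W22.pos0_sub (u w : W22 V) : (u - w).pos0 = u.pos0 - w.pos0 := by
  rw [← c_zero, ← c_zero u, ← c_zero w]; exact map_sub (evalC (V := V) 0) u w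

theorem W22.vel0_sub (u w : W22 V) : (u - w).vel0 = u.vel0 - w.vel0 := by
  rw [← v_zero, ← v_zero u, ← v_zero w]; exact map_sub (evalV (V := V) 0) u w

theorem W22.acc_sub (u w : W22 V) : (u - w).acc = u.acc - w.acc := rfl

theorem W22.tendsto_of_data {x : ℕ → W22 V} {u : W22 V}
    (h0 : Tendsto (fun n => (x n).pos0) atTop (𝓝 u.pos0))
    (h1 : Tendsto (fun n => (x n).vel0) atTop (𝓝 u.vel0))
    (h2 : Tendsto (fun n => (x n).acc) atTop (𝓝 u.acc)) : Tendsto x atTop (𝓝 u) := by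
  rw [tendsto_iff_norm_sub_tendsto_zero] at h0 h1 h2 ⊢
  refine squeeze_zero (fun _ => norm_nonneg _) (fun n => (x n - u).norm_le_data) ?_
  simp only [pos0_sub, vel0_sub, acc_sub]
  simpa using (h0.add (h1.const_mul 2)).add (h2.const_mul 3)

theorem W22.ext_of_data {u w : W22 V} (h0 : u.pos0 = w.pos0) (h1 : u.vel0 = w.vel0)
    (h2 : u.acc = w.acc) : u = w := by
  have := (u - w).norm_le_data
  rw [pos0_sub, vel0_sub, acc_sub, h0, h1, h2] at this
  simp only [sub_self, norm_zero, mul_zero, add_zero] at this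
  exact sub_eq_zero.1 (norm_le_zero_iff.1 this)

/-- The interpolations of the nodal values, extended linearly beyond the end points, converge
strongly. -/
theorem tendsto_eta_nodal {u : W22 V} {κ : ℕ → ℕ} (hκ : ∀ n, 0 < κ n) (hκ' : Tendsto κ atTop atTop)
    {Y : ℕ → ℤ → V} (hY : ∀ n, IsNodal u (Y n) (κ n)) (h0 : ∀ n, secDiff (Y n) 0 = 0)
    (hl : ∀ n, secDiff (Y n) (κ n) = 0) :
    Tendsto (fun n => eta (Y n) (κ n)) atTop (𝓝 u) := by
  have hv : ∀ t ∈ Icc (0 : ℝ) 1,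
      Tendsto (fun n => (eta (Y n) (κ n)).v t) atTop (𝓝 (u.v t)) := fun t ht => by
    rw [tendsto_iff_norm_sub_tendsto_zero]
    have h1 : Tendsto (fun n => 3 * √(1 / (κ n : ℝ)) * ‖u.acc‖) atTop (𝓝 0) := by
      have := ((tendsto_one_div_atTop_nhds_zero_nat.comp hκ').sqrt.const_mul 3).mul_const ‖u.acc‖
      simpa [Function.comp_def] using this
    exact squeeze_zero (fun _ => norm_nonneg _)
      (fun n => (hY n).norm_v_eta_sub_le (hκ n) (h0 n) (hl n) ht) h1
  have hv0 := hv 0 (left_mem_Icc.2 zero_le_one)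
  simp only [W22.v_zero] at hv0
  refine W22.tendsto_of_data ?_ hv0 ?_
  · have : ∀ n, (eta (Y n) (κ n)).pos0 = u.pos0 := fun n => by
      have h1 := hY n 0 (Nat.zero_le _)
      rw [Nat.cast_zero, Nat.cast_zero, zero_div, W22.c_zero] at h1
      rw [← W22.c_zero, (eta_zero (Y n)).1, h0 n, smul_zero, add_zero, h1]
    simp only [this]
    exact tendsto_const_nhds
  · refine L2.tendsto_of_prim (fun n => (hY n).norm_acc_eta_le (hκ n) (h0 n) (hl n)) fun t ht => ?_
    have h1 : ∀ w : W22 V, w.acc.prim t = w.v t - w.vel0 := fun w => by simp [W22.v]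
    simp only [h1]
    exact (hv t ht).sub hv0

theorem secDiff_sub (Y Z : ℤ → V) (k : ℤ) : secDiff (Y - Z) k = secDiff Y k - secDiff Z k := by
  simp only [secDiff, Pi.sub_apply]; module

theorem eta_sub (Y Z : ℤ → V) (K : ℕ) : eta (Y - Z) K = eta Y K - eta Z K := by
  refine W22.ext_of_data ?_ ?_ ?_
  · rw [W22.pos0_sub, ← W22.c_zero, ← W22.c_zero, ← W22.c_zero, (eta_zero _).1, (eta_zero _).1,
      (eta_zero _).1, secDiff_sub, Pi.sub_apply]
    module
  · rw [W22.vel0_sub, ← W22.v_zero, ← W22.v_zero, ← W22.v_zero, (eta_zero _).2, (eta_zero _).2,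
      (eta_zero _).2, secDiff_sub, Pi.sub_apply, Pi.sub_apply]
    module
  · rw [W22.acc_sub]
    refine Lp.ext ?_
    filter_upwards [eta_acc_ae (Y - Z) (K := K), eta_acc_ae Y (K := K), eta_acc_ae Z (K := K),
      Lp.coeFn_sub (eta Y K).acc (eta Z K).acc] with t h1 h2 h3 h4
    rw [h4, Pi.sub_apply, h1, h2, h3, secDiff_sub, smul_sub]

/-- The interpolation of a small perturbation of the nodes is small. -/
theorem norm_eta_le {D : ℤ → V} {K : ℕ} {s a : ℝ} (hs : 0 < s) (hKs : K * s ^ 2 = 1) (ha : 0 ≤ a)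
    (h0 : D 0 = 0) (h1 : ‖D 1‖ ≤ s ^ 3 * a)
    (hS : ∑ k ∈ Finset.range (K + 1), ‖secDiff D k‖ ^ 2 ≤ (s ^ 3 * a) ^ 2) :
    ‖eta D K‖ ≤ 7 * a := by
  have hs1 := step_le_one hs hKs
  have hK := step_pos hs hKs
  have i1 : (1 / K : ℝ) = s ^ 2 := inv_eq_step_sq hs hKs
  have hz : ‖secDiff D 0‖ ≤ s ^ 3 * a := by
    have := Finset.single_le_sum (f := fun k : ℕ => ‖secDiff D k‖ ^ 2) (fun _ _ => sq_nonneg _)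
      (Finset.mem_range.2 (show 0 < K + 1 by omega))
    exact abs_le_of_sq_le_sq' ((by simpa using this : ‖secDiff D 0‖ ^ 2 ≤ _).trans hS)
      (by positivity) |>.2
  have s3 : s ^ 3 * a ≤ a := mul_le_of_le_one_left ha (pow_le_one₀ hs.le hs1)
  have p0 : ‖(eta D K).pos0‖ ≤ 1 / 8 * a := by
    rw [← W22.c_zero, (eta_zero D).1, h0, zero_add, norm_smul, Real.norm_of_nonneg (by norm_num)]
    gcongr
    exact hz.trans s3
  have p1 : ‖(eta D K).vel0‖ ≤ 3 / 2 * a := by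
    have e : (D 0 - D (-1)) + (1 / 2 : ℝ) • secDiff D 0 = D 1 - (1 / 2 : ℝ) • secDiff D 0 := by
      simp only [secDiff, h0, zero_add, zero_sub]; module
    rw [← W22.v_zero, (eta_zero D).2, e, norm_smul, Real.norm_of_nonneg (Nat.cast_nonneg _)]
    have h2 : ‖D 1 - (1 / 2 : ℝ) • secDiff D 0‖ ≤ 3 / 2 * (s ^ 3 * a) := by
      refine (norm_sub_le _ _).trans ?_
      rw [norm_smul, Real.norm_of_nonneg (by norm_num)]
      linarith
    calc K * ‖D 1 - (1 / 2 : ℝ) • secDiff D 0‖ ≤ K * (3 / 2 * (s ^ 3 * a)) := by gcongr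
      _ = (K * s ^ 2) * (3 / 2 * (s * a)) := by ring
      _ ≤ _ := by rw [hKs, one_mul]; gcongr; exact mul_le_of_le_one_left ha hs1
  have p2 : ‖(eta D K).acc‖ ≤ a := by
    refine abs_le_of_sq_le_sq' ?_ ha |>.2
    rw [norm_acc_eta_sq, integral_cell hK fun k => ‖discAcc D K k‖ ^ 2]
    have b1 : ∑ j ∈ Finset.range K, ‖discAcc D K j‖ ^ 2
        ≤ ∑ k ∈ Finset.range (K + 1), ‖discAcc D K k‖ ^ 2 := by
      rw [Finset.sum_range_succ]; linarith [sq_nonneg ‖discAcc D K K‖]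
    have b2 : ∑ j ∈ Finset.range K, ‖discAcc D K (j + 1)‖ ^ 2
        ≤ ∑ k ∈ Finset.range (K + 1), ‖discAcc D K k‖ ^ 2 := by
      rw [Finset.sum_range_succ']; push_cast; linarith [sq_nonneg ‖discAcc D K 0‖]
    have b3 : ∑ k ∈ Finset.range (K + 1), ‖discAcc D K k‖ ^ 2
        = (K : ℝ) ^ 4 * ∑ k ∈ Finset.range (K + 1), ‖secDiff D k‖ ^ 2 := by
      rw [Finset.mul_sum]
      refine Finset.sum_congr rfl fun k _ => ?_
      rw [discAcc, norm_smul, mul_pow, Real.norm_of_nonneg (by positivity), ← pow_mul]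
    rw [b3] at b1 b2
    have b4 : (1 / (2 * K) : ℝ) = s ^ 2 / 2 := by rw [← i1]; ring
    rw [b4]
    calc s ^ 2 / 2 * (∑ j ∈ Finset.range K, ‖discAcc D K j‖ ^ 2
          + ∑ j ∈ Finset.range K, ‖discAcc D K (j + 1)‖ ^ 2)
        ≤ s ^ 2 / 2 * ((K : ℝ) ^ 4 * (s ^ 3 * a) ^ 2 + (K : ℝ) ^ 4 * (s ^ 3 * a) ^ 2) := by
          gcongr
          · exact b1.trans (by gcongr)
          · exact b2.trans (by gcongr)
      _ = (K * s ^ 2) ^ 4 * a ^ 2 := by ring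
      _ = a ^ 2 := by rw [hKs]; ring
  linarith [(eta D K).norm_le_data]

end RiemSpline
end

noncomputable section

namespace RiemSpline

variable {V : Type*} [NormedAddCommGroup V] [InnerProductSpace ℝ V] [CompleteSpace V]

/-! ### Recovery sequences -/

/-- The acceleration near the end points of the unit interval. -/
def W22.edge (u : W22 V) (τ : ℝ) : ℝ :=
  (∫ x in (0 : ℝ)..τ, ‖u.acc.ext0 x‖ ^ 2) + ∫ x in (1 - τ)..1, ‖u.acc.ext0 x‖ ^ 2

theorem W22.tendsto_edge (u : W22 V) : Tendsto u.edge (𝓝 0) (𝓝 0) := by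
  have hint := fun a b : ℝ => (W22.integrable_ext0_sq u.acc).intervalIntegrable (a := a) (b := b)
  have h1 : Continuous fun t => ∫ x in (0 : ℝ)..t, ‖u.acc.ext0 x‖ ^ 2 :=
    intervalIntegral.continuous_primitive hint 0
  have h2 : Continuous fun t => ∫ x in t..(1 : ℝ), ‖u.acc.ext0 x‖ ^ 2 := by
    have : (fun t => ∫ x in t..(1 : ℝ), ‖u.acc.ext0 x‖ ^ 2)
        = fun t => -∫ x in (1 : ℝ)..t, ‖u.acc.ext0 x‖ ^ 2 := by
      ext t; rw [intervalIntegral.integral_symm]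
    rw [this]
    exact (intervalIntegral.continuous_primitive hint 1).neg
  have h3 : Continuous u.edge := h1.add (h2.comp (continuous_const.sub continuous_id))
  have := h3.tendsto 0
  simpa [edge] using this

theorem W22.edge_left_sq_le (u : W22 V) {τ : ℝ} (h0 : 0 ≤ τ) (h1 : τ ≤ 1) :
    ‖u.c τ - u.c 0 - τ • u.v 0‖ ^ 2 ≤ τ ^ 3 * ∫ x in (0 : ℝ)..τ, ‖u.acc.ext0 x‖ ^ 2 := by
  have := u.norm_c_sub_smul_v_sq_le le_rfl h1 (left_mem_Icc.2 h0)
  rwa [sub_zero] at this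

theorem W22.edge_right_sq_le (u : W22 V) {τ : ℝ} (h0 : 0 ≤ τ) (h1 : τ ≤ 1) :
    ‖u.c 1 - u.c (1 - τ) - τ • u.v 1‖ ^ 2 ≤ τ ^ 3 * ∫ x in (1 - τ)..1, ‖u.acc.ext0 x‖ ^ 2 := by
  have := u.norm_c_sub_smul_v_sq_le (a := 1 - τ) (b := 1) (by linarith) le_rfl
    (right_mem_Icc.2 (by linarith))
  rwa [sub_sub_cancel] at this

/-- The nodal values of a curve, where in the Hermite case the second and the last but one are
modified so as to satisfy the discrete boundary condition. -/
def recoveryNodes (bc : BoundaryCondition V) (u : W22 V) (K : ℕ) (k : Fin (K + 1)) : V :=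
  match bc with
  | .hermite v₀ v₁ =>
      if (k : ℕ) = 1 then u.c 0 + (1 / K : ℝ) • v₀
      else if (k : ℕ) + 1 = K then u.c 1 - (1 / K : ℝ) • v₁
      else u.c ((k : ℝ) / K)
  | _ => u.c ((k : ℝ) / K)

section

variable (u : W22 V) {K : ℕ}

theorem node_eq {p : Fin (K + 1) → V} {k : ℕ} (hk : k ≤ K) : node p k = p ⟨k, by omega⟩ := by
  rw [← node_val p ⟨k, by omega⟩]

theorem node_recoveryNodes_natural {k : ℕ} (hk : k ≤ K) :
    node (recoveryNodes .natural u K) k = u.c ((k : ℝ) / K) := node_eq hk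

theorem node_recoveryNodes_periodic {k : ℕ} (hk : k ≤ K) :
    node (recoveryNodes .periodic u K) k = u.c ((k : ℝ) / K) := node_eq hk

theorem node_recoveryNodes_hermite {v₀ v₁ : V} {k : ℕ} (hk : k ≤ K) :
    node (recoveryNodes (.hermite v₀ v₁) u K) k = if k = 1 then u.c 0 + (1 / K : ℝ) • v₀
      else if k + 1 = K then u.c 1 - (1 / K : ℝ) • v₁ else u.c ((k : ℝ) / K) := node_eq hk

variable (K) in
/-- The extension of the nodal values of `u` by the natural boundary condition. -/
def nodalExt : ℤ → V := extNode .natural (recoveryNodes .natural u K)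

theorem isNodal_nodalExt : IsNodal u (nodalExt u K) K := fun k hk => by
  rw [nodalExt, extNode_natCast _ _ hk, node_recoveryNodes_natural u hk]

theorem secDiff_nodalExt_zero (hK : 0 < K) : secDiff (nodalExt u K) 0 = 0 :=
  secDiff_extNode_zero _ hK id

theorem secDiff_nodalExt_last (hK : 0 < K) : secDiff (nodalExt u K) K = 0 :=
  secDiff_extNode_last _ hK id

/-- In the periodic case, the recovery nodes differ from the naturally extended nodal values only in
the ghost nodes. -/
theorem norm_eta_recovery_periodic_le {s : ℝ} (hs : 0 < s) (hKs : K * s ^ 2 = 1)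
    (hc : u.c 0 = u.c 1) (hv : u.v 0 = u.v 1) :
    ‖eta (extNode .periodic (recoveryNodes .periodic u K)) K - eta (nodalExt u K) K‖
      ≤ 7 * √(18 * u.edge (s ^ 2)) := by
  have hs1 := step_le_one hs hKs
  have hK := step_pos hs hKs
  have hK' : (0 : ℝ) < K := by exact_mod_cast hK
  have i1 : (1 / K : ℝ) = s ^ 2 := inv_eq_step_sq hs hKs
  have s21 : s ^ 2 ≤ 1 := pow_le_one₀ hs.le hs1
  set p := recoveryNodes .periodic u K
  set Y := extNode .periodic p with hY
  have hn : ∀ k : ℕ, k ≤ K → Y k = u.c ((k : ℝ) / K) := fun k hk => by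
    rw [hY, extNode_natCast _ _ hk, node_recoveryNodes_periodic u hk]
  have h1 : ∀ k : ℕ, k ≤ K → (Y - nodalExt u K) k = 0 := fun k hk => by
    rw [Pi.sub_apply, hn k hk, isNodal_nodalExt u k hk, sub_self]
  have hp : node p 0 = node p K := by
    rw [node_recoveryNodes_periodic u (Nat.zero_le _), node_recoveryNodes_periodic u le_rfl,
      div_self hK'.ne', Nat.cast_zero, zero_div, hc]
  have hlast := secDiff_extNode_periodic p hK (bc := .periodic) trivial hp
  -- the second difference across the closing point is a difference of two Taylor remainders,
  -- because the velocities at `0` and `1` agree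
  have e0 : secDiff Y 0 = (u.c (s ^ 2) - u.c 0 - s ^ 2 • u.v 0)
      - (u.c 1 - u.c (1 - s ^ 2) - s ^ 2 • u.v 1) := by
    have a1 : Y 1 = u.c (s ^ 2) := by
      have := hn 1 hK
      rwa [Nat.cast_one, Nat.cast_one, i1] at this
    have a0 : Y 0 = u.c 0 := by
      have := hn 0 (Nat.zero_le _)
      rwa [Nat.cast_zero, Nat.cast_zero, zero_div] at this
    have a2 : Y (-1) = u.c (1 - s ^ 2) := by
      have h2 : Y (-1) = node p (K - 1) := extNode_neg_one _ _
      rw [h2, node_recoveryNodes_periodic u (Nat.sub_le _ _), Nat.cast_sub hK, Nat.cast_one,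
        sub_div, div_self hK'.ne', i1]
    rw [secDiff, zero_add, zero_sub, a1, a0, a2, ← hc, ← hv]
    module
  have n0 : ‖secDiff Y 0‖ ^ 2 ≤ 2 * (s ^ 6 * u.edge (s ^ 2)) := by
    have b1 := u.edge_left_sq_le (sq_nonneg s) s21
    have b2 := u.edge_right_sq_le (sq_nonneg s) s21
    rw [e0]
    have b3 := norm_sub_le (u.c (s ^ 2) - u.c 0 - s ^ 2 • u.v 0)
      (u.c 1 - u.c (1 - s ^ 2) - s ^ 2 • u.v 1)
    refine (pow_le_pow_left₀ (norm_nonneg _) b3 2).trans (add_sq_le.trans ?_)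
    rw [W22.edge]
    nlinarith
  have hedge : 0 ≤ u.edge (s ^ 2) := by
    have := (sq_nonneg _).trans n0
    have h6 : 0 < s ^ 6 := by positivity
    by_contra hneg
    nlinarith [mul_neg_of_pos_of_neg h6 (not_le.1 hneg)]
  rw [← eta_sub]
  refine norm_eta_le hs hKs (Real.sqrt_nonneg _) (by simpa using h1 0 (Nat.zero_le _)) ?_ ?_
  · have := h1 1 hK
    rw [Nat.cast_one] at this
    rw [this, norm_zero]
    positivity
  · rw [mul_pow, Real.sq_sqrt (by positivity)]
    have a1 : ∀ k ∈ Finset.range (K + 1), ‖secDiff (Y - nodalExt u K) k‖ ^ 2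
        ≤ (if k = 0 then ‖secDiff Y 0‖ ^ 2 else 0) + (if k = K then ‖secDiff Y 0‖ ^ 2 else 0) :=
      fun k hk => by
        have hkK := Finset.mem_range.1 hk
        rcases Nat.eq_zero_or_pos k with rfl | hk0
        · rw [secDiff_sub, Nat.cast_zero, secDiff_nodalExt_zero u hK, sub_zero, if_pos rfl]
          split_ifs <;> simp
        · rw [if_neg hk0.ne']
          rcases (Nat.lt_succ_iff.1 hkK).eq_or_lt with rfl | hlt
          · rw [secDiff_sub, secDiff_nodalExt_last u hK, sub_zero, if_pos rfl, ← hlast, zero_add]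
          · have i2 : ((k : ℤ) - 1) = ((k - 1 : ℕ) : ℤ) := by omega
            have i3 : ((k : ℤ) + 1) = ((k + 1 : ℕ) : ℤ) := by omega
            rw [if_neg hlt.ne, secDiff, i2, i3, h1 _ (by omega), h1 _ (by omega), h1 _ (by omega)]
            simp
    refine (Finset.sum_le_sum a1).trans ?_
    rw [Finset.sum_add_distrib, Finset.sum_ite_eq', Finset.sum_ite_eq', if_pos (by simp),
      if_pos (by simp)]
    nlinarith [mul_nonneg (by positivity : 0 ≤ s ^ 6) hedge]

theorem norm_secDiff_sq_le_add (D : ℤ → V) (k : ℤ) :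
    ‖secDiff D k‖ ^ 2 ≤ 3 * (‖D (k + 1)‖ ^ 2 + 4 * ‖D k‖ ^ 2 + ‖D (k - 1)‖ ^ 2) := by
  have h : ‖secDiff D k‖ ≤ ‖D (k + 1)‖ + 2 * ‖D k‖ + ‖D (k - 1)‖ := by
    refine (norm_add_le _ _).trans (add_le_add ((norm_sub_le _ _).trans ?_) le_rfl)
    rw [norm_smul, Real.norm_of_nonneg zero_le_two]
  refine (pow_le_pow_left₀ (norm_nonneg _) h 2).trans ?_
  nlinarith [sq_nonneg (‖D (k + 1)‖ - 2 * ‖D k‖), sq_nonneg (‖D (k + 1)‖ - ‖D (k - 1)‖),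
    sq_nonneg (2 * ‖D k‖ - ‖D (k - 1)‖)]

theorem sum_range_shift_le {d : ℕ → ℝ} (hd : ∀ k, 0 ≤ d k) {m i N : ℕ} (h : m + i ≤ N) :
    ∑ j ∈ Finset.range m, d (j + i) ≤ ∑ k ∈ Finset.range N, d k := by
  have e : ∑ j ∈ Finset.range m, d (j + i) = ∑ k ∈ Finset.Ico i (m + i), d k := by
    rw [Finset.sum_Ico_eq_sum_range, Nat.add_sub_cancel]
    exact Finset.sum_congr rfl fun j _ => by rw [add_comm]
  rw [e]
  refine Finset.sum_le_sum_of_subset_of_nonneg (fun k hk => ?_) fun k _ _ => hd k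
  exact Finset.mem_range.2 ((Finset.mem_Ico.1 hk).2.trans_le h)

theorem sum_secDiff_sq_le {D : ℤ → V} (h0 : secDiff D 0 = 0) (hl : secDiff D K = 0) :
    ∑ k ∈ Finset.range (K + 1), ‖secDiff D k‖ ^ 2
      ≤ 18 * ∑ k ∈ Finset.range (K + 1), ‖D k‖ ^ 2 := by
  have hT : 0 ≤ ∑ k ∈ Finset.range (K + 1), ‖D k‖ ^ 2 := Finset.sum_nonneg fun _ _ => sq_nonneg _
  rcases K with _ | _ | n
  · simp [h0]
  · rw [Finset.sum_range_succ, Finset.sum_range_one, hl, Nat.cast_zero, h0]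
    simpa using hT
  rw [Finset.sum_range_succ, Finset.sum_range_succ', hl, Nat.cast_zero, h0, norm_zero]
  have h1 : ∀ j ∈ Finset.range (n + 1), ‖secDiff D (j + 1 : ℕ)‖ ^ 2
      ≤ 3 * (‖D (j + 2 : ℕ)‖ ^ 2 + 4 * ‖D (j + 1 : ℕ)‖ ^ 2 + ‖D (j : ℕ)‖ ^ 2) := fun j _ => by
    have := norm_secDiff_sq_le_add D (j + 1 : ℕ)
    rwa [show ((j + 1 : ℕ) : ℤ) + 1 = ((j + 2 : ℕ) : ℤ) by push_cast; ring,
      show ((j + 1 : ℕ) : ℤ) - 1 = (j : ℤ) by push_cast; ring] at this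
  have h2 := Finset.sum_le_sum h1
  rw [← Finset.mul_sum, Finset.sum_add_distrib, Finset.sum_add_distrib, ← Finset.mul_sum] at h2
  have e0 := sum_range_shift_le (d := fun k : ℕ => ‖D k‖ ^ 2) (fun _ => sq_nonneg _)
    (show n + 1 + 0 ≤ n + 1 + 1 + 1 by omega)
  have e1 := sum_range_shift_le (d := fun k : ℕ => ‖D k‖ ^ 2) (fun _ => sq_nonneg _)
    (show n + 1 + 1 ≤ n + 1 + 1 + 1 by omega)
  have e2 := sum_range_shift_le (d := fun k : ℕ => ‖D k‖ ^ 2) (fun _ => sq_nonneg _)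
    (show n + 1 + 2 ≤ n + 1 + 1 + 1 by omega)
  simp only [add_zero] at e0
  have e3 : (0 : ℝ) ^ 2 = 0 := by norm_num
  rw [e3]
  linarith

/-- In the Hermite case, the recovery nodes differ from the naturally extended nodal values in two
nodes, by an error of higher order. -/
theorem norm_eta_recovery_hermite_le {s : ℝ} (hs : 0 < s) (hKs : K * s ^ 2 = 1) (hK3 : 3 ≤ K) :
    ‖eta (extNode (.hermite (u.v 0) (u.v 1)) (recoveryNodes (.hermite (u.v 0) (u.v 1)) u K)) K
        - eta (nodalExt u K) K‖ ≤ 7 * √(18 * u.edge (s ^ 2)) := by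
  have hs1 := step_le_one hs hKs
  have hK := step_pos hs hKs
  have hK' : (0 : ℝ) < K := by exact_mod_cast hK
  have i1 : (1 / K : ℝ) = s ^ 2 := inv_eq_step_sq hs hKs
  have s21 : s ^ 2 ≤ 1 := pow_le_one₀ hs.le hs1
  set p := recoveryNodes (.hermite (u.v 0) (u.v 1)) u K
  set Y := extNode (.hermite (u.v 0) (u.v 1)) p with hY
  set D := Y - nodalExt u K with hD
  have hn : ∀ k : ℕ, k ≤ K → D k = (if k = 1 then u.c 0 + s ^ 2 • u.v 0
      else if k + 1 = K then u.c 1 - s ^ 2 • u.v 1 else u.c ((k : ℝ) / K)) - u.c ((k : ℝ) / K) :=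
    fun k hk => by
      rw [hD, Pi.sub_apply, isNodal_nodalExt u k hk, hY, extNode_natCast _ _ hk,
        node_recoveryNodes_hermite u hk, i1]
  have z0 : secDiff D 0 = 0 := by
    rw [secDiff_sub, secDiff_nodalExt_zero u hK, hY, secDiff_extNode_zero p hK id, sub_zero]
  have zl : secDiff D K = 0 := by
    rw [secDiff_sub, secDiff_nodalExt_last u hK, hY, secDiff_extNode_last p hK id, sub_zero]
  have b1 := u.edge_left_sq_le (sq_nonneg s) s21
  have b2 := u.edge_right_sq_le (sq_nonneg s) s21
  have d0 : D 0 = 0 := by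
    have := hn 0 (Nat.zero_le _)
    rwa [if_neg (by omega), if_neg (by omega), sub_self] at this
  have d1 : ‖D 1‖ ^ 2 ≤ (s ^ 2) ^ 3 * ∫ x in (0 : ℝ)..(s ^ 2), ‖u.acc.ext0 x‖ ^ 2 := by
    have := hn 1 hK
    rw [if_pos rfl, Nat.cast_one, Nat.cast_one, i1] at this
    rw [this, show u.c 0 + s ^ 2 • u.v 0 - u.c (s ^ 2) = -(u.c (s ^ 2) - u.c 0 - s ^ 2 • u.v 0) by
      abel, norm_neg]
    exact b1
  have dl : ‖D (K - 1 : ℕ)‖ ^ 2 ≤ (s ^ 2) ^ 3 * ∫ x in (1 - s ^ 2)..1, ‖u.acc.ext0 x‖ ^ 2 := by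
    have := hn (K - 1) (Nat.sub_le _ _)
    have q : ((K - 1 : ℕ) : ℝ) / K = 1 - s ^ 2 := by
      rw [Nat.cast_sub hK, Nat.cast_one, sub_div, div_self hK'.ne', i1]
    rw [if_neg (by omega), if_pos (by omega), q] at this
    rw [this, show u.c 1 - s ^ 2 • u.v 1 - u.c (1 - s ^ 2)
      = u.c 1 - u.c (1 - s ^ 2) - s ^ 2 • u.v 1 by abel]
    exact b2
  have hsum : ∑ k ∈ Finset.range (K + 1), ‖D k‖ ^ 2 ≤ s ^ 6 * u.edge (s ^ 2) := by
    have a1 : ∀ k ∈ Finset.range (K + 1), ‖D k‖ ^ 2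
        = (if k = 1 then ‖D 1‖ ^ 2 else 0) + (if k = K - 1 then ‖D (K - 1 : ℕ)‖ ^ 2 else 0) :=
      fun k hk => by
        have hkK := Finset.mem_range.1 hk
        rcases eq_or_ne k 1 with rfl | h1
        · rw [if_pos rfl, if_neg (by omega), add_zero, Nat.cast_one]
        · rw [if_neg h1, zero_add]
          rcases eq_or_ne k (K - 1) with rfl | h2
          · rw [if_pos rfl]
          · rw [if_neg h2, hn k (by omega), if_neg h1, if_neg (by omega), sub_self]
            simp
    rw [Finset.sum_congr rfl a1, Finset.sum_add_distrib, Finset.sum_ite_eq', Finset.sum_ite_eq',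
      if_pos (Finset.mem_range.2 (by omega)), if_pos (Finset.mem_range.2 (by omega)), W22.edge]
    refine (add_le_add d1 dl).trans_eq ?_
    ring
  have hedge : 0 ≤ s ^ 6 * u.edge (s ^ 2) := (Finset.sum_nonneg fun _ _ => sq_nonneg _).trans hsum
  have hedge' : 0 ≤ u.edge (s ^ 2) := nonneg_of_mul_nonneg_right hedge (by positivity)
  have hsq : (s ^ 3 * √(18 * u.edge (s ^ 2))) ^ 2 = 18 * (s ^ 6 * u.edge (s ^ 2)) := by
    rw [mul_pow, Real.sq_sqrt (by positivity)]; ring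
  rw [← eta_sub]
  refine norm_eta_le hs hKs (Real.sqrt_nonneg _) d0 ?_ ?_
  · refine abs_le_of_sq_le_sq' ?_ (by positivity) |>.2
    rw [hsq]
    have := Finset.single_le_sum (f := fun k : ℕ => ‖D k‖ ^ 2) (fun _ _ => sq_nonneg _)
      (Finset.mem_range.2 (show 1 < K + 1 by omega))
    have h2 : ‖D 1‖ ^ 2 ≤ s ^ 6 * u.edge (s ^ 2) := by
      refine le_trans ?_ hsum
      simpa using this
    linarith
  · rw [hsq]
    exact (sum_secDiff_sq_le z0 zl).trans (by gcongr)

end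

end RiemSpline
end

noncomputable section

namespace RiemSpline

variable {V Y : Type*} [NormedAddCommGroup V] [InnerProductSpace ℝ V] [CompleteSpace V]
  [NormedAddCommGroup Y] [NormedSpace ℝ Y] {ι : V →L[ℝ] Y}

theorem BoundaryCondition.holds_hermite_iff {u : W22 V} {v₀ v₁ : V} :
    (BoundaryCondition.hermite v₀ v₁).Holds u ↔ u.v 0 = v₀ ∧ u.v 1 = v₁ :=
  and_congr (u.hasValueAt_vel (left_mem_Icc.2 zero_le_one))
    (u.hasValueAt_vel (right_mem_Icc.2 zero_le_one))

theorem BoundaryCondition.holds_periodic_iff {u : W22 V} :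
    BoundaryCondition.periodic.Holds u ↔ u.c 0 = u.c 1 ∧ u.v 0 = u.v 1 := by
  have h0 : (0 : ℝ) ∈ Icc (0 : ℝ) 1 := left_mem_Icc.2 zero_le_one
  have h1 : (1 : ℝ) ∈ Icc (0 : ℝ) 1 := right_mem_Icc.2 zero_le_one
  constructor
  · rintro ⟨⟨a, a0, a1⟩, b, b0, b1⟩
    exact ⟨((u.hasValueAt_curve h0).1 a0).trans ((u.hasValueAt_curve h1).1 a1).symm,
      ((u.hasValueAt_vel h0).1 b0).trans ((u.hasValueAt_vel h1).1 b1).symm⟩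
  · rintro ⟨hc, hv⟩
    exact ⟨⟨u.c 0, (u.hasValueAt_curve h0).2 rfl, (u.hasValueAt_curve h1).2 hc.symm⟩,
      u.v 0, (u.hasValueAt_vel h0).2 rfl, (u.hasValueAt_vel h1).2 hv.symm⟩

/-- The interpolations of the recovery nodes converge strongly. -/
theorem tendsto_eta_recovery {bc : BoundaryCondition V} {u : W22 V} (hu : bc.Holds u) {κ : ℕ → ℕ}
    (hκ : ∀ n, 0 < κ n) (hκ' : Tendsto κ atTop atTop) :
    Tendsto (fun n => eta (extNode bc (recoveryNodes bc u (κ n))) (κ n)) atTop (𝓝 u) := by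
  have h0 : Tendsto (fun n => eta (nodalExt u (κ n)) (κ n)) atTop (𝓝 u) :=
    tendsto_eta_nodal hκ hκ' (fun n => isNodal_nodalExt u) (fun n => secDiff_nodalExt_zero u (hκ n))
      (fun n => secDiff_nodalExt_last u (hκ n))
  have hs : ∀ n, 0 < √(1 / (κ n : ℝ)) ∧ κ n * √(1 / (κ n : ℝ)) ^ 2 = 1 := fun n => by
    have : (0 : ℝ) < κ n := by exact_mod_cast hκ n
    refine ⟨Real.sqrt_pos.2 (by positivity), ?_⟩
    rw [Real.sq_sqrt (by positivity)]; field_simp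
  suffices h : ∀ᶠ n in atTop, ‖eta (extNode bc (recoveryNodes bc u (κ n))) (κ n)
      - eta (nodalExt u (κ n)) (κ n)‖ ≤ 7 * √(18 * u.edge (√(1 / (κ n : ℝ)) ^ 2)) by
    have h1 : Tendsto (fun n => √(1 / (κ n : ℝ)) ^ 2) atTop (𝓝 0) := by
      have := (tendsto_one_div_atTop_nhds_zero_nat.comp hκ').sqrt.pow 2
      simpa [Function.comp_def] using this
    have h2 : Tendsto (fun n => 7 * √(18 * u.edge (√(1 / (κ n : ℝ)) ^ 2))) atTop (𝓝 0) := by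
      have := ((u.tendsto_edge.comp h1).const_mul 18).sqrt.const_mul 7
      simpa [Function.comp_def] using this
    have h3 := squeeze_zero_norm' h h2
    simpa using h3.add h0
  cases bc with
  | natural =>
    refine Eventually.of_forall fun n => ?_
    rw [nodalExt, sub_self, norm_zero]
    positivity
  | hermite v₀ v₁ =>
    obtain ⟨rfl, rfl⟩ := BoundaryCondition.holds_hermite_iff.1 hu
    filter_upwards [hκ'.eventually_ge_atTop 3] with n hn
    exact norm_eta_recovery_hermite_le u (hs n).1 (hs n).2 hn
  | periodic =>
    obtain ⟨hc, hv⟩ := BoundaryCondition.holds_periodic_iff.1 hu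
    exact Eventually.of_forall fun n => norm_eta_recovery_periodic_le u (hs n).1 (hs n).2 hc hv

theorem discreteHolds_recoveryNodes {bc : BoundaryCondition V} {u : W22 V} (hu : bc.Holds u) {K : ℕ}
    (hK : 3 ≤ K) : bc.DiscreteHolds (recoveryNodes bc u K) := by
  have hK' : (K : ℝ) ≠ 0 := by exact_mod_cast (show K ≠ 0 by omega)
  cases bc with
  | natural => trivial
  | hermite v₀ v₁ =>
    constructor
    · rw [node_recoveryNodes_hermite u (by omega), node_recoveryNodes_hermite u (Nat.zero_le _),
        if_pos rfl, if_neg (by omega), if_neg (by omega), Nat.cast_zero, zero_div,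
        add_sub_cancel_left, smul_smul, mul_one_div_cancel hK', one_smul]
    · rw [node_recoveryNodes_hermite u le_rfl, node_recoveryNodes_hermite u (Nat.sub_le _ _),
        if_neg (by omega), if_neg (by omega), if_neg (by omega), if_pos (by omega),
        div_self hK', sub_sub_cancel, smul_smul, mul_one_div_cancel hK', one_smul]
  | periodic =>
    change node _ _ = node _ _
    rw [node_recoveryNodes_periodic u (Nat.zero_le _), node_recoveryNodes_periodic u le_rfl,
      div_self hK', Nat.cast_zero, zero_div, (BoundaryCondition.holds_periodic_iff.1 hu).1]

theorem recoveryNodes_apply {bc : BoundaryCondition V} {u : W22 V} {K : ℕ} {k : Fin (K + 1)}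
    (h1 : (k : ℕ) ≠ 1) (h2 : (k : ℕ) + 1 ≠ K) : recoveryNodes bc u K k = u.c ((k : ℝ) / K) := by
  cases bc <;> simp [recoveryNodes, h1, h2]

/-- For fine discretizations, the recovery nodes satisfy the interpolation constraints. -/
theorem eventually_recoveryNodes_eq (bc : BoundaryCondition V) {u : W22 V} {κ : ℕ → ℕ}
    (hκ : ∀ n, 0 < κ n) (hκ' : Tendsto κ atTop atTop) {I : ℕ} {t : Fin I → ℝ} {ybar : Fin I → V}
    (ht01 : ∀ i, t i ∈ Icc (0 : ℝ) 1) (hint : ∀ n i, ∃ k : ℕ, (k : ℝ) = κ n * t i)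
    (hu : ∀ i, u.c (t i) = ybar i) :
    ∀ᶠ n in atTop, ∀ i, ∃ k : Fin (κ n + 1), (k : ℝ) = κ n * t i ∧
      recoveryNodes bc u (κ n) k = ybar i := by
  rw [eventually_all]
  intro i
  have hκR : Tendsto (fun n => (κ n : ℝ)) atTop atTop := tendsto_natCast_atTop_atTop.comp hκ'
  -- the modified nodes `1` and `κ n - 1` are eventually no interpolation times
  have h1 : ∀ᶠ n in atTop, (κ n : ℝ) * t i ≠ 1 := by
    rcases (ht01 i).1.eq_or_lt with h | h
    · exact Eventually.of_forall fun n => by rw [← h, mul_zero]; exact zero_ne_one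
    · filter_upwards [(hκR.atTop_mul_const h).eventually_gt_atTop 1] with n hn using hn.ne'
  have h2 : ∀ᶠ n in atTop, (κ n : ℝ) * (1 - t i) ≠ 1 := by
    rcases (ht01 i).2.eq_or_lt with h | h
    · exact Eventually.of_forall fun n => by rw [h, sub_self, mul_zero]; exact zero_ne_one
    · filter_upwards [(hκR.atTop_mul_const (sub_pos.2 h)).eventually_gt_atTop 1]
        with n hn using hn.ne'
  filter_upwards [h1, h2] with n h1 h2
  obtain ⟨k, hk⟩ := hint n i
  have hκ0 : (0 : ℝ) < κ n := by exact_mod_cast hκ n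
  have hkK : k ≤ κ n := by
    have : (k : ℝ) ≤ κ n := hk ▸ mul_le_of_le_one_right hκ0.le (ht01 i).2
    exact_mod_cast this
  refine ⟨⟨k, by omega⟩, hk, ?_⟩
  rw [recoveryNodes_apply]
  · simp only [hk]
    rw [mul_div_cancel_left₀ _ hκ0.ne', hu i]
  · rintro (h : k = 1)
    exact h1 (by rw [← hk, h, Nat.cast_one])
  · rintro (h : k + 1 = κ n)
    refine h2 ?_
    rw [mul_sub, mul_one, ← hk, ← h]
    push_cast; ring

/-! ### The constraints are closed under weak convergence -/

theorem secDiff_tendsto_zero {κ : ℕ → ℕ} (hκ : ∀ n, 0 < κ n) (hκ' : Tendsto κ atTop atTop)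
    {Y : ℕ → ℤ → V} {M : ℝ} (hM : ∀ n, ‖eta (Y n) (κ n)‖ ≤ M) {k : ℕ → ℕ} (hk : ∀ n, k n ≤ κ n) :
    Tendsto (fun n => secDiff (Y n) (k n)) atTop (𝓝 0) := by
  have h1 : Tendsto (fun n => 2 * M * √(1 / (κ n : ℝ)) ^ 3) atTop (𝓝 0) := by
    have := ((tendsto_one_div_atTop_nhds_zero_nat.comp hκ').sqrt.pow 3).const_mul (2 * M)
    simpa [Function.comp_def] using this
  refine squeeze_zero_norm (fun n => ?_) h1
  have : (0 : ℝ) < κ n := by exact_mod_cast hκ n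
  refine norm_secDiff_le (Real.sqrt_pos.2 (by positivity)) ?_ (hM n) (hk n)
  rw [Real.sq_sqrt (by positivity)]; field_simp

variable {bc : BoundaryCondition V} {κ : ℕ → ℕ} {x : ℕ → W22 V} {u : W22 V}
  {p : ∀ n, Fin (κ n + 1) → V}

theorem c_eq_of_weakTendsto (hκ : ∀ n, 0 < κ n) (hκ' : Tendsto κ atTop atTop)
    (hx : WeakTendsto x u) (hp : ∀ n, IsInterp bc (p n) (x n)) {t : ℝ} {y : V}
    (hy : ∀ n, ∃ k : Fin (κ n + 1), (k : ℝ) = κ n * t ∧ p n k = y) : u.c t = y := by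
  obtain ⟨M, hM⟩ := hx.exists_norm_le
  choose k hk hky using hy
  have hxe := fun n => (hp n).eq_eta (hκ n)
  have h1 : Tendsto (fun n => y + (1 / 8 : ℝ) • secDiff (extNode bc (p n)) (k n : ℕ)) atTop
      (𝓝 (y + (1 / 8 : ℝ) • (0 : V))) :=
    ((secDiff_tendsto_zero hκ hκ' (Y := fun n => extNode bc (p n)) (fun n => hxe n ▸ hM n)
      (k := fun n => k n) fun n => Nat.lt_succ_iff.1 (k n).2).const_smul _).const_add _
  rw [smul_zero, add_zero] at h1
  have h2 : (fun n => y + (1 / 8 : ℝ) • secDiff (extNode bc (p n)) (k n : ℕ))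
      = fun n => (x n).c t := by
    ext1 n
    have hkn : (k n : ℕ) ≤ κ n := Nat.lt_succ_iff.1 (k n).2
    have h3 := (eta_node (extNode bc (p n)) (hκ n) hkn).1
    have hκ0 : (0 : ℝ) < κ n := by exact_mod_cast hκ n
    rw [← hxe n, hk n, mul_div_cancel_left₀ _ hκ0.ne',
      extNode_natCast _ _ hkn, node_val, hky n] at h3
    exact h3.symm
  rw [h2] at h1
  exact (hx.map (W22.evalC t)).unique (WeakTendsto.of_tendsto h1)

theorem holds_of_weakTendsto (hκ : ∀ n, 0 < κ n) (hx : WeakTendsto x u)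
    (hp : ∀ n, IsInterp bc (p n) (x n)) (hd : ∀ n, bc.DiscreteHolds (p n)) : bc.Holds u := by
  have hxe := fun n => (hp n).eq_eta (hκ n)
  have hK : ∀ n, (κ n : ℝ) / κ n = 1 := fun n => div_self (by exact_mod_cast (hκ n).ne')
  have ei : ∀ n, ((κ n : ℤ) - 1) = ((κ n - 1 : ℕ) : ℤ) := fun n => by have := hκ n; omega
  have y0 : ∀ n, extNode bc (p n) 0 = node (p n) 0 := fun n => by
    have := extNode_natCast bc (p n) (Nat.zero_le _)
    rwa [Nat.cast_zero] at this
  have yK : ∀ n, extNode bc (p n) (κ n) = node (p n) (κ n) := fun n => extNode_natCast _ _ le_rfl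
  have yl : ∀ n, extNode bc (p n) ((κ n : ℤ) - 1) = node (p n) (κ n - 1) := fun n => by
    rw [ei n]; exact extNode_natCast _ _ (Nat.sub_le _ _)
  have c0 : ∀ n, (x n).c 0
      = extNode bc (p n) 0 + (1 / 8 : ℝ) • secDiff (extNode bc (p n)) 0 := fun n => by
    have := (eta_zero (extNode bc (p n)) (K := κ n)).1
    rwa [← hxe n] at this
  have v0 : ∀ n, (x n).v 0 = (κ n : ℝ) • ((extNode bc (p n) 0 - extNode bc (p n) (-1))
      + (1 / 2 : ℝ) • secDiff (extNode bc (p n)) 0) := fun n => by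
    have := (eta_zero (extNode bc (p n)) (K := κ n)).2
    rwa [← hxe n] at this
  have c1 : ∀ n, (x n).c 1
      = extNode bc (p n) (κ n : ℕ) + (1 / 8 : ℝ) • secDiff (extNode bc (p n)) (κ n : ℕ) :=
      fun n => by
    have := (eta_node (extNode bc (p n)) (hκ n) le_rfl).1
    rwa [← hxe n, hK n] at this
  have v1 : ∀ n, (x n).v 1
      = (κ n : ℝ) • ((extNode bc (p n) (κ n : ℕ) - extNode bc (p n) ((κ n : ℤ) - 1))
      + (1 / 2 : ℝ) • secDiff (extNode bc (p n)) (κ n : ℕ)) := fun n => by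
    have := (eta_node (extNode bc (p n)) (hκ n) le_rfl).2
    rwa [← hxe n, hK n] at this
  cases bc with
  | natural => trivial
  | hermite v₀ v₁ =>
    rw [BoundaryCondition.holds_hermite_iff]
    constructor
    · refine (hx.map (W22.evalV 0)).unique ?_
      have : (fun n => W22.evalV 0 (x n)) = fun _ => v₀ := by
        ext1 n
        refine Eq.trans ?_ (hd n).1
        rw [W22.evalV_apply, v0 n, secDiff_extNode_zero (bc := .hermite v₀ v₁) (p n) (hκ n) id,
          smul_zero, add_zero, extNode_neg_one,
          leftGhost_of_not_periodic (bc := .hermite v₀ v₁) (p := p n) id, y0]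
        module
      rw [this]; exact weakTendsto_const _
    · refine (hx.map (W22.evalV 1)).unique ?_
      have : (fun n => W22.evalV 1 (x n)) = fun _ => v₁ := by
        ext1 n
        refine Eq.trans ?_ (hd n).2
        rw [W22.evalV_apply, v1 n, secDiff_extNode_last (bc := .hermite v₀ v₁) (p n) (hκ n) id,
          smul_zero, add_zero, yK, yl]
      rw [this]; exact weakTendsto_const _
  | periodic =>
    rw [BoundaryCondition.holds_periodic_iff]
    have hsd := fun n => secDiff_extNode_periodic (p n) (hκ n) (bc := .periodic) trivial (hd n)
    constructor
    · refine (hx.map (W22.evalC 0)).unique ?_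
      have : (fun n => W22.evalC 0 (x n)) = fun n => W22.evalC 1 (x n) := by
        ext1 n
        rw [W22.evalC_apply, W22.evalC_apply, c0 n, c1 n, hsd n, y0, yK, hd n]
      rw [this]; exact hx.map (W22.evalC 1)
    · refine (hx.map (W22.evalV 0)).unique ?_
      have : (fun n => W22.evalV 0 (x n)) = fun n => W22.evalV 1 (x n) := by
        ext1 n
        rw [W22.evalV_apply, W22.evalV_apply, v0 n, v1 n, hsd n, y0, yK, yl, hd n, extNode_neg_one]
        rfl
      rw [this]; exact hx.map (W22.evalV 1)

theorem constraint_eq_zero_iff {I : ℕ} {t : Fin I → ℝ} (ht01 : ∀ i, t i ∈ Icc (0 : ℝ) 1)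
    {ybar : Fin I → V} :
    constraint t ybar bc u = 0 ↔ (∀ i, u.c (t i) = ybar i) ∧ bc.Holds u := by
  have e : (∀ i, HasValueAt u.curve (t i) (ybar i)) ↔ ∀ i, u.c (t i) = ybar i :=
    forall_congr' fun i => u.hasValueAt_curve (ht01 i)
  rw [constraint, ← e]
  split_ifs with h
  · exact iff_of_true rfl h
  · exact iff_of_false ENNReal.top_ne_zero h

theorem constraint_eq_top_of_ne_zero {I : ℕ} {t : Fin I → ℝ} {ybar : Fin I → V}
    (h : constraint t ybar bc u ≠ 0) : constraint t ybar bc u = ⊤ := by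
  simp only [constraint] at h ⊢
  split_ifs with h1
  · rw [if_pos h1] at h; exact absurd rfl h
  · rfl

/-- Where the constrained discrete functional is small, the curve interpolates a discrete path of
small energy that satisfies the constraints. -/
theorem exists_path_of_lt {W : V → V → ℝ} {σ : ℝ} {I K : ℕ} (hK : 0 < K)
    {m : (Fin (K + 1) → V) → ℕ → V} {t : Fin I → ℝ} {ybar : Fin I → V} {a : ℝ≥0∞}
    (h : discreteRegSplineEnergy W σ bc K m u + discreteConstraint t ybar bc K u < a) :
    ∃ p : Fin (K + 1) → V, IsInterp bc p u ∧
      ENNReal.ofReal (discreteSplineEnergy W bc p (m p) + σ * discretePathEnergy W p) < a ∧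
      (∀ i, ∃ k : Fin (K + 1), (k : ℝ) = K * t i ∧ p k = ybar i) ∧ bc.DiscreteHolds p := by
  have h1 := lt_of_le_of_lt le_self_add h
  have h2 := (lt_of_le_of_lt le_add_self h).trans_le le_top
  simp only [discreteRegSplineEnergy, liftDiscrete, iInf_lt_iff] at h1
  simp only [discreteConstraint, liftDiscrete, iInf_lt_iff] at h2
  obtain ⟨p, hp, hpa⟩ := h1
  obtain ⟨q, hq, hqa⟩ := h2
  obtain rfl := hp.unique hK hq
  refine ⟨p, hp, hpa, ?_⟩
  by_contra hne
  rw [if_neg hne] at hqa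
  exact lt_irrefl _ hqa

end RiemSpline
end

noncomputable section

namespace RiemSpline

variable {V Y : Type*} [NormedAddCommGroup V] [InnerProductSpace ℝ V] [CompleteSpace V]
  [NormedAddCommGroup Y] [NormedSpace ℝ Y] {ι : V →L[ℝ] Y}

/-! ### The two inequalities of the Gamma-limit -/

section GammaLimit

theorem liftDiscrete_le {bc : BoundaryCondition V} {K : ℕ} {Φ : (Fin (K + 1) → V) → ℝ≥0∞}
    {u : W22 V} {p : Fin (K + 1) → V} (hp : IsInterp bc p u) : liftDiscrete bc Φ u ≤ Φ p :=
  iInf₂_le p hp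

variable {G : AdmissibleMetric ι} {σ : ℝ} {I : ℕ} {t : Fin I → ℝ} {ybar : Fin I → V}
  {bc : BoundaryCondition V} {κ : ℕ → ℕ}

/-- The liminf inequality.  If it fails, a subsequence of the discrete functionals stays below some
`c` less than the limit functional; the curves of the subsequence interpolate admissible discrete
paths, so the weak limit satisfies the constraints, and consistency together with weak lower
semicontinuity of the energy gives a contradiction. -/
theorem AdmissibleEnergy.le_liminf (hι : IsCompactOperator ι) (A : AdmissibleEnergy G) (hσ : 0 < σ)
    (ht01 : ∀ i, t i ∈ Icc (0 : ℝ) 1) {m : (K : ℕ) → (Fin (K + 1) → V) → ℕ → V}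
    (hm : ∀ (K : ℕ) (p : Fin (K + 1) → V), IsAux A.W bc p (m K p)) (hκ : ∀ n, 0 < κ n)
    (hκ' : Tendsto κ atTop atTop) {u : W22 V} {x : ℕ → W22 V} (hx : WeakTendsto x u) :
    G.regSplineEnergy σ u + constraint t ybar bc u
      ≤ liminf (fun n => discreteRegSplineEnergy A.W σ bc (κ n) (m (κ n)) (x n) +
          discreteConstraint t ybar bc (κ n) (x n)) atTop := by
  by_contra! hlt
  obtain ⟨c, hc1, hc2⟩ := exists_between hlt
  obtain ⟨φ, hφ, hφc⟩ := extraction_of_frequently_atTop (frequently_lt_of_liminf_lt (h := hc1))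
  have hpath := fun n => exists_path_of_lt (hκ (φ n)) (hφc n)
  choose p hp hpc hpt hpd using hpath
  have hx' : WeakTendsto (x ∘ φ) u := hx.subseq hφ.tendsto_atTop
  have hκφ : Tendsto (κ ∘ φ) atTop atTop := hκ'.comp hφ.tendsto_atTop
  have hκ0 : ∀ n, 0 < (κ ∘ φ) n := fun n => hκ _
  -- the constraints are closed under weak convergence, so the weak limit is admissible
  have hcon : constraint t ybar bc u = 0 := (constraint_eq_zero_iff ht01).2
    ⟨fun i => c_eq_of_weakTendsto hκ0 hκφ hx' hp fun n => hpt n i,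
      holds_of_weakTendsto hκ0 hx' hp hpd⟩
  rw [hcon, add_zero, G.regSplineEnergy_eq hσ.le] at hc2
  have hc3 : c.toReal < G.energy σ u := (ENNReal.lt_ofReal_iff_toReal_lt hc2.ne_top).1 hc2
  obtain ⟨M, hM⟩ := hx'.exists_norm_le
  obtain ⟨e, he, K₀, hcons⟩ := A.exists_consistency M σ
  have hε : 0 < (G.energy σ u - c.toReal) / 3 := by linarith
  obtain ⟨n, h1, h2, h3⟩ := ((G.eventually_energy_le hι hσ hx' hε).and
    ((hκφ.eventually_ge_atTop K₀).and
      ((he.comp hκφ).eventually (gt_mem_nhds hε)))).exists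
  have h4 := (abs_le.1 (hcons _ bc (p n) _ _ h2 (hM n) (hp n) (hm _ (p n)))).1
  have h5 : discreteSplineEnergy A.W bc (p n) (m (κ (φ n)) (p n)) + σ * discretePathEnergy A.W (p n)
      ≤ c.toReal :=
    (ENNReal.ofReal_le_iff_le_toReal hc2.ne_top).1 (hpc n).le
  simp only [Function.comp_apply] at h1 h3 h4
  linarith

/-- Along the recovery sequence the discrete functionals are asymptotically at most the limit
energy. -/
theorem AdmissibleEnergy.limsup_recovery_le (A : AdmissibleEnergy G) (hσ : 0 < σ)
    (ht01 : ∀ i, t i ∈ Icc (0 : ℝ) 1) {m : (K : ℕ) → (Fin (K + 1) → V) → ℕ → V}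
    (hm : ∀ (K : ℕ) (p : Fin (K + 1) → V), IsAux A.W bc p (m K p)) (hκ : ∀ n, 0 < κ n)
    (hκ' : Tendsto κ atTop atTop) (hint : ∀ n i, ∃ k : ℕ, (k : ℝ) = κ n * t i) {u : W22 V}
    (hu : ∀ i, u.c (t i) = ybar i) (hbu : bc.Holds u) :
    limsup (fun n => discreteRegSplineEnergy A.W σ bc (κ n) (m (κ n))
        (eta (extNode bc (recoveryNodes bc u (κ n))) (κ n)) +
      discreteConstraint t ybar bc (κ n) (eta (extNode bc (recoveryNodes bc u (κ n))) (κ n))) atTop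
      ≤ G.regSplineEnergy σ u := by
  have hx := tendsto_eta_recovery hbu hκ hκ'
  obtain ⟨M, hM⟩ := (WeakTendsto.of_tendsto hx).exists_norm_le
  obtain ⟨e, he, K₀, hcons⟩ := A.exists_consistency M σ
  have hlim : Tendsto (fun n => ENNReal.ofReal
      (G.energy σ (eta (extNode bc (recoveryNodes bc u (κ n))) (κ n)) + e (κ n))) atTop
      (𝓝 (G.regSplineEnergy σ u)) := by
    rw [G.regSplineEnergy_eq hσ.le]
    refine ENNReal.tendsto_ofReal ?_
    simpa using (G.tendsto_energy hx).add (he.comp hκ')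
  rw [← hlim.limsup_eq]
  refine limsup_le_limsup ?_
  filter_upwards [hκ'.eventually_ge_atTop 3, hκ'.eventually_ge_atTop K₀,
    eventually_recoveryNodes_eq bc hκ hκ' ht01 hint hu] with n h3 hK hn
  have hd := discreteHolds_recoveryNodes hbu h3
  have hp : IsInterp bc (recoveryNodes bc u (κ n))
      (eta (extNode bc (recoveryNodes bc u (κ n))) (κ n)) := by
    refine isInterp_eta (hκ n) fun h => ?_
    cases bc with
    | natural => exact h.elim
    | hermite v₀ v₁ => exact h.elim
    | periodic => exact hd
  have h0 : discreteConstraint t ybar bc (κ n)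
      (eta (extNode bc (recoveryNodes bc u (κ n))) (κ n)) ≤ 0 := by
    have hc : (∀ i, ∃ k : Fin (κ n + 1), (k : ℝ) = κ n * t i ∧
        recoveryNodes bc u (κ n) k = ybar i) ∧ bc.DiscreteHolds (recoveryNodes bc u (κ n)) :=
      ⟨hn, hd⟩
    exact (liftDiscrete_le hp).trans (by rw [if_pos hc])
  refine (add_le_add (liftDiscrete_le hp) h0).trans ?_
  rw [add_zero]
  refine ENNReal.ofReal_le_ofReal ?_
  linarith [(abs_le.1 (hcons _ bc _ _ _ hK (hM n) hp (hm _ _))).2]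

end GammaLimit

end RiemSpline
end

theorem theorem4p6
    {V Y : Type*} [NormedAddCommGroup V] [InnerProductSpace ℝ V] [CompleteSpace V]
    [TopologicalSpace.SeparableSpace V]
    [NormedAddCommGroup Y] [NormedSpace ℝ Y] [CompleteSpace Y]
    (ι : V →L[ℝ] Y) (hι_inj : Function.Injective ι) (hι_cpt : IsCompactOperator ι)
    (G : RiemSpline.AdmissibleMetric ι) (A : RiemSpline.AdmissibleEnergy G)
    (σ : ℝ) (hσ : 0 < σ)
    {I : ℕ} (t : Fin I → ℝ) (ht : StrictMono t) (ht01 : ∀ i, t i ∈ Set.Icc (0 : ℝ) 1)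
    (ybar : Fin I → V)
    (bc : RiemSpline.BoundaryCondition V) (hbc : bc.Compatible t) :
    (∀ a b : V, ∃ z : V, RiemSpline.IsMidpoint A.W a b z) ∧
    ∀ (m : (K : ℕ) → (Fin (K + 1) → V) → ℕ → V),
      (∀ (K : ℕ) (p : Fin (K + 1) → V), RiemSpline.IsAux A.W bc p (m K p)) →
      ∀ κ : ℕ → ℕ, (∀ n, 0 < κ n) → Filter.Tendsto κ Filter.atTop Filter.atTop →
        (∀ n i, ∃ k : ℕ, (k : ℝ) = κ n * t i) →
        RiemSpline.GammaTendsto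
          (fun n u => RiemSpline.discreteRegSplineEnergy A.W σ bc (κ n) (m (κ n)) u +
            RiemSpline.discreteConstraint t ybar bc (κ n) u)
          (fun u => G.regSplineEnergy σ u + RiemSpline.constraint t ybar bc u) := by
  refine ⟨fun a b => A.exists_midpoint a b, fun m hm κ hκ hκ' hint =>
    ⟨fun u x hx => A.le_liminf hι_cpt hσ ht01 hm hκ hκ' hx, fun u => ?_⟩⟩
  beta_reduce
  by_cases hcon : RiemSpline.constraint t ybar bc u = 0
  · obtain ⟨hu, hbu⟩ := (RiemSpline.constraint_eq_zero_iff ht01).1 hcon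
    refine ⟨_, RiemSpline.WeakTendsto.of_tendsto (RiemSpline.tendsto_eta_recovery hbu hκ hκ'), ?_⟩
    rw [hcon, add_zero]
    exact A.limsup_recovery_le hσ ht01 hm hκ hκ' hint hu hbu
  · refine ⟨fun _ => u, RiemSpline.weakTendsto_const u, ?_⟩
    rw [RiemSpline.constraint_eq_top_of_ne_zero hcon, add_top]
    exact le_top
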